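/- **Theorem.** Let $\omega=\omega_1\,dx+\omega_2\,dy+\omega_3\,dz$ be a germ at $0\in\mathbb C^3$ of a holomorphic $1$-form which is integrable, i.e. $\omega\wedge d\omega=0$ near $0$. Let $\operatorname{rot}(\omega)$ denote the unique vector field $X$ with $d\omega=\imath_X(dx\wedge dy\wedge dz)$, and suppose that $0$ is a simple singularity of $\omega$: $\omega(0)=0$, and either $d\omega(0)\neq 0$ or $0$ is an isolated zero of $d\omega$. Then the tangent sheaf $\operatorname{Ker}(\omega)$ (the sheaf of holomorphic vector fields $Z$ with $\omega(Z)=0$) is locally free at $0$. More precisely, there are an open neighbourhood $U$ of $0$ and a holomorphic vector field $S$ on $U$ such that $\operatorname{rot}(\omega)$ and $S$ form a free basis of the $\mathcal O_U$-module $\operatorname{Ker}(\omega)|_U$, and $S$ has non-zero linear part at $0$, i.e. $DS(0)\neq 0$. If, moreover, the singular set $\{\omega=0\}$ has codimension at least two at $0$, then $S$ can be chosen to satisfy in addition $S(0)=0$. -/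

import Mathlib

open Filter Topology

namespace SimpleSing

/-- Complex affine space `ℂ³` with coordinates `(x, y, z) = (p 0, p 1, p 2)`. -/
abbrev C3 : Type := Fin 3 → ℂ

/-- Differential 1-forms on `ℂ³`. A holomorphic germ of 1-form at `0` is represented by such a map
which is analytic at `0`; all notions below only depend on the germ. -/
abbrev OneForm : Type := C3 → C3 [⋀^Fin 1]→L[ℂ] ℂ

/-- The standard basis vectors, i.e. the constant vector fields `∂/∂x, ∂/∂y, ∂/∂z`. -/
abbrev e (i : Fin 3) : C3 := Pi.single i 1

/-- The volume form `dx ∧ dy ∧ dz`. -/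
noncomputable def vol : C3 [⋀^Fin 3]→L[ℂ] ℂ :=
  { (Matrix.detRowAlternating : C3 [⋀^Fin 3]→ₗ[ℂ] ℂ) with
    cont := by
      change Continuous fun M : Matrix (Fin 3) (Fin 3) ℂ => M.det
      exact continuous_id.matrix_det }

/-- The contraction `ω(Z)` of a 1-form with a vector field. -/
noncomputable def contract (ω : OneForm) (Z : C3 → C3) (p : C3) : ℂ := ω p ![Z p]

/-- The 3-form `α ∧ β` of a 1-covector `α` and a 2-covector `β`, evaluated at `(u, v, w)`. -/
noncomputable def wedge (α : C3 [⋀^Fin 1]→L[ℂ] ℂ) (β : C3 [⋀^Fin 2]→L[ℂ] ℂ) (u v w : C3) : ℂ :=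
  α ![u] * β ![v, w] - α ![v] * β ![u, w] + α ![w] * β ![u, v]

/-- The germ of `ω` at `0` is integrable: `ω ∧ dω = 0` near `0`. -/
def IsIntegrable (ω : OneForm) : Prop :=
  ∀ᶠ p in 𝓝 (0 : C3), ∀ u v w : C3, wedge (ω p) (extDeriv ω p) u v w = 0

/-- The rotational of `ω`, written in coordinates; see `eq_rot_iff` for its characterization
`rot ω = X ↔ dω = ι_X (dx ∧ dy ∧ dz)`. -/
noncomputable def rot (ω : OneForm) (p : C3) : C3 :=
  ![extDeriv ω p ![e 1, e 2], extDeriv ω p ![e 2, e 0], extDeriv ω p ![e 0, e 1]]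

theorem vol_apply (u v w : C3) : vol ![u, v, w] = Matrix.det (Matrix.of ![u, v, w]) := rfl

theorem eq_rot_iff (ω : OneForm) (p X : C3) :
    X = rot ω p ↔ extDeriv ω p = vol.curryLeft X := by
  constructor
  · rintro rfl
    have key : (extDeriv ω p).toAlternatingMap = (vol.curryLeft (rot ω p)).toAlternatingMap := by
      refine Module.Basis.ext_alternating (Pi.basisFun ℂ (Fin 3)) fun v hv => ?_
      have hv01 : v 0 ≠ v 1 := fun h => by simpa using hv h
      have hfun : (fun i => Pi.basisFun ℂ (Fin 3) (v i)) = ![e (v 0), e (v 1)] := by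
        funext i; fin_cases i <;> simp [e]
      rw [hfun]
      change extDeriv ω p ![e (v 0), e (v 1)] = vol ![rot ω p, e (v 0), e (v 1)]
      have sw : ∀ a b : C3, extDeriv ω p ![a, b] = - extDeriv ω p ![b, a] := by
        intro a b
        have := (extDeriv ω p).toAlternatingMap.map_swap ![b, a] (i := 0) (j := 1) (by decide)
        have h2 : ![b, a] ∘ Equiv.swap (0 : Fin 2) 1 = ![a, b] := by
          funext i; fin_cases i <;> simp
        rw [h2] at this
        exact this
      rw [vol_apply, Matrix.det_fin_three]
      generalize v 0 = i at *
      generalize v 1 = j at *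
      have h10 := sw (e 1) (e 0)
      have h21 := sw (e 2) (e 1)
      have h02 := sw (e 0) (e 2)
      fin_cases i <;> fin_cases j <;>
        first
        | exact absurd rfl hv01
        | (simp [rot, e] at *; try assumption)
    exact ContinuousAlternatingMap.toAlternatingMap_injective key
  · intro h
    have hd : ∀ a b : C3, extDeriv ω p ![a, b] = vol ![X, a, b] := fun a b => by
      rw [h]; rfl
    funext i
    fin_cases i <;> simp [rot, hd, vol_apply, Matrix.det_fin_three, e]

/-- `0` is a simple singularity of `ω`: `ω(0) = 0`, and either `dω(0) ≠ 0`, or `0` is an isolated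
zero of `dω`. -/
def IsSimpleSingularity (ω : OneForm) : Prop :=
  ω 0 = 0 ∧ (extDeriv ω 0 ≠ 0 ∨
    (extDeriv ω 0 = 0 ∧ ∀ᶠ p in 𝓝[≠] (0 : C3), extDeriv ω p ≠ 0))

/-- The germ at `0` of the singular set `{ω = 0}` has codimension at least two, i.e. it contains
no germ of analytic hypersurface `{f = 0}` through `0`. -/
def SingCodimGETwo (ω : OneForm) : Prop :=
  ¬ ∃ f : C3 → ℂ, AnalyticAt ℂ f 0 ∧ f 0 = 0 ∧ (¬ ∀ᶠ p in 𝓝 (0 : C3), f p = 0) ∧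
    ∀ᶠ p in 𝓝 (0 : C3), f p = 0 → ω p = 0

/-- `Z` is a section over the open set `V` of the tangent sheaf `Ker ω`: a holomorphic
vector field on `V` with `ω(Z) = 0`. -/
def IsTangentSection (ω : OneForm) (V : Set C3) (Z : C3 → C3) : Prop :=
  AnalyticOnNhd ℂ Z V ∧ ∀ p ∈ V, contract ω Z p = 0

/-- The vector fields `Y i` generate the sheaf `Ker ω` freely over the open set `U`:
`(a i) ↦ ∑ i, a i • Y i` is an isomorphism from `𝒪_U ^ r` onto the restriction of
`Ker ω` to `U`, i.e. it is bijective on sections over every open `V ⊆ U`. -/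
structure IsFreeFrame (ω : OneForm) (U : Set C3) {r : ℕ} (Y : Fin r → C3 → C3) : Prop where
  analytic : AnalyticOnNhd ℂ ω U
  tangent : ∀ i, IsTangentSection ω U (Y i)
  generate : ∀ V : Set C3, IsOpen V → V ⊆ U → ∀ Z : C3 → C3, IsTangentSection ω V Z →
    ∃ a : Fin r → C3 → ℂ, (∀ i, AnalyticOnNhd ℂ (a i) V) ∧ ∀ p ∈ V, Z p = ∑ i, a i p • Y i p
  unique : ∀ V : Set C3, IsOpen V → V ⊆ U → ∀ a b : Fin r → C3 → ℂ,
    (∀ i, AnalyticOnNhd ℂ (a i) V) → (∀ i, AnalyticOnNhd ℂ (b i) V) →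
    (∀ p ∈ V, ∑ i, a i p • Y i p = ∑ i, b i p • Y i p) → ∀ i, ∀ p ∈ V, a i p = b i p

/-- The tangent sheaf `Ker ω` is locally free at `0`: it is free of finite rank over some open
neighbourhood of `0`. -/
def TangentSheafLocallyFree (ω : OneForm) : Prop :=
  ∃ U : Set C3, IsOpen U ∧ (0 : C3) ∈ U ∧ ∃ (r : ℕ) (Y : Fin r → C3 → C3), IsFreeFrame ω U Y

end SimpleSing

/-! Let `w` be the vector of components of `ω` and `X = rot ω`, so that `X = curl w`; integrability
says `w · X = 0`. Either some component of `X` is a unit, or the components of `X` have an isolated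
common zero. In the second case the Nullstellensatz puts powers of the three coordinates into the
ideal `(X)`. These powers form a regular sequence, so the Koszul complex of `X` is exact
(`exists_cross_of_dot_eq_zero`); with a unit component exactness is elementary. Every vector
orthogonal to `X` is therefore of the form `S × X`.

Split off a common factor, `w = g W`, so that the ideal `(W)` contains, in suitable coordinates, a
monic polynomial `F` in the last variable and a nonzero germ `ρ` in the other variables
(`exists_common_factor`). Since `W · X = 0`, also `W = S × X`. If `ω(Z) = 0`, then `Z × X` and `S ×
Z` are parallel to `W`. The pair `F`, `ρ` forces them to be multiples `β W` and `α W`, whence `Z = α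
X + β S` (`exists_combination`). Weierstrass division at nearby points shows that `F` and `ρ` keep
this property there, so `X` and `S` are a frame on a whole neighbourhood.

For the linear part, suppose first `g = 1`. The equation `X = curl (S × X)` with `div X = 0` reads
`X = (X·∇)S - (div S) X - (S·∇)X`. If `S` vanished to order two, each term on the right would vanish
to higher order than `X`, so `X` would be flat, contradicting that `(X)` contains a power of a
coordinate. If `X(0) = 0`, the same equation shows that `S·∇` preserves the ideal `(X)`. Applied to
the least power of `x_i` in that ideal, this gives `S_i(0) = 0`. If `X(0) ≠ 0`, then `S(0)` is a
multiple of `X(0)` and can be subtracted off. A unit `g` is absorbed into `S`; a non-unit `g` makes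
`{ω = 0}` contain a hypersurface.

The local algebra (Weierstrass division and preparation, factoriality, the Nullstellensatz for
isolated zeros) is derived from the analytic dependence of an invertible division operator on
parameters. -/

namespace SimpleSing

/-! ### Analyticity of superposition operators on spaces of continuous functions. -/

section Superposition

variable {K : Type*} [TopologicalSpace K] [CompactSpace K]
  {G : Type*} [NormedAddCommGroup G] [NormedSpace ℂ G]

/-- Pointwise application of a multilinear form to continuous functions. -/
noncomputable def superMultilinear (n : ℕ) (p : G [×n]→L[ℂ] ℂ) : C(K, G) [×n]→L[ℂ] C(K, ℂ) :=
  MultilinearMap.mkContinuous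
    { toFun := fun y => ⟨fun k => p fun i => y i k, by fun_prop⟩
      map_update_add' := by
        intro _ m i x y
        ext k
        have key : ∀ w : C(K, G), (fun j => (Function.update m i w) j k)
            = Function.update (fun j => m j k) i (w k) := by
          intro w; funext j
          by_cases h : j = i
          · subst h; simp
          · simp [h]
        simp only [ContinuousMap.coe_mk, ContinuousMap.add_apply, key, p.map_update_add]
      map_update_smul' := by
        intro _ m i c x
        ext k
        have key : ∀ w : C(K, G), (fun j => (Function.update m i w) j k)
            = Function.update (fun j => m j k) i (w k) := by
          intro w; funext j
          by_cases h : j = i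
          · subst h; simp
          · simp [h]
        simp only [ContinuousMap.coe_mk, ContinuousMap.smul_apply, key, p.map_update_smul] }
    ‖p‖ (by
      intro m
      rw [ContinuousMap.norm_le _ (by positivity)]
      intro k
      refine (p.le_opNorm _).trans ?_
      gcongr with i
      exact ContinuousMap.norm_coe_le_norm _ _)

theorem norm_superMultilinear_le (n : ℕ) (p : G [×n]→L[ℂ] ℂ) :
    ‖superMultilinear (K := K) n p‖ ≤ ‖p‖ :=
  MultilinearMap.mkContinuous_norm_le _ (norm_nonneg _) _

/-- The superposition operator `y ↦ f ∘ y` of a function which is analytic on a ball is analytic. -/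
theorem exists_superposition {f : G → ℂ} {p : FormalMultilinearSeries ℂ G ℂ} {r : ENNReal}
    (hf : HasFPowerSeriesOnBall f p 0 r) :
    ∃ Φ : C(K, G) → C(K, ℂ), AnalyticOnNhd ℂ Φ (Metric.eball 0 r) ∧
      ∀ y ∈ Metric.eball (0 : C(K, G)) r, ∀ k, Φ y k = f (y k) := by
  let P : FormalMultilinearSeries ℂ C(K, G) C(K, ℂ) := fun n => superMultilinear n (p n)
  -- Applying the coefficients pointwise does not increase their norms, so the radius of convergence
  -- does not shrink.
  have hrad : p.radius ≤ P.radius := by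
    refine ENNReal.le_of_forall_nnreal_lt fun s hs => ?_
    obtain ⟨C, -, hC⟩ := p.norm_mul_pow_le_of_lt_radius hs
    refine P.le_radius_of_bound C fun n => le_trans ?_ (hC n)
    gcongr
    exact norm_superMultilinear_le _ _
  have hP := P.hasFPowerSeriesOnBall (hf.r_pos.trans_le (hf.r_le.trans hrad))
  refine ⟨P.sum, fun y hy => ?_, fun y hy k => ?_⟩
  · exact hP.analyticAt_of_mem (Metric.eball_subset_eball (hf.r_le.trans hrad) hy)
  · have hy' := hP.hasSum (Metric.eball_subset_eball (hf.r_le.trans hrad) hy)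
    have h1 := hy'.mapL (ContinuousMap.evalCLM ℂ k)
    have hk : y k ∈ Metric.eball (0 : G) r := by
      rw [Metric.mem_eball, edist_zero_right] at hy ⊢
      refine lt_of_le_of_lt ?_ hy
      rw [enorm_le_iff_norm_le]
      exact ContinuousMap.norm_coe_le_norm _ _
    have h2 := hf.hasSum hk
    simp only [zero_add] at h1 h2
    exact h1.unique h2

end Superposition

end SimpleSing

namespace SimpleSing

/-! ### Power series as bounded sequences, and the functional calculus of the shift. -/

section Shift

/-- The Banach space of bounded sequences, thought of as coefficient sequences of functions on the
unit disc. -/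
def BSeq : Type := BoundedContinuousFunction ℕ ℂ

namespace BSeq

noncomputable instance : NormedAddCommGroup BSeq :=
  inferInstanceAs (NormedAddCommGroup (BoundedContinuousFunction ℕ ℂ))

noncomputable instance : NormedSpace ℂ BSeq :=
  inferInstanceAs (NormedSpace ℂ (BoundedContinuousFunction ℕ ℂ))

instance : CompleteSpace BSeq :=
  inferInstanceAs (CompleteSpace (BoundedContinuousFunction ℕ ℂ))

/-- The sequence with given bounded terms. -/
noncomputable def mk (f : ℕ → ℂ) (C : ℝ) (h : ∀ n, ‖f n‖ ≤ C) : BSeq :=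
  BoundedContinuousFunction.ofNormedAddCommGroup f continuous_of_discreteTopology C h

/-- The terms of a sequence. -/
noncomputable def coeff (n : ℕ) (a : BSeq) : ℂ :=
  (show BoundedContinuousFunction ℕ ℂ from a) n

@[simp] theorem coeff_mk (f : ℕ → ℂ) (C : ℝ) (h : ∀ n, ‖f n‖ ≤ C) (n : ℕ) :
    coeff n (mk f C h) = f n := rfl

@[simp] theorem coeff_add (n : ℕ) (a b : BSeq) : coeff n (a + b) = coeff n a + coeff n b := rfl

@[simp] theorem coeff_sub (n : ℕ) (a b : BSeq) : coeff n (a - b) = coeff n a - coeff n b := rfl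

@[simp] theorem coeff_smul (n : ℕ) (c : ℂ) (a : BSeq) : coeff n (c • a) = c * coeff n a := rfl

@[simp] theorem coeff_zero (n : ℕ) : coeff n 0 = 0 := rfl

theorem norm_coeff_le (n : ℕ) (a : BSeq) : ‖coeff n a‖ ≤ ‖a‖ :=
  BoundedContinuousFunction.norm_coe_le_norm (f := a) n

theorem norm_le {a : BSeq} {C : ℝ} (hC : 0 ≤ C) (h : ∀ n, ‖coeff n a‖ ≤ C) : ‖a‖ ≤ C :=
  (BoundedContinuousFunction.norm_le (f := a) hC).2 h

@[ext] theorem ext {a b : BSeq} (h : ∀ n, coeff n a = coeff n b) : a = b :=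
  BoundedContinuousFunction.ext (f := a) (g := b) h

/-- The first term, as a continuous linear form. -/
noncomputable def coeffL : BSeq →L[ℂ] ℂ :=
  LinearMap.mkContinuous
    { toFun := coeff 0
      map_add' := fun _ _ => rfl
      map_smul' := fun _ _ => rfl } 1 (by
    intro a
    rw [one_mul]
    exact norm_coeff_le 0 a)

end BSeq

open BSeq

/-- The left shift of sequences. -/
noncomputable def leftShift : BSeq →L[ℂ] BSeq :=
  LinearMap.mkContinuous
    { toFun := fun a => mk (fun n => coeff (n + 1) a) ‖a‖ fun n => norm_coeff_le _ a
      map_add' := fun _ _ => rfl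
      map_smul' := fun _ _ => rfl } 1 (by
    intro a
    rw [one_mul]
    exact norm_le (norm_nonneg _) fun n => norm_coeff_le _ a)

@[simp] theorem coeff_leftShift (a : BSeq) (n : ℕ) : coeff n (leftShift a) = coeff (n + 1) a := rfl

theorem norm_leftShift_le : ‖leftShift‖ ≤ 1 :=
  LinearMap.mkContinuous_norm_le _ zero_le_one _

theorem norm_consZero_le (a : BSeq) (n : ℕ) :
    ‖(Nat.casesOn n 0 fun m => coeff m a : ℂ)‖ ≤ ‖a‖ := by
  cases n with
  | zero => simp
  | succ n => exact norm_coeff_le n a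

/-- The right shift of sequences. -/
noncomputable def rightShift : BSeq →L[ℂ] BSeq :=
  LinearMap.mkContinuous
    { toFun := fun a => mk (fun n => Nat.casesOn n 0 fun m => coeff m a) ‖a‖ (norm_consZero_le a)
      map_add' := fun a b => by
        ext n; cases n <;> simp
      map_smul' := fun c a => by
        ext n; cases n <;> simp } 1 (by
    intro a
    rw [one_mul]
    exact norm_le (norm_nonneg _) (norm_consZero_le a))

@[simp] theorem coeff_zero_rightShift (a : BSeq) : coeff 0 (rightShift a) = 0 := rfl

@[simp] theorem coeff_succ_rightShift (a : BSeq) (n : ℕ) :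
    coeff (n + 1) (rightShift a) = coeff n a := rfl

theorem norm_rightShift_le : ‖rightShift‖ ≤ 1 :=
  LinearMap.mkContinuous_norm_le _ zero_le_one _

theorem leftShift_rightShift (a : BSeq) : leftShift (rightShift a) = a := rfl

/-- The sequence `1, 0, 0, …`. -/
noncomputable def unitSeq : BSeq :=
  mk (fun n => if n = 0 then 1 else 0) 1 (by intro n; split_ifs <;> simp)

theorem coeff_unitSeq (n : ℕ) : coeff n unitSeq = if n = 0 then 1 else 0 := rfl

theorem leftShift_unitSeq : leftShift unitSeq = 0 := by
  ext n; simp [coeff_unitSeq]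

theorem isUnit_one_sub_smul_leftShift {z : ℂ} (hz : ‖z‖ < 1) :
    IsUnit (1 - z • leftShift : BSeq →L[ℂ] BSeq) := by
  refine isUnit_one_sub_of_norm_lt_one ?_
  rw [norm_smul]
  nlinarith [norm_leftShift_le, norm_nonneg z, norm_nonneg leftShift]

/-- Evaluation at `z` of the power series with given bounded coefficients. -/
noncomputable def evalSeq (z : ℂ) : BSeq →L[ℂ] ℂ :=
  -- With `L` the left shift, `∑ aₙ zⁿ` is the zeroth term of `(1 - z L)⁻¹ a`; in this form its
  -- analyticity in `z` is that of operator inversion.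
  coeffL.comp
    (Ring.inverse (1 - z • leftShift : BSeq →L[ℂ] BSeq))

/-- This recursion is all that is used to compute with `evalSeq`: the inverse is never expanded as a
series. -/
theorem evalSeq_apply_eq {z : ℂ} (hz : ‖z‖ < 1) (a : BSeq) :
    evalSeq z a = coeff 0 a + z * evalSeq z (leftShift a) := by
  have h := Ring.inverse_mul_cancel _ (isUnit_one_sub_smul_leftShift hz)
  have h2 : Ring.inverse (1 - z • leftShift : BSeq →L[ℂ] BSeq) (a - z • leftShift a) = a :=
    congrArg (fun T : BSeq →L[ℂ] BSeq => T a) h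
  have h3 := congrArg (coeff 0) h2
  rw [map_sub, map_smul, coeff_sub, coeff_smul] at h3
  change coeff 0 (Ring.inverse (1 - z • leftShift : BSeq →L[ℂ] BSeq) a) =
    coeff 0 a + z * coeff 0 (Ring.inverse (1 - z • leftShift : BSeq →L[ℂ] BSeq) (leftShift a))
  linear_combination h3

theorem evalSeq_unitSeq {z : ℂ} (hz : ‖z‖ < 1) : evalSeq z unitSeq = 1 := by
  rw [evalSeq_apply_eq hz, leftShift_unitSeq]; simp [coeff_unitSeq]

theorem evalSeq_rightShift {z : ℂ} (hz : ‖z‖ < 1) (a : BSeq) :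
    evalSeq z (rightShift a) = z * evalSeq z a := by
  rw [evalSeq_apply_eq hz, leftShift_rightShift]; simp

theorem analyticAt_ringInverse {T : BSeq →L[ℂ] BSeq} (hT : IsUnit T) :
    AnalyticAt ℂ (Ring.inverse : (BSeq →L[ℂ] BSeq) → BSeq →L[ℂ] BSeq) T := by
  obtain ⟨u, rfl⟩ := hT
  exact analyticAt_inverse u

theorem analyticAt_evalSeq {z : ℂ} (hz : ‖z‖ < 1) : AnalyticAt ℂ evalSeq z := by
  have h1 : AnalyticAt ℂ (fun z : ℂ => (1 - z • leftShift : BSeq →L[ℂ] BSeq)) z := by fun_prop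
  have h3 := AnalyticAt.fun_comp (f := fun z : ℂ => (1 - z • leftShift : BSeq →L[ℂ] BSeq))
    (analyticAt_ringInverse (isUnit_one_sub_smul_leftShift hz)) h1
  exact AnalyticAt.fun_comp
    (f := fun z : ℂ => Ring.inverse (1 - z • leftShift : BSeq →L[ℂ] BSeq))
    ((ContinuousLinearMap.compL ℂ BSeq BSeq ℂ coeffL).analyticAt _) h3

/-- The constant term is the value at `0`; dividing by `z` replaces the sequence by its left shift,
and induction gives all terms. -/
theorem eq_zero_of_evalSeq_eventually {a : BSeq} (h : ∀ᶠ z in 𝓝 (0 : ℂ), evalSeq z a = 0) :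
    a = 0 := by
  have key : ∀ n : ℕ, ∀ a : BSeq, (∀ᶠ z in 𝓝 (0 : ℂ), evalSeq z a = 0) → coeff n a = 0 := by
    have hb : ∀ᶠ z in 𝓝 (0 : ℂ), ‖z‖ < 1 := by
      have := Metric.ball_mem_nhds (0 : ℂ) one_pos
      filter_upwards [this] with z hz using by simpa using hz
    have h0 : ∀ a : BSeq, (∀ᶠ z in 𝓝 (0 : ℂ), evalSeq z a = 0) → coeff 0 a = 0 := by
      intro a ha
      have := ha.self_of_nhds
      rw [evalSeq_apply_eq (by simp)] at this
      simpa using this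
    intro n
    induction n with
    | zero => exact h0
    | succ n ih =>
      intro a ha
      refine ih (leftShift a) ?_
      have han : AnalyticAt ℂ (fun z => evalSeq z (leftShift a)) 0 :=
        ((ContinuousLinearMap.apply ℂ ℂ (leftShift a)).analyticAt _).comp
          (analyticAt_evalSeq (by simp))
      refine han.frequently_zero_iff_eventually_zero.1 (Eventually.frequently ?_)
      filter_upwards [(ha.and hb).filter_mono nhdsWithin_le_nhds, self_mem_nhdsWithin] with z hz hz0
      have := evalSeq_apply_eq hz.2 a
      rw [hz.1, h0 a ha, zero_add, eq_comm, mul_eq_zero] at this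
      exact this.resolve_left hz0
  ext n
  exact key n a h

/-- The disc of radius two, on which functions are prescribed in the functional calculus. -/
abbrev disc2 : Type := Metric.closedBall (0 : ℂ) 2

theorem isUnit_smul_one_sub_rightShift {z : ℂ} (hz : 1 < ‖z‖) :
    IsUnit (z • 1 - rightShift : BSeq →L[ℂ] BSeq) := by
  have hz0 : z ≠ 0 := by rintro rfl; simp at hz; linarith
  have h1 : IsUnit (1 - z⁻¹ • rightShift : BSeq →L[ℂ] BSeq) := by
    refine isUnit_one_sub_of_norm_lt_one ?_
    rw [norm_smul, norm_inv]
    have : ‖z‖⁻¹ < 1 := inv_lt_one_of_one_lt₀ hz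
    nlinarith [norm_rightShift_le, norm_nonneg rightShift, inv_nonneg.2 (norm_nonneg z)]
  have h2 : (z • 1 - rightShift : BSeq →L[ℂ] BSeq) =
      algebraMap ℂ (BSeq →L[ℂ] BSeq) z * (1 - z⁻¹ • rightShift) := by
    rw [← Algebra.smul_def, smul_sub, smul_smul, mul_inv_cancel₀ hz0, one_smul]
  rw [h2]
  exact ((isUnit_iff_ne_zero.2 hz0).map (algebraMap ℂ (BSeq →L[ℂ] BSeq))).mul h1

/-- The points of the circle of radius two. -/
noncomputable def circle2 (θ : ℝ) : disc2 :=
  ⟨circleMap 0 2 θ, by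
    have := circleMap_mem_sphere (0 : ℂ) (by norm_num : (0:ℝ) ≤ 2) θ
    exact Metric.sphere_subset_closedBall this⟩

theorem continuous_circle2 : Continuous circle2 := by
  unfold circle2
  exact (continuous_circleMap 0 2).subtype_mk _

/-- The resolvent of the right shift along the circle of radius two. -/
noncomputable def resolventCircle (θ : ℝ) : BSeq →L[ℂ] BSeq :=
  (deriv (circleMap 0 2) θ * (2 * Real.pi * Complex.I)⁻¹) •
    Ring.inverse (circleMap 0 2 θ • 1 - rightShift)

theorem norm_circleMap_two (θ : ℝ) : ‖circleMap 0 2 θ‖ = 2 := by simp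

theorem continuous_resolventCircle : Continuous resolventCircle := by
  have h1 : Continuous fun θ : ℝ => deriv (circleMap 0 2) θ * (2 * Real.pi * Complex.I)⁻¹ := by
    refine Continuous.mul ?_ continuous_const
    have : deriv (circleMap 0 2) = fun θ : ℝ => circleMap 0 2 θ * Complex.I := by
      funext θ; exact deriv_circleMap 0 2 θ
    rw [this]
    exact (continuous_circleMap 0 2).mul continuous_const
  have h2 : Continuous fun θ : ℝ =>
      (Ring.inverse (circleMap 0 2 θ • 1 - rightShift) : BSeq →L[ℂ] BSeq) := by
    refine continuous_iff_continuousAt.2 fun θ => ?_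
    have h2 := (analyticAt_ringInverse (isUnit_smul_one_sub_rightShift (z := circleMap 0 2 θ)
      (by rw [norm_circleMap_two]; norm_num))).continuousAt
    have h3 : ContinuousAt (fun θ => (circleMap 0 2 θ • 1 - rightShift : BSeq →L[ℂ] BSeq)) θ :=
      (((continuous_circleMap 0 2).smul (continuous_const (y := (1 : BSeq →L[ℂ] BSeq)))).sub
        continuous_const).continuousAt
    exact ContinuousAt.comp (f := fun θ => (circleMap 0 2 θ • 1 - rightShift : BSeq →L[ℂ] BSeq))
      h2 h3
  exact h1.smul h2

theorem intervalIntegrable_calculus (φ : C(disc2, ℂ)) :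
    IntervalIntegrable (fun θ => φ (circle2 θ) • resolventCircle θ) MeasureTheory.volume
      0 (2 * Real.pi) := by
  refine Continuous.intervalIntegrable ?_ _ _
  exact (φ.continuous.comp continuous_circle2).smul continuous_resolventCircle

/-- The holomorphic functional calculus of the right shift. -/
noncomputable def shiftCalculus : C(disc2, ℂ) →L[ℂ] BSeq →L[ℂ] BSeq :=
  LinearMap.mkContinuousOfExistsBound
    { toFun := fun φ => ∫ θ in (0)..(2 * Real.pi), φ (circle2 θ) • resolventCircle θ
      map_add' := fun φ ψ => by
        rw [← intervalIntegral.integral_add (intervalIntegrable_calculus φ)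
          (intervalIntegrable_calculus ψ)]
        simp [add_smul]
      map_smul' := fun c φ => by
        rw [RingHom.id_apply, ← intervalIntegral.integral_smul]
        simp [smul_smul] } (by
    obtain ⟨C, hC⟩ := (isCompact_uIcc (a := 0) (b := 2 * Real.pi)).exists_bound_of_continuousOn
      continuous_resolventCircle.continuousOn
    refine ⟨C * |2 * Real.pi - 0|, fun φ => ?_⟩
    have := intervalIntegral.norm_integral_le_of_norm_le_const (a := 0) (b := 2 * Real.pi)
      (f := fun θ => φ (circle2 θ) • resolventCircle θ) (C := ‖φ‖ * C) (by
        intro θ hθ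
        rw [norm_smul]
        exact mul_le_mul (φ.norm_coe_le_norm _) (hC θ (Set.uIoc_subset_uIcc hθ)) (norm_nonneg _)
          (norm_nonneg _))
    refine this.trans (le_of_eq (by ring)))

/-- Under `evalSeq z` the right shift becomes multiplication by `z`, so its resolvent at `ζ` becomes
multiplication by `(ζ - z)⁻¹`. -/
theorem evalSeq_resolventCircle {z : ℂ} (hz : ‖z‖ < 1) (θ : ℝ) (a : BSeq) :
    evalSeq z (resolventCircle θ a) =
      deriv (circleMap 0 2) θ * (2 * Real.pi * Complex.I)⁻¹ * (circleMap 0 2 θ - z)⁻¹ *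
        evalSeq z a := by
  have hu := isUnit_smul_one_sub_rightShift (z := circleMap 0 2 θ)
      (by rw [norm_circleMap_two]; norm_num)
  have h := Ring.mul_inverse_cancel _ hu
  have h2 : circleMap 0 2 θ • Ring.inverse (circleMap 0 2 θ • 1 - rightShift) a -
      rightShift (Ring.inverse (circleMap 0 2 θ • 1 - rightShift) a) = a :=
    congrArg (fun T : BSeq →L[ℂ] BSeq => T a) h
  replace h2 := congrArg (evalSeq z) h2
  rw [map_sub, map_smul, evalSeq_rightShift hz, smul_eq_mul] at h2
  have hne : circleMap 0 2 θ - z ≠ 0 := by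
    intro h0
    have : ‖circleMap 0 2 θ‖ = ‖z‖ := by rw [sub_eq_zero.1 h0]
    rw [norm_circleMap_two] at this; linarith
  change evalSeq z ((deriv (circleMap 0 2) θ * (2 * Real.pi * Complex.I)⁻¹) •
    Ring.inverse (circleMap 0 2 θ • 1 - rightShift) a) = _
  rw [map_smul, smul_eq_mul, ← h2]
  field_simp

/-- The functional calculus multiplies power series by the given function. -/
theorem evalSeq_shiftCalculus {z : ℂ} (hz : ‖z‖ < 1) {φ : C(disc2, ℂ)} {f : ℂ → ℂ}
    (hf : DifferentiableOn ℂ f (Metric.closedBall 0 2)) (hφ : ∀ k : disc2, φ k = f k) (a : BSeq) :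
    evalSeq z (shiftCalculus φ a) = f z * evalSeq z a := by
  have e1 : evalSeq z (shiftCalculus φ a) =
      ∫ θ in (0)..(2 * Real.pi), evalSeq z ((φ (circle2 θ) • resolventCircle θ) a) := by
    change ((evalSeq z).comp (ContinuousLinearMap.apply ℂ BSeq a))
      (∫ θ in (0)..(2 * Real.pi), φ (circle2 θ) • resolventCircle θ) = _
    rw [← ContinuousLinearMap.intervalIntegral_comp_comm _ (intervalIntegrable_calculus φ)]
    rfl
  -- Cauchy's formula on the circle of radius two, which surrounds the unit disc containing the
  -- spectrum of the shift.
  have hC : (∮ ζ in C(0, 2), (ζ - z)⁻¹ • f ζ) = (2 * Real.pi * Complex.I) • f z := by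
    refine DiffContOnCl.circleIntegral_sub_inv_smul ?_ (by simpa using hz.trans one_lt_two)
    refine DifferentiableOn.diffContOnCl ?_
    rwa [closure_ball _ (by norm_num)]
  rw [e1]
  have hpi : (2 * Real.pi * Complex.I : ℂ) ≠ 0 := Complex.two_pi_I_ne_zero
  have e2 : ∀ θ : ℝ, evalSeq z ((φ (circle2 θ) • resolventCircle θ) a) =
      ((2 * Real.pi * Complex.I)⁻¹ * evalSeq z a) *
        (deriv (circleMap 0 2) θ • ((circleMap 0 2 θ - z)⁻¹ • f (circleMap 0 2 θ))) := by
    intro θ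
    change evalSeq z (φ (circle2 θ) • resolventCircle θ a) = _
    rw [map_smul, evalSeq_resolventCircle hz, hφ]
    simp only [smul_eq_mul]
    change f (circleMap 0 2 θ) * _ = _
    ring
  simp only [e2]
  rw [intervalIntegral.integral_const_mul]
  rw [circleIntegral] at hC
  rw [hC, smul_eq_mul]
  field_simp

end Shift

end SimpleSing

namespace SimpleSing

open BSeq

/-! ### Division with remainder as an invertible operator depending on parameters. -/

section WeierstrassCore

variable {G : Type*} [NormedAddCommGroup G] [NormedSpace ℂ G]
  {E : Type*} [NormedAddCommGroup E] [NormedSpace ℂ E]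

/-- The function has a power series at the origin converging on a ball of radius larger than two. -/
def LargeAnalytic (f : G → ℂ) : Prop :=
  ∃ (p : FormalMultilinearSeries ℂ G ℂ) (r : ENNReal), 2 < r ∧ HasFPowerSeriesOnBall f p 0 r

theorem LargeAnalytic.analyticAt {f : G → ℂ} (hf : LargeAnalytic f) {x : G} (hx : ‖x‖ ≤ 2) :
    AnalyticAt ℂ f x := by
  obtain ⟨p, r, hr, h⟩ := hf
  refine h.analyticAt_of_mem ?_
  rw [Metric.mem_eball, edist_zero_right]
  refine lt_of_le_of_lt ?_ hr
  rw [← ofReal_norm]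
  exact (ENNReal.ofReal_le_ofReal hx).trans (by simp)

theorem exists_largeAnalytic_smul {f : G → ℂ} (hf : AnalyticAt ℂ f 0) :
    ∃ ε : ℝ, 0 < ε ∧ ∀ c : ℂ, 0 < ‖c‖ → ‖c‖ < ε → LargeAnalytic fun x => f (c • x) := by
  obtain ⟨p, r, h⟩ := hf
  obtain ⟨s, hs0, hsr⟩ := ENNReal.lt_iff_exists_nnreal_btwn.1 h.r_pos
  refine ⟨s / 3, by have : (0:ℝ) < s := by exact_mod_cast hs0
                    positivity, fun c hc0 hc => ?_⟩
  let u : G →L[ℂ] G := c • ContinuousLinearMap.id ℂ G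
  have hu : HasFPowerSeriesOnBall f p (u 0) r := by simpa using h
  refine ⟨_, _, ?_, hu.compContinuousLinearMap⟩
  have hle : ‖u‖ₑ ≤ ‖c‖ₑ := by
    rw [enorm_le_iff_norm_le, norm_smul]
    exact mul_le_of_le_one_right (norm_nonneg _) ContinuousLinearMap.norm_id_le
  have hlt : ‖c‖ₑ * 2 < r := by
    refine lt_trans ?_ hsr
    have h1 : ‖c‖₊ * 2 < s := by
      rw [← NNReal.coe_lt_coe]
      push_cast
      linarith
    rw [enorm_eq_nnnorm]
    exact_mod_cast h1
  refine lt_of_lt_of_le ?_ (ENNReal.div_le_div_left hle r)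
  rw [ENNReal.lt_div_iff_mul_lt (Or.inl (by simpa using hc0)) (Or.inl (by simp)), mul_comm]
  exact hlt

/-- The operators multiplying power series in `z` by `f (x, z)` depend analytically on `x`. -/
theorem exists_mulOperator {f : E × ℂ → ℂ} (hf : LargeAnalytic f) :
    ∃ M : E → BSeq →L[ℂ] BSeq, AnalyticAt ℂ M 0 ∧
      ∀ᶠ x in 𝓝 (0 : E), ∀ z : ℂ, ‖z‖ < 1 → ∀ a, evalSeq z (M x a) = f (x, z) * evalSeq z a := by
  have hf' := hf
  obtain ⟨p, r, hr, h⟩ := hf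
  obtain ⟨Φ, hΦ, hΦe⟩ := exists_superposition (K := disc2) h
  -- The map `y` sends `x` to the function `ζ ↦ (x, ζ)` and is affine. Composing it with
  -- superposition by `f` and the linear functional calculus gives analyticity of the multiplication
  -- operators.
  let y₀ : C(disc2, E × ℂ) := ⟨fun k => (0, (k : ℂ)), by fun_prop⟩
  let y : E → C(disc2, E × ℂ) := fun x =>
    ContinuousLinearMap.const ℂ disc2 (ContinuousLinearMap.inl ℂ E ℂ x) + y₀
  have hyk : ∀ x k, y x k = (x, (k : ℂ)) := by
    intro x k
    change (x, (0 : ℂ)) + (0, (k : ℂ)) = _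
    simp
  have hyn : ∀ x, ‖x‖ < 2 → y x ∈ Metric.eball (0 : C(disc2, E × ℂ)) r := by
    intro x hx
    rw [Metric.mem_eball, edist_zero_right]
    refine lt_of_le_of_lt ?_ hr
    have : ‖y x‖ ≤ 2 := by
      rw [ContinuousMap.norm_le _ zero_le_two]
      intro k
      rw [hyk, Prod.norm_def]
      exact max_le hx.le (mem_closedBall_zero_iff.1 k.2)
    rw [← ofReal_norm]
    exact (ENNReal.ofReal_le_ofReal this).trans (by simp)
  have hyan : AnalyticAt ℂ y 0 := by
    have h1 := ((ContinuousLinearMap.const ℂ (M := E × ℂ) disc2).comp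
      (ContinuousLinearMap.inl ℂ E ℂ)).analyticAt (0 : E)
    exact h1.add analyticAt_const
  have hcomp : AnalyticAt ℂ (fun x => Φ (y x)) 0 := (hΦ _ (hyn 0 (by simp))).comp hyan
  refine ⟨fun x => shiftCalculus (Φ (y x)), (shiftCalculus.analyticAt _).comp hcomp, ?_⟩
  filter_upwards [Metric.ball_mem_nhds (0 : E) zero_lt_two] with x hx z hz a
  have hx2 : ‖x‖ < 2 := by simpa using hx
  refine evalSeq_shiftCalculus (f := fun ζ => f (x, ζ)) hz ?_ ?_ a
  · intro ζ hζ
    have h1 : AnalyticAt ℂ f (x, ζ) := hf'.analyticAt (by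
      rw [Prod.norm_def]; exact max_le hx2.le (by simpa using hζ))
    have h2 : AnalyticAt ℂ (fun ζ : ℂ => (x, ζ)) ζ := by fun_prop
    exact (AnalyticAt.comp (f := fun ζ : ℂ => (x, ζ)) h1 h2).differentiableAt.differentiableWithinAt
  · intro k
    rw [hΦe _ (hyn x hx2), hyk]

/-- The sequences supported on the first `d` terms. -/
noncomputable def initialSeq (d : ℕ) : (Fin d → ℂ) →L[ℂ] BSeq :=
  ∑ j : Fin d, (ContinuousLinearMap.proj (R := ℂ) (φ := fun _ : Fin d => ℂ) j).smulRight
    ((rightShift ^ (j : ℕ)) unitSeq)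

theorem initialSeq_apply (d : ℕ) (c : Fin d → ℂ) :
    initialSeq d c = ∑ j, c j • (rightShift ^ (j : ℕ)) unitSeq := by
  rw [initialSeq, sum_apply]
  rfl

theorem coeff_rightShift_pow (d n : ℕ) (a : BSeq) :
    coeff n ((rightShift ^ d) a) = if n < d then 0 else coeff (n - d) a := by
  induction d generalizing n with
  | zero => simp
  | succ d ih =>
    rw [pow_succ']
    change coeff n (rightShift ((rightShift ^ d) a)) = _
    cases n with
    | zero => simp
    | succ n => rw [coeff_succ_rightShift, ih]; simp

theorem coeff_leftShift_pow (d n : ℕ) (a : BSeq) :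
    coeff n ((leftShift ^ d) a) = coeff (n + d) a := by
  induction d generalizing n with
  | zero => simp
  | succ d ih =>
    rw [pow_succ']
    change coeff n (leftShift ((leftShift ^ d) a)) = _
    rw [coeff_leftShift, ih]
    congr 1; omega

theorem coeff_sum {ι : Type*} (s : Finset ι) (f : ι → BSeq) (n : ℕ) :
    coeff n (∑ i ∈ s, f i) = ∑ i ∈ s, coeff n (f i) := by
  classical
  induction s using Finset.induction_on with
  | empty => simp
  | insert i s hi ih => rw [Finset.sum_insert hi, Finset.sum_insert hi, coeff_add, ih]

theorem coeff_initialSeq (d n : ℕ) (c : Fin d → ℂ) :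
    coeff n (initialSeq d c) = if h : n < d then c ⟨n, h⟩ else 0 := by
  rw [initialSeq_apply, coeff_sum]
  simp only [coeff_smul, coeff_rightShift_pow, coeff_unitSeq]
  split_ifs with h
  · rw [Finset.sum_eq_single ⟨n, h⟩]
    · simp
    · intro b _ hb
      have : (b : ℕ) ≠ n := fun h' => hb (Fin.ext h')
      split_ifs <;> first | (exfalso; omega) | simp
    · simp
  · refine Finset.sum_eq_zero fun b _ => ?_
    have := b.2
    split_ifs <;> first | (exfalso; omega) | simp

theorem evalSeq_rightShift_pow {z : ℂ} (hz : ‖z‖ < 1) (d : ℕ) (a : BSeq) :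
    evalSeq z ((rightShift ^ d) a) = z ^ d * evalSeq z a := by
  induction d with
  | zero => simp
  | succ d ih =>
    rw [pow_succ']
    change evalSeq z (rightShift ((rightShift ^ d) a)) = _
    rw [evalSeq_rightShift hz, ih]; ring

theorem evalSeq_initialSeq {z : ℂ} (hz : ‖z‖ < 1) (d : ℕ) (c : Fin d → ℂ) :
    evalSeq z (initialSeq d c) = ∑ j, c j * z ^ (j : ℕ) := by
  rw [initialSeq_apply, map_sum]
  refine Finset.sum_congr rfl fun j _ => ?_
  rw [map_smul, evalSeq_rightShift_pow hz, evalSeq_unitSeq hz]; simp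

theorem eq_of_evalSeq_eq {a b : BSeq} (h : ∀ z : ℂ, ‖z‖ < 1 → evalSeq z a = evalSeq z b) :
    a = b := by
  rw [← sub_eq_zero]
  refine eq_zero_of_evalSeq_eventually ?_
  filter_upwards [Metric.ball_mem_nhds (0 : ℂ) one_pos] with z hz
  rw [map_sub, h z (by simpa using hz), sub_self]

/-- The operator `(q, r) ↦ q f(x, ·) + r` of division with remainder: it is analytic in `x` and
invertible near the origin. -/
theorem exists_divisionOperator {f : E × ℂ → ℂ} (hf : LargeAnalytic f) {u v : ℂ → ℂ}
    (hu : LargeAnalytic fun p : E × ℂ => u p.2) (hv : LargeAnalytic fun p : E × ℂ => v p.2)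
    (huv : ∀ z : ℂ, ‖z‖ < 1 → u z * v z = 1) (d : ℕ)
    (h0 : ∀ z : ℂ, ‖z‖ < 1 → f (0, z) = z ^ d * u z) :
    ∃ L : E → (BSeq × (Fin d → ℂ)) →L[ℂ] BSeq,
      AnalyticAt ℂ (fun x => (L x).inverse) 0 ∧ (∀ᶠ x in 𝓝 0, (L x).IsInvertible) ∧
      ∀ᶠ x in 𝓝 (0 : E), ∀ z : ℂ, ‖z‖ < 1 → ∀ a c,
        evalSeq z (L x (a, c)) = f (x, z) * evalSeq z a + ∑ j, c j * z ^ (j : ℕ) := by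
  obtain ⟨M, hM, hMe⟩ := exists_mulOperator hf
  obtain ⟨U, -, hU⟩ := exists_mulOperator hu
  obtain ⟨V, -, hV⟩ := exists_mulOperator hv
  replace hU := hU.self_of_nhds
  replace hV := hV.self_of_nhds
  have hUV : ∀ a, U 0 (V 0 a) = a := fun a => eq_of_evalSeq_eq fun z hz => by
    rw [hU z hz, hV z hz]; linear_combination evalSeq z a * huv z hz
  have hVU : ∀ a, V 0 (U 0 a) = a := fun a => eq_of_evalSeq_eq fun z hz => by
    rw [hV z hz, hU z hz]; linear_combination evalSeq z a * huv z hz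
  -- At `x = 0` multiplication by `f` is an invertible operator followed by `d` right shifts. The
  -- remainder supplies the first `d` terms of a sequence and the quotient all others, so `L 0` is
  -- bijective.
  have hM0 : ∀ a, M 0 a = (rightShift ^ d) (U 0 a) := fun a => eq_of_evalSeq_eq fun z hz => by
    rw [hMe.self_of_nhds z hz, h0 z hz, evalSeq_rightShift_pow hz, hU z hz]; ring
  let L : E → (BSeq × (Fin d → ℂ)) →L[ℂ] BSeq := fun x =>
    (M x).comp (ContinuousLinearMap.fst ℂ BSeq (Fin d → ℂ)) +
      (initialSeq d).comp (ContinuousLinearMap.snd ℂ BSeq (Fin d → ℂ))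
  have hLe : ∀ x a c, L x (a, c) = M x a + initialSeq d c := fun _ _ _ => rfl
  have hL : AnalyticAt ℂ L 0 := by
    have h1 : AnalyticAt ℂ (fun x => (M x).comp (ContinuousLinearMap.fst ℂ BSeq (Fin d → ℂ))) 0 :=
      (((ContinuousLinearMap.compL ℂ (BSeq × (Fin d → ℂ)) BSeq BSeq).flip
        (ContinuousLinearMap.fst ℂ BSeq (Fin d → ℂ))).analyticAt _).comp hM
    exact h1.add analyticAt_const
  have hinj : Function.Injective (L 0) := by
    rw [injective_iff_map_eq_zero]
    rintro ⟨a, c⟩ hac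
    rw [hLe, hM0] at hac
    have hc : ∀ n, (if n < d then 0 else coeff (n - d) (U 0 a)) +
        (if h : n < d then c ⟨n, h⟩ else 0) = 0 := by
      intro n
      have := congrArg (coeff n) hac
      rwa [coeff_add, coeff_rightShift_pow, coeff_initialSeq] at this
    have hc0 : c = 0 := by
      funext j
      have := hc j
      simpa using this
    have ha0 : U 0 a = 0 := by
      ext n
      have := hc (n + d)
      simpa using this
    rw [← hVU a, ha0, hc0]; simp
  have hsurj : Function.Surjective (L 0) := by
    intro g
    refine ⟨(V 0 ((leftShift ^ d) g), fun j => coeff j g), ?_⟩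
    rw [hLe, hM0, hUV]
    ext n
    rw [coeff_add, coeff_rightShift_pow, coeff_initialSeq, coeff_leftShift_pow]
    split_ifs with h
    · simp
    · rw [add_zero, Nat.sub_add_cancel (not_lt.1 h)]
  let e : (BSeq × (Fin d → ℂ)) ≃L[ℂ] BSeq := ContinuousLinearEquiv.ofBijective (L 0)
    (LinearMap.ker_eq_bot.2 hinj) (LinearMap.range_eq_top.2 hsurj)
  have he : (e : (BSeq × (Fin d → ℂ)) →L[ℂ] BSeq) = L 0 := ContinuousLinearMap.ext fun _ => rfl
  refine ⟨L, ?_, ?_, ?_⟩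
  -- Inversion is analytic and invertibility is open, so both pass from `L 0` to `L x` for small
  -- `x`.
  · have h1 := (contDiffAt_map_inverse (𝕜 := ℂ) (n := ⊤) e).analyticAt
    rw [he] at h1
    exact h1.comp hL
  · have h1 := ContinuousLinearEquiv.nhds e
    rw [he] at h1
    filter_upwards [hL.continuousAt h1] with x hx
    exact hx
  · filter_upwards [hMe] with x hx z hz a c
    rw [hLe, map_add, hx z hz, evalSeq_initialSeq hz]

end WeierstrassCore

end SimpleSing

namespace SimpleSing

open BSeq

/-! ### Weierstrass division of functions: existence and uniqueness. -/

section WeierstrassDivision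

variable {G : Type*} [NormedAddCommGroup G] [NormedSpace ℂ G]
  {E : Type*} [NormedAddCommGroup E] [NormedSpace ℂ E]

theorem LargeAnalytic.const_mul {f : G → ℂ} (hf : LargeAnalytic f) (c : ℂ) :
    LargeAnalytic fun x => c * f x := by
  obtain ⟨p, r, hr, h⟩ := hf
  exact ⟨_, r, hr, h.const_smul (c := c)⟩

theorem analyticAt_clm_apply {F H : Type*} [NormedAddCommGroup F] [NormedSpace ℂ F]
    [NormedAddCommGroup H] [NormedSpace ℂ H] {f : G → F →L[ℂ] H} {g : G → F} {x : G}
    (hf : AnalyticAt ℂ f x) (hg : AnalyticAt ℂ g x) : AnalyticAt ℂ (fun y => f y (g y)) x :=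
  AnalyticAt.fun_comp (g := fun p : (F →L[ℂ] H) × F => p.1 p.2) (f := fun y => (f y, g y))
    ((ContinuousLinearMap.id ℂ (F →L[ℂ] H)).analyticAt_bilinear _) (hf.prod hg)

/-- A homothety by a small `c` makes all power series in play converge beyond radius two, as the
functional calculus requires. -/
theorem exists_scaled_divisionOperator {f g : E × ℂ → ℂ} (hf : AnalyticAt ℂ f 0)
    (hg : AnalyticAt ℂ g 0) {u : ℂ → ℂ} (hu : AnalyticAt ℂ u 0) (hu0 : u 0 ≠ 0) {d : ℕ}
    (h0 : ∀ᶠ z in 𝓝 (0 : ℂ), f (0, z) = z ^ d * u z) :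
    ∃ c : ℂ, c ≠ 0 ∧ LargeAnalytic (fun p => g (c • p)) ∧
      ∃ L : E → (BSeq × (Fin d → ℂ)) →L[ℂ] BSeq,
      AnalyticAt ℂ (fun x => (L x).inverse) 0 ∧ (∀ᶠ x in 𝓝 0, (L x).IsInvertible) ∧
      ∀ᶠ x in 𝓝 (0 : E), ∀ z : ℂ, ‖z‖ < 1 → ∀ a b,
        evalSeq z (L x (a, b)) = f (c • (x, z)) * evalSeq z a + ∑ j, b j * z ^ (j : ℕ) := by
  have hus : AnalyticAt ℂ (fun p : E × ℂ => u p.2) 0 :=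
    AnalyticAt.comp (f := fun p : E × ℂ => p.2) hu (analyticAt_snd)
  have hvs : AnalyticAt ℂ (fun p : E × ℂ => (u p.2)⁻¹) 0 := hus.inv hu0
  obtain ⟨ε₁, hε₁, h1⟩ := exists_largeAnalytic_smul hf
  obtain ⟨ε₂, hε₂, h2⟩ := exists_largeAnalytic_smul hg
  obtain ⟨ε₃, hε₃, h3⟩ := exists_largeAnalytic_smul hus
  obtain ⟨ε₄, hε₄, h4⟩ := exists_largeAnalytic_smul hvs
  obtain ⟨ε₅, hε₅, h5⟩ := Metric.eventually_nhds_iff.1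
    (h0.and (hu.continuousAt.eventually_ne hu0))
  obtain ⟨ε, hε, hε1, hε2, hε3, hε4, hε5⟩ : ∃ ε : ℝ, 0 < ε ∧ ε < ε₁ ∧ ε < ε₂ ∧ ε < ε₃ ∧ ε < ε₄ ∧
      ε < ε₅ := by
    refine ⟨min ε₁ (min ε₂ (min ε₃ (min ε₄ ε₅))) / 2, by positivity, ?_⟩
    have hm : 0 < min ε₁ (min ε₂ (min ε₃ (min ε₄ ε₅))) := by positivity
    have hh := half_lt_self hm
    simpa only [lt_min_iff] using hh
  have hn : ‖(ε : ℂ)‖ = ε := by rw [Complex.norm_real, Real.norm_of_nonneg hε.le]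
  have hc : (ε : ℂ) ≠ 0 := by exact_mod_cast hε.ne'
  have hsm : ∀ z : ℂ, ‖z‖ < 1 → dist ((ε : ℂ) * z) 0 < ε₅ := by
    intro z hz
    rw [dist_zero_right, norm_mul, hn]
    nlinarith [norm_nonneg z]
  refine ⟨ε, hc, h2 _ (by rwa [hn]) (by rwa [hn]), ?_⟩
  refine exists_divisionOperator (f := fun p => f ((ε : ℂ) • p))
    (u := fun z => (ε : ℂ) ^ d * u (ε * z)) (v := fun z => ((ε : ℂ) ^ d)⁻¹ * (u (ε * z))⁻¹)
    (h1 _ (by rwa [hn]) (by rwa [hn])) ((h3 _ (by rwa [hn]) (by rwa [hn])).const_mul _)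
    ((h4 _ (by rwa [hn]) (by rwa [hn])).const_mul _) ?_ d ?_
  · intro z hz
    have := (h5 (hsm z hz)).2
    have hcd : (ε : ℂ) ^ d ≠ 0 := pow_ne_zero _ hc
    field_simp
  · intro z hz
    have := (h5 (hsm z hz)).1
    simp only [Prod.smul_mk, smul_zero, smul_eq_mul]
    rw [this]; ring

theorem weierstrass_division {f g : E × ℂ → ℂ} (hf : AnalyticAt ℂ f 0)
    (hg : AnalyticAt ℂ g 0) {u : ℂ → ℂ} (hu : AnalyticAt ℂ u 0) (hu0 : u 0 ≠ 0) {d : ℕ}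
    (h0 : ∀ᶠ z in 𝓝 (0 : ℂ), f (0, z) = z ^ d * u z) :
    ∃ (q : E × ℂ → ℂ) (r : Fin d → E → ℂ), AnalyticAt ℂ q 0 ∧ (∀ j, AnalyticAt ℂ (r j) 0) ∧
      ∀ᶠ p in 𝓝 (0 : E × ℂ), g p = q p * f p + ∑ j, r j p.1 * p.2 ^ (j : ℕ) := by
  obtain ⟨c, hc, hgc, L, hLan, hLinv, hLe⟩ := exists_scaled_divisionOperator hf hg hu hu0 h0
  obtain ⟨M, hM, hMe⟩ := exists_mulOperator hgc
  -- The pair quotient and remainder is the inverse division operator applied to the series of `g`;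
  -- the factors `c⁻¹` below undo the homothety.
  let s : E → BSeq × (Fin d → ℂ) := fun x => (L x).inverse (M x unitSeq)
  have hs : AnalyticAt ℂ s 0 := analyticAt_clm_apply hLan (analyticAt_clm_apply hM analyticAt_const)
  let q : E × ℂ → ℂ := fun p => evalSeq (c⁻¹ * p.2) (s (c⁻¹ • p.1)).1
  let r : Fin d → E → ℂ := fun j x => (s (c⁻¹ • x)).2 j * (c⁻¹) ^ (j : ℕ)
  have hsc : AnalyticAt ℂ (fun x : E => s (c⁻¹ • x)) 0 := by
    refine AnalyticAt.fun_comp (g := s) (f := fun x : E => c⁻¹ • x) ?_ (by fun_prop)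
    simpa using hs
  have hsc' : AnalyticAt ℂ (fun p : E × ℂ => s (c⁻¹ • p.1)) 0 :=
    AnalyticAt.fun_comp (g := fun x : E => s (c⁻¹ • x)) (f := fun p : E × ℂ => p.1) hsc analyticAt_fst
  refine ⟨q, r, ?_, ?_, ?_⟩
  · have h1 : AnalyticAt ℂ (fun p : E × ℂ => evalSeq (c⁻¹ * p.2)) 0 := by
      refine AnalyticAt.fun_comp (g := evalSeq) (f := fun p : E × ℂ => c⁻¹ * p.2) ?_
        (analyticAt_const.mul analyticAt_snd)
      exact analyticAt_evalSeq (by simp)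
    exact analyticAt_clm_apply h1
      (((ContinuousLinearMap.fst ℂ BSeq (Fin d → ℂ)).analyticAt _).comp hsc')
  · intro j
    exact (((ContinuousLinearMap.proj (R := ℂ) (φ := fun _ : Fin d => ℂ) j).comp
      (ContinuousLinearMap.snd ℂ BSeq (Fin d → ℂ))).analyticAt _ |>.comp hsc).mul analyticAt_const
  · have ht1 : Tendsto (fun p : E × ℂ => c⁻¹ • p.1) (𝓝 0) (𝓝 0) := by
      have : Continuous fun p : E × ℂ => c⁻¹ • p.1 := by fun_prop
      simpa using this.tendsto 0
    have ht2 : Tendsto (fun p : E × ℂ => c⁻¹ * p.2) (𝓝 0) (𝓝 0) := by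
      have : Continuous fun p : E × ℂ => c⁻¹ * p.2 := by fun_prop
      simpa using this.tendsto 0
    filter_upwards [ht1.eventually hMe, ht1.eventually hLe, ht1.eventually hLinv,
      ht2.eventually (Metric.ball_mem_nhds (0 : ℂ) one_pos)] with p h1 h2 h3 h4
    have hz : ‖c⁻¹ * p.2‖ < 1 := by simpa using h4
    have hp : c • ((c⁻¹ • p.1, c⁻¹ * p.2) : E × ℂ) = p := by
      ext <;> simp [hc]
    have e1 := h1 _ hz unitSeq
    rw [evalSeq_unitSeq hz, mul_one, hp] at e1
    have e2 := h2 _ hz (s (c⁻¹ • p.1)).1 (s (c⁻¹ • p.1)).2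
    rw [hp, Prod.mk.eta, h3.self_apply_inverse, e1] at e2
    rw [e2, mul_comm (f p)]
    congr 1
    refine Finset.sum_congr rfl fun j _ => ?_
    simp only [r, mul_pow]; ring

theorem weierstrass_unique {f q : E × ℂ → ℂ} (hf : AnalyticAt ℂ f 0)
    (hq : AnalyticAt ℂ q 0) {u : ℂ → ℂ} (hu : AnalyticAt ℂ u 0) (hu0 : u 0 ≠ 0) {d : ℕ}
    (h0 : ∀ᶠ z in 𝓝 (0 : ℂ), f (0, z) = z ^ d * u z) {r : Fin d → E → ℂ}
    (h : ∀ᶠ p in 𝓝 (0 : E × ℂ), q p * f p + ∑ j, r j p.1 * p.2 ^ (j : ℕ) = 0) :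
    ∀ j, ∀ᶠ x in 𝓝 (0 : E), r j x = 0 := by
  obtain ⟨c, hc, hqc, L, hLan, hLinv, hLe⟩ := exists_scaled_divisionOperator hf hq hu hu0 h0
  obtain ⟨M, hM, hMe⟩ := exists_mulOperator hqc
  have ht : Tendsto (fun p : E × ℂ => c • p) (𝓝 0) (𝓝 0) := by
    have : Continuous fun p : E × ℂ => c • p := by fun_prop
    simpa using this.tendsto 0
  have h' := ht.eventually h
  rw [Prod.zero_eq_mk, nhds_prod_eq] at h'
  have h'' := h'.curry
  have key : ∀ᶠ x in 𝓝 (0 : E), ∀ j, r j (c • x) = 0 := by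
    filter_upwards [h'', hMe, hLe, hLinv] with x h1 h2 h3 h4 j
    -- The relation says that `L x` kills the pair formed by the series of `q` and the remainder, so
    -- invertibility makes the remainder zero.
    have e : L x (M x unitSeq, fun j => r j (c • x) * c ^ (j : ℕ)) = 0 := by
      refine eq_zero_of_evalSeq_eventually ?_
      filter_upwards [h1, Metric.ball_mem_nhds (0 : ℂ) one_pos] with z hz hz1
      have hz1' : ‖z‖ < 1 := by simpa using hz1
      rw [h3 z hz1', h2 z hz1', evalSeq_unitSeq hz1', mul_one, ← hz, mul_comm]
      congr 1
      refine Finset.sum_congr rfl fun j _ => ?_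
      simp only [Prod.smul_fst, Prod.smul_snd, smul_eq_mul, mul_pow]; ring
    have e2 := h4.inverse_apply_self (M x unitSeq, fun j => r j (c • x) * c ^ (j : ℕ))
    rw [e, map_zero] at e2
    have e3 := congrFun (congrArg Prod.snd e2) j
    simp only [Prod.snd_zero, Pi.zero_apply, zero_eq_mul] at e3
    exact e3.resolve_right (pow_ne_zero _ hc)
  intro j
  have ht' : Tendsto (fun x : E => c⁻¹ • x) (𝓝 0) (𝓝 0) := by
    have : Continuous fun x : E => c⁻¹ • x := by fun_prop
    simpa using this.tendsto 0
  filter_upwards [ht'.eventually key] with x hx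
  simpa [smul_smul, hc] using hx j

end WeierstrassDivision

end SimpleSing

namespace SimpleSing

/-! ### The ring of germs of analytic functions. -/

section Germs

variable (E : Type*) [NormedAddCommGroup E] [NormedSpace ℂ E]

/-- The functions which are analytic at the origin. -/
def AnalyticFun : Subalgebra ℂ (E → ℂ) where
  carrier := {f | AnalyticAt ℂ f 0}
  mul_mem' := fun hf hg => hf.mul hg
  add_mem' := fun hf hg => hf.add hg
  algebraMap_mem' := fun _ => analyticAt_const

/-- The functions whose germ at the origin vanishes. -/
def nullIdeal : Ideal (AnalyticFun E) where
  carrier := {f | ∀ᶠ x in 𝓝 (0 : E), (f : E → ℂ) x = 0}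
  add_mem' := fun {f g} hf hg => by
    filter_upwards [hf, hg] with x h1 h2
    change (f : E → ℂ) x + (g : E → ℂ) x = 0
    rw [h1, h2, add_zero]
  zero_mem' := Eventually.of_forall fun _ => rfl
  smul_mem' := fun c f hf => by
    filter_upwards [hf] with x h1
    change (c : E → ℂ) x * (f : E → ℂ) x = 0
    rw [h1, mul_zero]

/-- The ring of germs at the origin of analytic functions. -/
def AGerm : Type _ := AnalyticFun E ⧸ nullIdeal E

namespace AGerm

noncomputable instance : CommRing (AGerm E) :=
  inferInstanceAs (CommRing (AnalyticFun E ⧸ nullIdeal E))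

noncomputable instance : Algebra ℂ (AGerm E) :=
  inferInstanceAs (Algebra ℂ (AnalyticFun E ⧸ nullIdeal E))

/-- The germ of an analytic function, as an algebra homomorphism. -/
noncomputable def mk : AnalyticFun E →ₐ[ℂ] AGerm E := Ideal.Quotient.mkₐ ℂ (nullIdeal E)

variable {E}

theorem mk_surjective : Function.Surjective (mk E) := Ideal.Quotient.mk_surjective

/-- The germ of a function which is analytic at the origin. -/
noncomputable def of (f : E → ℂ) (hf : AnalyticAt ℂ f 0) : AGerm E := mk E ⟨f, hf⟩

theorem analyticAt_coe (f : AnalyticFun E) : AnalyticAt ℂ (f : E → ℂ) 0 := f.2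

theorem mk_eq_of (f : AnalyticFun E) : mk E f = of f (analyticAt_coe f) := rfl

theorem of_eq_of {f g : E → ℂ} {hf : AnalyticAt ℂ f 0} {hg : AnalyticAt ℂ g 0} :
    of f hf = of g hg ↔ ∀ᶠ x in 𝓝 (0 : E), f x = g x := by
  have h : of f hf = of g hg ↔ (⟨f, hf⟩ - ⟨g, hg⟩ : AnalyticFun E) ∈ nullIdeal E :=
    Ideal.Quotient.eq
  rw [h]
  constructor <;> intro h <;> filter_upwards [h] with x hx
  · exact sub_eq_zero.1 hx
  · exact sub_eq_zero.2 hx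

theorem of_eq_zero {f : E → ℂ} {hf : AnalyticAt ℂ f 0} :
    of f hf = 0 ↔ ∀ᶠ x in 𝓝 (0 : E), f x = 0 := by
  have h : (0 : AGerm E) = of (fun _ => 0) analyticAt_const := (map_zero (mk E)).symm
  rw [h, of_eq_of]

theorem exists_rep (φ : AGerm E) : ∃ (f : E → ℂ) (hf : AnalyticAt ℂ f 0), φ = of f hf := by
  obtain ⟨f, rfl⟩ := mk_surjective φ
  exact ⟨f, f.2, rfl⟩

theorem of_add {f g : E → ℂ} (hf : AnalyticAt ℂ f 0) (hg : AnalyticAt ℂ g 0) :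
    of f hf + of g hg = of (fun x => f x + g x) (hf.add hg) := rfl

theorem of_sub {f g : E → ℂ} (hf : AnalyticAt ℂ f 0) (hg : AnalyticAt ℂ g 0) :
    of f hf - of g hg = of (fun x => f x - g x) (hf.sub hg) := rfl

theorem of_mul {f g : E → ℂ} (hf : AnalyticAt ℂ f 0) (hg : AnalyticAt ℂ g 0) :
    of f hf * of g hg = of (fun x => f x * g x) (hf.mul hg) := rfl

theorem of_const (c : ℂ) : of (fun _ : E => c) analyticAt_const = algebraMap ℂ (AGerm E) c := rfl

theorem of_one : of (fun _ : E => 1) analyticAt_const = 1 := rfl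

theorem of_pow {f : E → ℂ} (hf : AnalyticAt ℂ f 0) (n : ℕ) :
    of f hf ^ n = of (fun x => f x ^ n) (hf.pow n) := rfl

/-- The value of a germ at the origin. -/
noncomputable def value : AGerm E →ₐ[ℂ] ℂ :=
  Ideal.Quotient.liftₐ (nullIdeal E)
    ((Pi.evalAlgHom ℂ (fun _ : E => ℂ) 0).comp (AnalyticFun E).val) fun f hf => by
      have h : ∀ᶠ x in 𝓝 (0 : E), (f : E → ℂ) x = 0 := hf
      exact h.self_of_nhds

@[simp] theorem value_of (f : E → ℂ) (hf : AnalyticAt ℂ f 0) : value (of f hf) = f 0 := rfl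

theorem isUnit_iff (φ : AGerm E) : IsUnit φ ↔ value φ ≠ 0 := by
  refine ⟨fun h => (h.map value).ne_zero, fun h => ?_⟩
  obtain ⟨f, hf, rfl⟩ := exists_rep φ
  refine IsUnit.of_mul_eq_one (of (fun x => (f x)⁻¹) (hf.inv h)) ?_
  rw [of_mul, ← of_one, of_eq_of]
  filter_upwards [hf.continuousAt.eventually_ne h] with x hx
  exact mul_inv_cancel₀ hx

variable {E' : Type*} [NormedAddCommGroup E'] [NormedSpace ℂ E']

/-- Pull back of germs along an analytic map fixing the origin. -/
noncomputable def pull (g : E' → E) (hg : AnalyticAt ℂ g 0) (h0 : g 0 = 0) :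
    AGerm E →ₐ[ℂ] AGerm E' :=
  Ideal.Quotient.liftₐ (nullIdeal E)
    { toFun := fun f => of (fun x => (f : E → ℂ) (g x))
        (AnalyticAt.fun_comp (by rw [h0]; exact f.2) hg)
      map_one' := rfl
      map_mul' := fun _ _ => rfl
      map_zero' := rfl
      map_add' := fun _ _ => rfl
      commutes' := fun _ => rfl } fun f hf => by
    refine of_eq_zero.2 ?_
    have h : ∀ᶠ x in 𝓝 (0 : E), (f : E → ℂ) x = 0 := hf
    have ht : Tendsto g (𝓝 0) (𝓝 0) := by simpa [h0] using hg.continuousAt.tendsto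
    exact ht.eventually h

theorem pull_of (g : E' → E) (hg : AnalyticAt ℂ g 0) (h0 : g 0 = 0) (f : E → ℂ)
    (hf : AnalyticAt ℂ f 0) : pull g hg h0 (of f hf) =
      of (fun x => f (g x)) (AnalyticAt.fun_comp (by rw [h0]; exact hf) hg) := rfl

theorem value_pull (g : E' → E) (hg : AnalyticAt ℂ g 0) (h0 : g 0 = 0) (φ : AGerm E) :
    value (pull g hg h0 φ) = value φ := by
  obtain ⟨f, hf, rfl⟩ := exists_rep φ
  rw [pull_of, value_of, value_of, h0]

theorem pull_pull_eq_self {g : E' → E} (hg : AnalyticAt ℂ g 0) (h0 : g 0 = 0) {k : E → E'}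
    (hk : AnalyticAt ℂ k 0) (k0 : k 0 = 0) (h : ∀ x, g (k x) = x) (φ : AGerm E) :
    pull k hk k0 (pull g hg h0 φ) = φ := by
  obtain ⟨f, hf, rfl⟩ := exists_rep φ
  rw [pull_of, pull_of, of_eq_of]
  exact Eventually.of_forall fun x => by rw [h]

theorem analyticAt_equiv (e : E' ≃L[ℂ] E) : AnalyticAt ℂ e 0 :=
  e.toContinuousLinearMap.analyticAt 0

/-- The isomorphism of germ rings induced by a linear isomorphism. -/
noncomputable def congr (e : E' ≃L[ℂ] E) : AGerm E ≃ₐ[ℂ] AGerm E' :=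
  AlgEquiv.ofAlgHom (pull e (analyticAt_equiv e) (map_zero e))
    (pull e.symm (analyticAt_equiv e.symm) (map_zero e.symm))
    (AlgHom.ext fun φ => pull_pull_eq_self (analyticAt_equiv e.symm) (map_zero e.symm)
      (analyticAt_equiv e) (map_zero e) (fun x => e.symm_apply_apply x) φ)
    (AlgHom.ext fun φ => pull_pull_eq_self (analyticAt_equiv e) (map_zero e)
      (analyticAt_equiv e.symm) (map_zero e.symm) (fun x => e.apply_symm_apply x) φ)

theorem congr_of (e : E' ≃L[ℂ] E) (f : E → ℂ) (hf : AnalyticAt ℂ f 0) :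
    congr e (of f hf) = of (fun x => f (e x))
      (AnalyticAt.fun_comp (by rw [map_zero]; exact hf) (analyticAt_equiv e)) :=
  rfl

theorem value_congr (e : E' ≃L[ℂ] E) (φ : AGerm E) : value (congr e φ) = value φ :=
  value_pull _ (analyticAt_equiv e) (map_zero e) φ

end AGerm

variable {E}

/-- If a product of analytic functions vanishes near a point, so does one of the factors. -/
theorem eventually_eq_zero_of_mul {f g : E → ℂ} {p : E} (hf : AnalyticAt ℂ f p)
    (hg : AnalyticAt ℂ g p) (h : ∀ᶠ x in 𝓝 p, f x * g x = 0) :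
    (∀ᶠ x in 𝓝 p, f x = 0) ∨ ∀ᶠ x in 𝓝 p, g x = 0 := by
  by_contra hcon
  obtain ⟨h1, h2⟩ := not_or.1 hcon
  refine h2 ?_
  obtain ⟨r, hr, hball⟩ := Metric.eventually_nhds_iff_ball.1
    ((hg.eventually_analyticAt.and hf.eventually_analyticAt).and h)
  rw [not_eventually] at h1
  obtain ⟨x, hx1, hx2⟩ := (h1.and_eventually (Metric.ball_mem_nhds p hr)).exists
  have hg' : AnalyticOnNhd ℂ g (Metric.ball p r) := fun y hy => (hball y hy).1.1
  have hgx : g =ᶠ[𝓝 x] 0 := by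
    filter_upwards [(hball x hx2).1.2.continuousAt.eventually_ne hx1,
      Metric.isOpen_ball.mem_nhds hx2] with y hy1 hy2
    exact (mul_eq_zero.1 (hball y hy2).2).resolve_left hy1
  have := hg'.eqOn_zero_of_preconnected_of_eventuallyEq_zero
    (convex_ball p r).isPreconnected hx2 hgx
  filter_upwards [Metric.ball_mem_nhds p hr] with y hy using this hy

namespace AGerm

instance : Nontrivial (AGerm E) :=
  ⟨⟨0, 1, fun h => by simpa using congrArg value h⟩⟩

instance : IsDomain (AGerm E) :=
  have : NoZeroDivisors (AGerm E) := ⟨fun {a b} h => by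
    obtain ⟨f, hf, rfl⟩ := exists_rep a
    obtain ⟨g, hg, rfl⟩ := exists_rep b
    rw [of_mul, of_eq_zero] at h
    rw [of_eq_zero, of_eq_zero]
    exact eventually_eq_zero_of_mul hf hg h⟩
  NoZeroDivisors.to_isDomain _

end AGerm

end Germs

/-! ### Polynomials in the last variable and Weierstrass division of germs. -/

section Polynomials

open Polynomial

variable {E : Type*} [NormedAddCommGroup E] [NormedSpace ℂ E]

/-- Evaluation of analytic functions at a point. -/
def evalAt (x : E) : AnalyticFun E →+* ℂ := (Pi.evalRingHom (fun _ : E => ℂ) x).comp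
  (AnalyticFun E).subtype

@[simp] theorem evalAt_apply (x : E) (f : AnalyticFun E) : evalAt x f = (f : E → ℂ) x := rfl

/-- The function on `E × ℂ` defined by a polynomial in the last variable. -/
noncomputable def polyFun (P : (AnalyticFun E)[X]) (p : E × ℂ) : ℂ := P.eval₂ (evalAt p.1) p.2

theorem analyticAt_polyFun (P : (AnalyticFun E)[X]) : AnalyticAt ℂ (polyFun P) 0 := by
  induction P using Polynomial.induction_on' with
  | add P Q hP hQ =>
    have : polyFun (P + Q) = fun p => polyFun P p + polyFun Q p := by
      funext p; simp [polyFun, eval₂_add]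
    rw [this]; exact hP.add hQ
  | monomial n a =>
    have : polyFun (monomial n a) = fun p => (a : E → ℂ) p.1 * p.2 ^ n := by
      funext p; simp [polyFun, eval₂_monomial]
    rw [this]
    have ha : AnalyticAt ℂ (a : E → ℂ) 0 := a.2
    exact (AnalyticAt.fun_comp (f := fun p : E × ℂ => p.1) ha analyticAt_fst).mul
      (analyticAt_snd.pow n)

namespace AGerm

/-- Germs on `E` as germs on `E × ℂ`. -/
noncomputable def base (E : Type*) [NormedAddCommGroup E] [NormedSpace ℂ E] :
    AGerm E →ₐ[ℂ] AGerm (E × ℂ) := pull Prod.fst analyticAt_fst rfl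

theorem base_of (f : E → ℂ) (hf : AnalyticAt ℂ f 0) : base E (of f hf) =
    of (fun p => f p.1) (AnalyticAt.fun_comp (f := fun p : E × ℂ => p.1) hf analyticAt_fst) := rfl

/-- The germ of the last coordinate. -/
noncomputable def zvar (E : Type*) [NormedAddCommGroup E] [NormedSpace ℂ E] : AGerm (E × ℂ) :=
  of (fun p => p.2) analyticAt_snd

/-- Polynomials in the last coordinate as germs. -/
noncomputable def polyMap (E : Type*) [NormedAddCommGroup E] [NormedSpace ℂ E] :
    (AGerm E)[X] →+* AGerm (E × ℂ) := eval₂RingHom (base E).toRingHom (zvar E)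

@[simp] theorem polyMap_C (a : AGerm E) : polyMap E (C a) = base E a := by simp [polyMap]

@[simp] theorem polyMap_X : polyMap E X = zvar E := by simp [polyMap]

theorem polyMap_map_mk (P : (AnalyticFun E)[X]) :
    polyMap E (P.map (mk E).toRingHom) = of (polyFun P) (analyticAt_polyFun P) := by
  induction P using Polynomial.induction_on' with
  | add P Q hP hQ =>
    rw [Polynomial.map_add, map_add, hP, hQ, of_add, of_eq_of]
    exact Eventually.of_forall fun p => by simp [polyFun, eval₂_add]
  | monomial n a =>
    rw [map_monomial, ← C_mul_X_pow_eq_monomial, map_mul, map_pow, polyMap_C, polyMap_X]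
    change base E (of a (analyticAt_coe a)) * zvar E ^ n = _
    rw [base_of, zvar, of_pow, of_mul, of_eq_of]
    exact Eventually.of_forall fun p => by simp [polyFun, eval₂_monomial]

theorem value_base (a : AGerm E) : value (base E a) = value a := value_pull _ _ _ a

@[simp] theorem value_zvar : value (zvar E) = 0 := rfl

/-- Restriction of germs to the last coordinate axis. -/
noncomputable def axis (E : Type*) [NormedAddCommGroup E] [NormedSpace ℂ E] :
    AGerm (E × ℂ) →ₐ[ℂ] AGerm ℂ :=
  pull (fun z : ℂ => ((0 : E), z)) (analyticAt_const.prod analyticAt_id) rfl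

/-- The coordinate germ on `ℂ`. -/
noncomputable def coord : AGerm ℂ := of (fun z => z) analyticAt_id

/-- The germ is regular of order `d` in the last coordinate. -/
def RegularOfOrder (F : AGerm (E × ℂ)) (d : ℕ) : Prop :=
  ∃ u : AGerm ℂ, IsUnit u ∧ axis E F = coord ^ d * u

theorem RegularOfOrder.exists_fun {f : E × ℂ → ℂ} {hf : AnalyticAt ℂ f 0} {d : ℕ}
    (h : RegularOfOrder (of f hf) d) : ∃ u : ℂ → ℂ, AnalyticAt ℂ u 0 ∧ u 0 ≠ 0 ∧
      ∀ᶠ z in 𝓝 (0 : ℂ), f (0, z) = z ^ d * u z := by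
  obtain ⟨u, hu, h⟩ := h
  obtain ⟨u, hu', rfl⟩ := exists_rep u
  rw [isUnit_iff, value_of] at hu
  refine ⟨u, hu', hu, ?_⟩
  rw [axis, pull_of, coord, of_pow, of_mul, of_eq_of] at h
  exact h

theorem RegularOfOrder.ne_zero {F : AGerm (E × ℂ)} {d : ℕ} (h : RegularOfOrder F d) : F ≠ 0 := by
  rintro rfl
  obtain ⟨u, hu, h⟩ := h
  rw [map_zero] at h
  have hc : coord ≠ 0 := by
    intro h0
    rw [coord, of_eq_zero] at h0
    have h1 := h0.filter_mono (nhdsWithin_le_nhds (s := {0}ᶜ))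
    obtain ⟨z, hz, hz0⟩ := (h1.and self_mem_nhdsWithin).exists
    exact hz0 hz
  exact mul_ne_zero (pow_ne_zero _ hc) hu.ne_zero h.symm

/-- Weierstrass division. -/
theorem RegularOfOrder.exists_div {F : AGerm (E × ℂ)} {d : ℕ} (hF : RegularOfOrder F d)
    (G : AGerm (E × ℂ)) : ∃ (Q : AGerm (E × ℂ)) (r : (AGerm E)[X]), r.degree < d ∧
      G = Q * F + polyMap E r := by
  obtain ⟨f, hf, rfl⟩ := exists_rep F
  obtain ⟨g, hg, rfl⟩ := exists_rep G
  obtain ⟨u, hu, hu0, h⟩ := hF.exists_fun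
  obtain ⟨q, r, hq, hr, hqr⟩ := weierstrass_division hf hg hu hu0 h
  let P : (AnalyticFun E)[X] := ∑ j : Fin d, C ⟨r j, hr j⟩ * X ^ (j : ℕ)
  refine ⟨of q hq, P.map (mk E).toRingHom, ?_, ?_⟩
  · refine lt_of_le_of_lt degree_map_le ?_
    exact degree_sum_fin_lt _
  · rw [polyMap_map_mk, of_mul, of_add, of_eq_of]
    filter_upwards [hqr] with p hp
    rw [hp]
    congr 1
    simp [P, polyFun, eval₂_finsetSum]

/-- Uniqueness in Weierstrass division. -/
theorem RegularOfOrder.eq_zero_of_dvd {F : AGerm (E × ℂ)} {d : ℕ} (hF : RegularOfOrder F d)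
    {r : (AGerm E)[X]} (hr : r.degree < d) (h : F ∣ polyMap E r) : r = 0 := by
  obtain ⟨Q, hQ⟩ := h
  obtain ⟨f, hf, rfl⟩ := exists_rep F
  obtain ⟨q, hq, hqe⟩ := exists_rep (-Q)
  obtain ⟨u, hu, hu0, h⟩ := hF.exists_fun
  by_contra hr0
  have hrd := (natDegree_lt_iff_degree_lt hr0).2 hr
  obtain ⟨P₀, hP₀⟩ := Polynomial.map_surjective (mk E).toRingHom mk_surjective r
  obtain ⟨P, hP, hPd⟩ := Polynomial.exists_degree_eq_of_mem_lifts ((mem_lifts r).2 ⟨P₀, hP₀⟩)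
  have hPd' : P.natDegree < d := by rwa [natDegree_eq_of_degree_eq hPd]
  have key := weierstrass_unique (r := fun j : Fin d => (P.coeff j : E → ℂ)) hf hq hu hu0 h (by
    rw [← hP, polyMap_map_mk, ← sub_eq_zero, mul_comm, sub_eq_add_neg, ← neg_mul, hqe, of_mul,
      of_add, of_eq_zero] at hQ
    filter_upwards [hQ] with p hp
    rw [← hp, add_comm]
    congr 1
    rw [polyFun, eval₂_eq_sum_range' _ hPd', Finset.sum_range]
    rfl)
  apply hr0
  rw [← hP]
  ext j
  rw [coeff_map, coeff_zero]
  by_cases hj : j < d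
  · change of _ (analyticAt_coe (P.coeff j)) = 0
    exact of_eq_zero.2 (key ⟨j, hj⟩)
  · rw [coeff_eq_zero_of_natDegree_lt (by omega), map_zero]

end AGerm

end Polynomials

end SimpleSing

/-! ### Weierstrass preparation and factoriality of the ring of germs. -/

namespace SimpleSing

open Polynomial

variable {E : Type*} [NormedAddCommGroup E] [NormedSpace ℂ E]

namespace AGerm

theorem axis_base (a : AGerm E) : axis E (base E a) = algebraMap ℂ _ (value a) := by
  obtain ⟨f, hf, rfl⟩ := exists_rep a
  rfl

theorem axis_zvar : axis E (zvar E) = coord := rfl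

theorem value_axis (F : AGerm (E × ℂ)) : value (axis E F) = value F := value_pull _ _ _ F

@[simp] theorem value_coord : value coord = 0 := rfl

theorem coord_ne_zero : coord ≠ 0 := by
  intro h0
  rw [coord, of_eq_zero] at h0
  have h1 := h0.filter_mono (nhdsWithin_le_nhds (s := {0}ᶜ))
  obtain ⟨z, hz, hz0⟩ := (h1.and self_mem_nhdsWithin).exists
  exact hz0 hz

theorem axis_polyMap (P : (AGerm E)[X]) :
    axis E (polyMap E P) = aeval coord (P.map (value (E := E)).toRingHom) := by
  induction P using Polynomial.induction_on' with
  | add P Q hP hQ => rw [map_add, map_add, hP, hQ, Polynomial.map_add, map_add]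
  | monomial n a =>
    rw [← C_mul_X_pow_eq_monomial, map_mul, map_pow, polyMap_C, polyMap_X, map_mul, map_pow,
      axis_base, axis_zvar]
    simp

theorem exists_eq_coord_pow_mul {φ : AGerm ℂ} (h : φ ≠ 0) :
    ∃ (d : ℕ) (u : AGerm ℂ), IsUnit u ∧ φ = coord ^ d * u := by
  obtain ⟨f, hf, rfl⟩ := exists_rep φ
  rw [Ne, of_eq_zero] at h
  obtain ⟨n, g, hg, hg0, hfg⟩ := hf.exists_eventuallyEq_pow_smul_nonzero_iff.2 h
  refine ⟨n, of g hg, (isUnit_iff _).2 hg0, ?_⟩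
  rw [coord, of_pow, of_mul, of_eq_of]
  filter_upwards [hfg] with z hz
  simpa using hz

theorem exists_regularOfOrder {F : AGerm (E × ℂ)} (h : axis E F ≠ 0) :
    ∃ d, RegularOfOrder F d := by
  obtain ⟨d, u, hu, he⟩ := exists_eq_coord_pow_mul h
  exact ⟨d, u, hu, he⟩

/-- A nonzero polynomial of degree below `d` vanishes at `0` to order below `d`. -/
theorem eq_zero_of_coord_pow_dvd {ρ : ℂ[X]} {d : ℕ} (hρ : ρ.degree < d)
    (h : coord ^ d ∣ aeval coord ρ) : ρ = 0 := by
  by_contra h0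
  obtain ⟨σ, hσ, hσ0⟩ := exists_eq_pow_rootMultiplicity_mul_and_not_dvd ρ h0 0
  rw [C_0, sub_zero] at hσ hσ0
  set k := ρ.rootMultiplicity 0
  have hk : k < d := by
    have h1 := (natDegree_lt_iff_degree_lt h0).2 hρ
    have hσ1 : σ ≠ 0 := by rintro rfl; simp at hσ0
    rw [hσ, natDegree_mul (pow_ne_zero _ X_ne_zero) hσ1, natDegree_X_pow] at h1
    omega
  obtain ⟨q, hq⟩ := h
  rw [hσ, map_mul, map_pow, aeval_X, ← Nat.add_sub_cancel' hk.le, pow_add, mul_assoc] at hq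
  have h3 := mul_left_cancel₀ (pow_ne_zero _ coord_ne_zero) hq
  have h4 := congrArg value h3
  rw [map_mul, map_pow, value_coord, zero_pow (by omega), zero_mul, ← aeval_algHom_apply,
    value_coord] at h4
  exact hσ0 (X_dvd_iff.2 (by rw [coeff_zero_eq_aeval_zero]; exact h4))

/-- A Weierstrass polynomial: monic, with all lower coefficients vanishing at the origin. -/
def IsWeierstrass (P : (AGerm E)[X]) : Prop :=
  P.Monic ∧ P.map (value (E := E)).toRingHom = X ^ P.natDegree

theorem IsWeierstrass.regular {P : (AGerm E)[X]} (h : IsWeierstrass P) :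
    RegularOfOrder (polyMap E P) P.natDegree :=
  ⟨1, isUnit_one, by rw [axis_polyMap, h.2]; simp⟩

/-- At the origin a monic factor becomes a monic divisor of a power of `X`, hence itself a power of
`X`. -/
theorem IsWeierstrass.of_dvd {P Q : (AGerm E)[X]} (h : IsWeierstrass P) (hQ : Q.Monic)
    (hd : Q ∣ P) : IsWeierstrass Q := by
  refine ⟨hQ, ?_⟩
  have h1 : Q.map (value (E := E)).toRingHom ∣ X ^ P.natDegree := by
    rw [← h.2]; exact Polynomial.map_dvd _ hd
  obtain ⟨k, -, hk⟩ := (dvd_prime_pow prime_X _).1 h1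
  have h2 := eq_of_monic_of_associated (hQ.map _) (monic_X_pow k) hk
  rw [h2, ← hQ.natDegree_map (value (E := E)).toRingHom, h2, natDegree_X_pow]

/-- The Weierstrass preparation theorem. -/
theorem RegularOfOrder.exists_weierstrass {F : AGerm (E × ℂ)} {d : ℕ} (hF : RegularOfOrder F d) :
    ∃ P : (AGerm E)[X], IsWeierstrass P ∧ P.natDegree = d ∧ Associated (polyMap E P) F := by
  -- Divide `z^d` by `F`: restriction to the axis shows that `r` vanishes at the origin and that `Q`
  -- is a unit, so `z^d - r` is the Weierstrass polynomial.
  obtain ⟨Q, r, hr, h⟩ := hF.exists_div (zvar E ^ d)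
  obtain ⟨u, hu, hFu⟩ := hF
  have h1 : coord ^ d - aeval coord (r.map (value (E := E)).toRingHom) =
      axis E Q * (coord ^ d * u) := by
    rw [← hFu, ← axis_polyMap, ← map_mul, sub_eq_iff_eq_add, ← map_add, ← h, map_pow, axis_zvar]
  have h2 : r.map (value (E := E)).toRingHom = 0 := by
    refine eq_zero_of_coord_pow_dvd (lt_of_le_of_lt degree_map_le hr)
      ⟨1 - axis E Q * u, ?_⟩
    linear_combination -h1
  have h3 : axis E Q * u = 1 := by
    rw [h2, map_zero, sub_zero] at h1
    refine mul_left_cancel₀ (pow_ne_zero d coord_ne_zero) ?_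
    linear_combination -h1
  have hQ : IsUnit Q := by
    rw [isUnit_iff, ← value_axis, ← isUnit_iff]
    exact IsUnit.of_mul_eq_one _ h3
  have hm : (X ^ d - r).Monic := monic_X_pow_sub hr
  have hd : (X ^ d - r).natDegree = d := by
    have h4 := degree_sub_eq_left_of_degree_lt (p := X ^ d) (q := r) (by rwa [degree_X_pow])
    rw [natDegree_eq_of_degree_eq h4, natDegree_X_pow]
  refine ⟨X ^ d - r, ⟨hm, ?_⟩, hd, ?_⟩
  · rw [Polynomial.map_sub, h2, hd]; simp
  · have e : polyMap E (X ^ d - r) = F * Q := by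
      rw [map_sub, map_pow, polyMap_X, h]; ring
    rw [e]
    exact (associated_mul_unit_right F Q hQ).symm

/-- Divisibility by a function germ can be tested after multiplication by a germ in the first
variables only, if the divisor is regular in the last variable. -/
theorem RegularOfOrder.dvd_of_dvd_base_mul {F : AGerm (E × ℂ)} {d : ℕ} (hF : RegularOfOrder F d)
    {a : AGerm E} (ha : a ≠ 0) {b : AGerm (E × ℂ)} (h : F ∣ base E a * b) : F ∣ b := by
  obtain ⟨Q, r, hr, hb⟩ := hF.exists_div b
  have h1 : F ∣ polyMap E (C a * r) := by
    have h2 : polyMap E (C a * r) = base E a * b - F * (base E a * Q) := by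
      rw [map_mul, polyMap_C, hb]; ring
    rw [h2]
    exact dvd_sub h (dvd_mul_right _ _)
  have h3 := hF.eq_zero_of_dvd (lt_of_le_of_lt (by
    rw [degree_mul, degree_C ha, zero_add]) hr) h1
  rw [mul_eq_zero, C_eq_zero] at h3
  rw [hb, h3.resolve_left ha, map_zero, add_zero]
  exact dvd_mul_left _ _

/-- The Euclidean remainder by `P` is also a Weierstrass remainder, and the latter is unique. -/
theorem IsWeierstrass.dvd_iff {P : (AGerm E)[X]} (hP : IsWeierstrass P) (f : (AGerm E)[X]) :
    polyMap E P ∣ polyMap E f ↔ P ∣ f := by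
  refine ⟨fun h => ?_, fun h => map_dvd _ h⟩
  have h1 : polyMap E P ∣ polyMap E (f %ₘ P) := by
    rw [modByMonic_eq_sub_mul_div, map_sub, map_mul]
    exact dvd_sub h (dvd_mul_right _ _)
  have h2 := hP.regular.eq_zero_of_dvd (by
    rw [← degree_eq_natDegree hP.1.ne_zero]; exact degree_modByMonic_lt f hP.1) h1
  exact (modByMonic_eq_zero_iff_dvd hP.1).1 h2

theorem IsWeierstrass.exists_sub_dvd {P : (AGerm E)[X]} (hP : IsWeierstrass P)
    (G : AGerm (E × ℂ)) : ∃ g : (AGerm E)[X], polyMap E P ∣ G - polyMap E g := by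
  obtain ⟨Q, r, -, h⟩ := hP.regular.exists_div G
  exact ⟨r, Q, by rw [h]; ring⟩

/-- Modulo `P` every germ is a polynomial, and divisibility of polynomials by `P` is the same in
both rings; primality therefore transfers. -/
theorem IsWeierstrass.prime {P : (AGerm E)[X]} (hP : IsWeierstrass P) (hp : Prime P) :
    Prime (polyMap E P) := by
  refine ⟨hP.regular.ne_zero, fun h => ?_, fun G H hGH => ?_⟩
  · rw [isUnit_iff_dvd_one, ← map_one (polyMap E), hP.dvd_iff, ← isUnit_iff_dvd_one] at h
    exact hp.not_isUnit h
  · obtain ⟨g, hg⟩ := hP.exists_sub_dvd G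
    obtain ⟨h, hh⟩ := hP.exists_sub_dvd H
    have h1 : polyMap E P ∣ polyMap E (g * h) := by
      have h2 : polyMap E (g * h) = G * H - (G - polyMap E g) * H -
          (H - polyMap E h) * polyMap E g := by
        rw [map_mul]; ring
      rw [h2]
      exact dvd_sub (dvd_sub hGH (hg.mul_right _)) (hh.mul_right _)
    rw [hP.dvd_iff] at h1
    rcases hp.dvd_or_dvd h1 with h2 | h2
    · left
      exact (dvd_sub_left (map_dvd (polyMap E) h2)).1 hg
    · right
      exact (dvd_sub_left (map_dvd (polyMap E) h2)).1 hh

/-- The linear automorphism which maps the last coordinate axis to the line through `w`. -/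
noncomputable def shear (w : E × ℂ) (hw : w.2 ≠ 0) : (E × ℂ) ≃L[ℂ] (E × ℂ) :=
  ContinuousLinearEquiv.equivOfInverse
    ((ContinuousLinearMap.fst ℂ E ℂ + (ContinuousLinearMap.snd ℂ E ℂ).smulRight w.1).prod
      (w.2 • ContinuousLinearMap.snd ℂ E ℂ))
    ((ContinuousLinearMap.fst ℂ E ℂ - (w.2⁻¹ • ContinuousLinearMap.snd ℂ E ℂ).smulRight w.1).prod
      (w.2⁻¹ • ContinuousLinearMap.snd ℂ E ℂ))
    (fun p => by ext <;> simp [hw])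
    (fun p => by ext <;> simp [hw])

theorem shear_axis (w : E × ℂ) (hw : w.2 ≠ 0) (z : ℂ) : shear w hw (0, z) = z • w := by
  change ((0 : E) + z • w.1, w.2 • z) = z • w
  ext <;> simp [mul_comm]

/-- After a linear change of coordinates, a nonzero germ is regular in the last variable. -/
theorem exists_axis_congr_ne_zero {F : AGerm (E × ℂ)} (hF : F ≠ 0) :
    ∃ e : (E × ℂ) ≃L[ℂ] (E × ℂ), axis E (congr e F) ≠ 0 := by
  obtain ⟨f, hf, rfl⟩ := exists_rep F
  have hz : zvar E ≠ 0 := by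
    intro h
    have := congrArg (axis E) h
    rw [axis_zvar, map_zero] at this
    exact coord_ne_zero this
  have h1 := mul_ne_zero hF hz
  rw [zvar, of_mul, Ne, of_eq_zero] at h1
  obtain ⟨r, hr, hball⟩ := Metric.eventually_nhds_iff_ball.1 hf.eventually_analyticAt
  rw [not_eventually] at h1
  -- A point near `0` where neither `f` nor the last coordinate vanishes; if `f` vanished near `0`
  -- on the line through `w`, the identity theorem would make it vanish at `w`.
  obtain ⟨w, hw, hwb⟩ := (h1.and_eventually (Metric.ball_mem_nhds _ hr)).exists
  obtain ⟨hw1, hw2⟩ := mul_ne_zero_iff.1 hw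
  refine ⟨shear w hw2, fun h => hw1 ?_⟩
  rw [congr_of, axis, pull_of, of_eq_zero] at h
  simp only [shear_axis] at h
  let L : ℂ →L[ℂ] E × ℂ := (ContinuousLinearMap.id ℂ ℂ).smulRight w
  have hL : ∀ z, L z = z • w := fun z => rfl
  have hconv : Convex ℝ (L ⁻¹' Metric.ball 0 r) :=
    (convex_ball (0 : E × ℂ) r).linear_preimage (L.restrictScalars ℝ).toLinearMap
  have hmem : ∀ z, z ∈ L ⁻¹' Metric.ball (0 : E × ℂ) r → AnalyticAt ℂ (fun z : ℂ => f (z • w)) z :=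
    fun z hz => AnalyticAt.fun_comp (f := L) (hball _ hz) (L.analyticAt z)
  have h2 := AnalyticOnNhd.eqOn_zero_of_preconnected_of_eventuallyEq_zero (𝕜 := ℂ) (z₀ := 0)
    (fun z hz => hmem z hz) hconv.isPreconnected (by simpa using hr) h
  have h3 := h2 (x := 1) (by simpa [hL] using hwb)
  simpa using h3

/-- Polynomials over a factorial ring factor into primes; the factors of `P`, made monic, are
Weierstrass and so remain prime as germs. -/
theorem exists_prime_factors_of_isWeierstrass [UniqueFactorizationMonoid (AGerm E)]
    {P : (AGerm E)[X]} (hP : IsWeierstrass P) :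
    ∃ s : Multiset (AGerm (E × ℂ)), (∀ b ∈ s, Prime b) ∧ Associated s.prod (polyMap E P) := by
  obtain ⟨s, hs, hsP⟩ := UniqueFactorizationMonoid.exists_prime_factors P hP.1.ne_zero
  refine ⟨s.map (polyMap E), fun b hb => ?_, ?_⟩
  · obtain ⟨p, hp, rfl⟩ := Multiset.mem_map.1 hb
    have hpP : p ∣ P := (Multiset.dvd_prod hp).trans hsP.dvd
    obtain ⟨q, hq⟩ := id hpP
    have hlc : p.leadingCoeff * q.leadingCoeff = 1 := by
      rw [← leadingCoeff_mul, ← hq]; exact hP.1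
    have hq1 : IsUnit (C q.leadingCoeff) :=
      isUnit_C.2 (IsUnit.of_mul_eq_one p.leadingCoeff (by rw [mul_comm]; exact hlc))
    have hass : Associated p (p * C q.leadingCoeff) := associated_mul_unit_right p _ hq1
    have hmon : (p * C q.leadingCoeff).Monic := by
      rw [Monic, leadingCoeff_mul, leadingCoeff_C, hlc]
    have hw := hP.of_dvd hmon (hass.symm.dvd.trans hpP)
    exact ((hass.map (polyMap E)).prime_iff).2 (hw.prime (hass.prime_iff.1 (hs p hp)))
  · rw [← map_multiset_prod]
    exact hsP.map (polyMap E)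

instance instUFMProd [UniqueFactorizationMonoid (AGerm E)] :
    UniqueFactorizationMonoid (AGerm (E × ℂ)) := by
  refine UniqueFactorizationMonoid.of_exists_prime_factors fun F hF => ?_
  obtain ⟨e, he⟩ := exists_axis_congr_ne_zero hF
  obtain ⟨d, hd⟩ := exists_regularOfOrder he
  obtain ⟨P, hP, -, hPF⟩ := hd.exists_weierstrass
  obtain ⟨s, hs, hsP⟩ := exists_prime_factors_of_isWeierstrass hP
  refine ⟨s.map (congr e).symm, fun b hb => ?_, ?_⟩
  · obtain ⟨p, hp, rfl⟩ := Multiset.mem_map.1 hb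
    exact (MulEquiv.prime_iff (congr e).symm.toMulEquiv).2 (hs p hp)
  · rw [← map_multiset_prod]
    have := (hsP.trans hPF).map (congr e).symm
    simpa using this

instance instUFMSubsingleton [Subsingleton E] : UniqueFactorizationMonoid (AGerm E) := by
  refine UniqueFactorizationMonoid.of_exists_prime_factors fun F hF => ⟨0, by simp, ?_⟩
  rw [Multiset.prod_zero]
  refine (associated_one_iff_isUnit.2 ((isUnit_iff F).2 fun h => hF ?_)).symm
  obtain ⟨f, hf, rfl⟩ := exists_rep F
  exact of_eq_zero.2 (Eventually.of_forall fun x => by rw [Subsingleton.elim x 0]; exact h)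

end AGerm

end SimpleSing

/-! ### The Nullstellensatz for isolated zeros, by elimination. -/

namespace SimpleSing

open Polynomial

variable {E : Type*} [NormedAddCommGroup E] [NormedSpace ℂ E]

open AGerm

theorem eventually_sum_norm_lt {F : Type*} [NormedAddCommGroup F] {n : ℕ} (c : ℕ → F → ℂ) (hc : ∀ j < n, ContinuousAt (c j) 0)
    (hc0 : ∀ j < n, c j 0 = 0) {ε : ℝ} :
    ∀ᶠ x in 𝓝 (0 : F), ∑ j ∈ Finset.range n, ‖c j x‖ * (ε ^ j / ε ^ n) < 1 := by
  have h : Tendsto (fun x => ∑ j ∈ Finset.range n, ‖c j x‖ * (ε ^ j / ε ^ n)) (𝓝 (0 : F))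
      (𝓝 (∑ j ∈ Finset.range n, ‖c j 0‖ * (ε ^ j / ε ^ n))) :=
    tendsto_finsetSum _ fun j hj => ((hc j (Finset.mem_range.1 hj)).norm.tendsto).mul_const _
  refine h.eventually_lt_const ?_
  rw [Finset.sum_eq_zero]
  · exact one_pos
  · intro j hj
    rw [hc0 j (Finset.mem_range.1 hj)]; simp

/-- The roots of a polynomial with small lower coefficients are small. -/
theorem norm_lt_of_sum_lt {n : ℕ} {c : ℕ → ℂ} {ε : ℝ} (hε : 0 < ε)
    (hc : ∑ j ∈ Finset.range n, ‖c j‖ * (ε ^ j / ε ^ n) < 1) {t : ℂ}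
    (ht : t ^ n + ∑ j ∈ Finset.range n, c j * t ^ j = 0) : ‖t‖ < ε := by
  by_contra! h
  have ht0 : 0 < ‖t‖ := hε.trans_le h
  have h1 : ‖t‖ ^ n ≤ ∑ j ∈ Finset.range n, ‖c j‖ * ‖t‖ ^ j := by
    rw [← norm_pow, eq_neg_of_add_eq_zero_left ht, norm_neg]
    refine (norm_sum_le _ _).trans (le_of_eq (Finset.sum_congr rfl fun j _ => ?_))
    rw [norm_mul, norm_pow]
  have h2 : ∑ j ∈ Finset.range n, ‖c j‖ * ‖t‖ ^ j ≤
      ‖t‖ ^ n * ∑ j ∈ Finset.range n, ‖c j‖ * (ε ^ j / ε ^ n) := by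
    rw [Finset.mul_sum]
    refine Finset.sum_le_sum fun j hj => ?_
    have hj' := (Finset.mem_range.1 hj).le
    rw [mul_left_comm]
    refine mul_le_mul_of_nonneg_left ?_ (norm_nonneg _)
    rw [mul_div_assoc', le_div_iff₀ (pow_pos hε n)]
    calc ‖t‖ ^ j * ε ^ n = ‖t‖ ^ j * ε ^ (n - j) * ε ^ j := by
          rw [mul_assoc, ← pow_add, Nat.sub_add_cancel hj']
      _ ≤ ‖t‖ ^ j * ‖t‖ ^ (n - j) * ε ^ j := by gcongr
      _ = ‖t‖ ^ n * ε ^ j := by rw [← pow_add, Nat.add_sub_cancel' hj']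
  have h3 : 0 < ‖t‖ ^ n := pow_pos ht0 n
  nlinarith

/-- The family of functions has no common zero near the origin, except possibly the origin. -/
def IsolatedZero {k : ℕ} (f : Fin k → AnalyticFun E) : Prop :=
  ∀ᶠ x in 𝓝 (0 : E), (∀ i, (f i : E → ℂ) x = 0) → x = 0

/-- The ideal of germs generated by a family of functions. -/
noncomputable def germIdeal {k : ℕ} (f : Fin k → AnalyticFun E) : Ideal (AGerm E) :=
  Ideal.span (Set.range fun i => mk E (f i))

variable (E) in
/-- The Nullstellensatz for isolated zeros: a power of every germ vanishing at an isolated zero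
belongs to the ideal. -/
def Nullstellensatz : Prop :=
  ∀ (k : ℕ) (f : Fin k → AnalyticFun E), IsolatedZero f →
    ∀ φ : AGerm E, value φ = 0 → φ ∈ (germIdeal f).radical

theorem nullstellensatz_of_subsingleton [Subsingleton E] : Nullstellensatz E := by
  intro k f _ φ hφ
  have : φ = 0 := by
    obtain ⟨g, hg, rfl⟩ := exists_rep φ
    exact of_eq_zero.2 (Eventually.of_forall fun x => by rw [Subsingleton.elim x 0]; exact hφ)
  rw [this]; exact zero_mem _

/-- The generic linear combination of polynomials, with powers of a new variable as
coefficients. -/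
noncomputable def genericComb {R : Type*} [CommRing R] {k : ℕ} (g : Fin k → R[X]) : R[X][X] :=
  ∑ i : Fin k, C ((X : R[X]) ^ (i : ℕ)) * (g i).map C

theorem map_genericComb {R S : Type*} [CommRing R] [CommRing S] (ψ : R →+* S) {k : ℕ}
    (g : Fin k → R[X]) :
    (genericComb g).map (mapRingHom ψ) = genericComb fun i => (g i).map ψ := by
  simp only [genericComb, Polynomial.map_sum, Polynomial.map_mul, map_C, Polynomial.map_map]
  refine Finset.sum_congr rfl fun i _ => ?_
  congr 1
  · simp
  · congr 1
    ext a; simp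

theorem map_resultant_genericComb {R S : Type*} [CommRing R] [CommRing S] (ψ : R →+* S) {k : ℕ}
    (P : R[X]) (g : Fin k → R[X]) (m n : ℕ) :
    (resultant (P.map C) (genericComb g) m n).map ψ =
      resultant ((P.map ψ).map C) (genericComb fun i => (g i).map ψ) m n := by
  have h1 : (P.map ψ).map C = (P.map C).map (mapRingHom ψ) := by
    rw [Polynomial.map_map, Polynomial.map_map]
    congr 1
    ext a; simp
  rw [← map_genericComb, h1, resultant_map_map]
  rfl

/-- The resultant is the product, over the roots `t` of `P`, of the polynomials `∑ T^i g_i(t)`, each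
of which has a nonzero coefficient. -/
theorem resultant_genericComb_ne_zero {k m : ℕ} {P : ℂ[X]} (hP : P.Monic) {g : Fin k → ℂ[X]}
    (hm : (genericComb g).natDegree ≤ m) (h : ∀ t, P.eval t = 0 → ∃ i, (g i).eval t ≠ 0) :
    resultant (P.map C) (genericComb g) P.natDegree m ≠ 0 := by
  have hs : P.Splits := IsAlgClosed.splits P
  rw [← hP.natDegree_map (C : ℂ →+* ℂ[X]), resultant_eq_prod_eval _ _ _ hm (hs.map C),
    (hP.map C).leadingCoeff, one_pow, one_mul, hs.roots_map, Multiset.map_map, Ne,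
    Multiset.prod_eq_zero_iff, Multiset.mem_map]
  rintro ⟨t, ht, h0⟩
  obtain ⟨i, hi⟩ := h t (isRoot_of_mem_roots ht)
  have h1 := congrArg (fun q : ℂ[X] => q.coeff i) h0
  simp only [Function.comp_apply, genericComb, eval_finsetSum, eval_mul, eval_C, eval_map,
    coeff_zero, finsetSum_coeff] at h1
  rw [Finset.sum_eq_single i] at h1
  · rw [eval₂_at_apply, mul_comm, coeff_C_mul, coeff_X_pow, if_pos rfl, mul_one] at h1
    exact hi h1
  · intro j _ hj
    rw [eval₂_at_apply, mul_comm, coeff_C_mul, coeff_X_pow, if_neg, mul_zero]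
    exact fun h' => hj (Fin.ext h'.symm)
  · simp

theorem zvar_regular : RegularOfOrder (zvar E) 1 :=
  ⟨1, isUnit_one, by rw [axis_zvar]; simp⟩

/-- Division by the last coordinate leaves a remainder of degree zero, that is, a germ of the base.
-/
theorem mem_of_base_mem_of_zvar_mem {J : Ideal (AGerm (E × ℂ))}
    (hb : ∀ a : AGerm E, value a = 0 → base E a ∈ J) (hz : zvar E ∈ J) (φ : AGerm (E × ℂ))
    (hφ : value φ = 0) : φ ∈ J := by
  obtain ⟨Q, r, hr, h⟩ := zvar_regular.exists_div φ
  have hr' : r.degree ≤ 0 := by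
    by_contra hcon
    rw [not_le] at hcon
    have h1 := natDegree_pos_iff_degree_pos.2 hcon
    have h2 := (natDegree_lt_iff_degree_lt (by rintro rfl; simp at h1)).2 hr
    omega
  rw [eq_C_of_degree_le_zero hr', polyMap_C] at h
  rw [h]
  refine add_mem (J.mul_mem_left _ hz) (hb _ ?_)
  have h3 := congrArg value h
  rwa [map_add, map_mul, value_zvar, mul_zero, zero_add, value_base, hφ, eq_comm] at h3

theorem polyMap_coeff_sum (P : (AGerm E)[X]) {n : ℕ} (hn : P.natDegree < n) :
    polyMap E P = ∑ j ∈ Finset.range n, base E (P.coeff j) * zvar E ^ j := by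
  rw [polyMap, coe_eval₂RingHom, eval₂_eq_sum_range' _ hn]
  rfl

/-- Elimination of the last variable. -/
theorem nullstellensatz_of_regular (hE : Nullstellensatz E) {k : ℕ} (f : Fin k → AnalyticFun (E × ℂ))
    (hf : IsolatedZero f) (i₀ : Fin k) {d : ℕ} (hreg : RegularOfOrder (mk _ (f i₀)) d)
    (φ : AGerm (E × ℂ)) (hφ : value φ = 0) : φ ∈ (germIdeal f).radical := by
  obtain ⟨P, hP, hPd, hPF⟩ := hreg.exists_weierstrass
  set I := germIdeal f with hI
  have hfI : ∀ i, mk _ (f i) ∈ I := fun i => Ideal.subset_span ⟨i, rfl⟩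
  have hPI : polyMap E P ∈ I := I.mem_of_dvd (hPF.symm.dvd) (hfI i₀)
  -- Expressing the resultant by the two polynomials needs positive degree; for `d = 0` the ideal is
  -- the unit ideal.
  by_cases hd0 : d = 0
  · have h1 : P = 1 := eq_one_of_monic_natDegree_zero hP.1 (hPd.trans hd0)
    rw [h1, map_one] at hPI
    rw [(Ideal.eq_top_iff_one I).2 hPI, Ideal.radical_top]
    trivial
  choose q g hgd hg using fun i => hP.regular.exists_div (mk _ (f i))
  have hgI : ∀ i, polyMap E (g i) ∈ I := fun i => by
    have : polyMap E (g i) = mk _ (f i) - q i * polyMap E P := by rw [hg i]; ring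
    rw [this]
    exact sub_mem (hfI i) (I.mul_mem_left _ hPI)
  choose q' hq' using fun i => mk_surjective (q i)
  choose g' hg' using fun i =>
    Polynomial.map_surjective (mk E).toRingHom mk_surjective (g i)
  obtain ⟨P₀, hP₀⟩ := Polynomial.map_surjective (mk E).toRingHom mk_surjective P
  obtain ⟨P', hP', hPd', hPm'⟩ :=
    Polynomial.lifts_and_natDegree_eq_and_monic ((mem_lifts P).2 ⟨P₀, hP₀⟩) hP.1
  have hfe : ∀ᶠ p in 𝓝 (0 : E × ℂ), ∀ i, (f i : E × ℂ → ℂ) p =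
      (q' i : E × ℂ → ℂ) p * polyFun P' p + polyFun (g' i) p := by
    rw [eventually_all]
    intro i
    have := hg i
    rw [← hq' i, ← hP', ← hg' i, polyMap_map_mk, polyMap_map_mk, mk_eq_of, mk_eq_of, of_mul,
      of_add, of_eq_of] at this
    exact this
  let G := genericComb g'
  let N : (AnalyticFun E)[X] := resultant (P'.map C) G P'.natDegree G.natDegree
  -- the coefficients of the resultant lie in the ideal
  have hNI : ∀ j, base E (mk E (N.coeff j)) ∈ I := by
    obtain ⟨a, b, -, -, hab⟩ := exists_mul_add_mul_eq_C_resultant (P'.map C) G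
      (natDegree_map_le) (le_refl G.natDegree) (Or.inl (by rw [hPd', hPd]; exact hd0))
    let β : AnalyticFun E →+* AGerm (E × ℂ) := (base E).toRingHom.comp (mk E).toRingHom
    let ψ : (AnalyticFun E)[X][X] →+* (AGerm (E × ℂ))[X] :=
      eval₂RingHom (mapRingHom β) (C (zvar E))
    have hψ : ∀ Q : (AnalyticFun E)[X], ψ (Q.map C) = C (polyMap E (Q.map (mk E).toRingHom)) := by
      intro Q
      simp only [ψ, polyMap, coe_eval₂RingHom, eval₂_map, hom_eval₂]
      congr 1
      ext a; simp [β]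
    have h1 : ψ (C N) ∈ Ideal.map C I := by
      rw [← hab, map_add, map_mul, map_mul]
      refine add_mem (Ideal.mul_mem_right _ _ ?_) (Ideal.mul_mem_right _ _ ?_)
      · rw [hψ, hP']
        exact Ideal.mem_map_of_mem C hPI
      · simp only [G, genericComb, map_sum, map_mul]
        refine sum_mem fun i _ => Ideal.mul_mem_left _ _ ?_
        rw [hψ, hg']
        exact Ideal.mem_map_of_mem C (hgI i)
    intro j
    have h2 := Ideal.mem_map_C_iff.1 h1 j
    simpa [ψ, β] using h2
  -- the coefficients of the resultant have an isolated zero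
  have hNiso : IsolatedZero fun j : Fin (N.natDegree + 1) => N.coeff j := by
    obtain ⟨ε, hε, hball⟩ := Metric.eventually_nhds_iff.1 (hf.and hfe)
    have hcv : ∀ j < d, (P'.coeff j : E → ℂ) 0 = 0 := by
      intro j hj
      have h1 := congrArg (fun Q => Q.coeff j) hP.2
      simp only [coeff_map, coeff_X_pow, hPd, hj.ne, if_false] at h1
      rw [← hP', coeff_map] at h1
      exact h1
    -- This keeps the roots of `P'` over `x` within `ε`, where the isolation of the zero and the
    -- division identities hold.
    have hsmall := eventually_sum_norm_lt (n := d) (fun j => (P'.coeff j : E → ℂ))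
      (fun j _ => (analyticAt_coe (P'.coeff j)).continuousAt) hcv (ε := ε)
    filter_upwards [hsmall, Metric.ball_mem_nhds (0 : E) hε] with x hx hxε hall
    have hN0 : N.map (evalAt x) = 0 := by
      ext j
      rw [coeff_map, coeff_zero]
      by_cases hj : j < N.natDegree + 1
      · exact hall ⟨j, hj⟩
      · rw [coeff_eq_zero_of_natDegree_lt (by omega), map_zero]
    by_contra hx0
    have hmx : (P'.map (evalAt x)).natDegree = P'.natDegree := hPm'.natDegree_map _
    -- `G.natDegree` is kept as formal degree, since specialization at `x` may lower the actual
    -- degree.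
    have hres : N.map (evalAt x) = resultant ((P'.map (evalAt x)).map C)
        (genericComb fun i => (g' i).map (evalAt x)) (P'.map (evalAt x)).natDegree
          G.natDegree := by
      rw [hmx]
      exact map_resultant_genericComb (evalAt x) P' g' _ _
    rw [hres] at hN0
    refine resultant_genericComb_ne_zero (hPm'.map _) ?_ (fun t ht => ?_) hN0
    · rw [← map_genericComb]
      exact natDegree_map_le
    · by_contra! hgt
      have htε : ‖t‖ < ε := by
        refine norm_lt_of_sum_lt hε hx ?_
        rw [eval_map, eval₂_eq_sum_range, Finset.sum_range_succ, coeff_natDegree,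
          hPm'.leadingCoeff, map_one, one_mul, hPd', hPd, add_comm] at ht
        exact ht
      have hd : dist ((x, t) : E × ℂ) 0 < ε := by
        rw [dist_zero_right, Prod.norm_def]
        exact max_lt (by simpa using hxε) htε
      obtain ⟨h1, h2⟩ := hball hd
      have h3 : (x, t) = (0 : E × ℂ) := h1 fun i => by
        rw [h2 i]
        have e1 : polyFun P' (x, t) = 0 := by rw [polyFun, ← eval_map]; exact ht
        have e2 : polyFun (g' i) (x, t) = 0 := by rw [polyFun, ← eval_map]; exact hgt i
        rw [e1, e2]; simp
      exact hx0 (congrArg Prod.fst h3)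
  -- conclusion
  have hb : ∀ a : AGerm E, value a = 0 → base E a ∈ I.radical := by
    intro a ha
    obtain ⟨n, hn⟩ := hE _ _ hNiso a ha
    refine ⟨n, ?_⟩
    rw [← map_pow]
    have h1 : germIdeal (fun j : Fin (N.natDegree + 1) => N.coeff j) ≤ I.comap (base E) := by
      rw [germIdeal, Ideal.span_le]
      rintro _ ⟨j, rfl⟩
      exact hNI j
    exact h1 hn
  refine mem_of_base_mem_of_zvar_mem hb ?_ φ hφ
  -- Here `P` lies in the ideal, and its lower coefficients vanish at the origin, so they already
  -- lie in the radical.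
  have hz : zvar E ^ d ∈ I.radical := by
    have h1 := polyMap_coeff_sum P (Nat.lt_succ_self _)
    rw [Finset.sum_range_succ, coeff_natDegree, hP.1.leadingCoeff, map_one, one_mul, hPd] at h1
    have h2 : zvar E ^ d = polyMap E P - ∑ j ∈ Finset.range d, base E (P.coeff j) * zvar E ^ j := by
      rw [h1]; ring
    rw [h2]
    refine sub_mem (Ideal.le_radical hPI) (sum_mem fun j hj => Ideal.mul_mem_right _ _ (hb _ ?_))
    have h3 := congrArg (fun Q => Q.coeff j) hP.2
    simp only [coeff_map, coeff_X_pow, hPd, (Finset.mem_range.1 hj).ne, if_false] at h3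
    exact h3
  exact Ideal.radical_isRadical I ⟨d, hz⟩

end SimpleSing

namespace SimpleSing

open Polynomial AGerm

/-! ### Linear changes of coordinates and induction on the dimension. -/

section Transport

variable {E : Type*} [NormedAddCommGroup E] [NormedSpace ℂ E]
  {E' : Type*} [NormedAddCommGroup E'] [NormedSpace ℂ E']

/-- Composition of an analytic function with a linear isomorphism. -/
def compEquiv (e : E' ≃L[ℂ] E) (f : AnalyticFun E) : AnalyticFun E' :=
  ⟨fun x => (f : E → ℂ) (e x),
    AnalyticAt.fun_comp (by rw [map_zero]; exact analyticAt_coe f) (analyticAt_equiv e)⟩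

theorem mk_compEquiv (e : E' ≃L[ℂ] E) (f : AnalyticFun E) :
    mk E' (compEquiv e f) = congr e (mk E f) := rfl

theorem IsolatedZero.compEquiv {k : ℕ} {f : Fin k → AnalyticFun E} (hf : IsolatedZero f)
    (e : E' ≃L[ℂ] E) : IsolatedZero fun i => compEquiv e (f i) := by
  have ht : Tendsto e (𝓝 0) (𝓝 0) := by simpa using e.continuous.tendsto 0
  filter_upwards [ht.eventually hf] with x hx h
  exact (map_eq_zero_iff e e.injective).1 (hx h)

theorem mem_radical_of_congr (e : E' ≃L[ℂ] E) {k : ℕ} {f : Fin k → AnalyticFun E} {φ : AGerm E}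
    (h : congr e φ ∈ (germIdeal fun i => compEquiv e (f i)).radical) :
    φ ∈ (germIdeal f).radical := by
  obtain ⟨n, hn⟩ := h
  refine ⟨n, ?_⟩
  have h1 : (germIdeal fun i => compEquiv e (f i)) ≤ (germIdeal f).comap (congr e).symm := by
    rw [germIdeal, Ideal.span_le]
    rintro _ ⟨i, rfl⟩
    change (congr e).symm (mk E' (compEquiv e (f i))) ∈ germIdeal f
    rw [mk_compEquiv, AlgEquiv.symm_apply_apply]
    exact Ideal.subset_span ⟨i, rfl⟩
  have h2 : (congr e).symm (congr e φ ^ n) ∈ germIdeal f := h1 hn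
  rwa [← map_pow, AlgEquiv.symm_apply_apply] at h2

theorem Nullstellensatz.congr (hE : Nullstellensatz E') (e : E' ≃L[ℂ] E) : Nullstellensatz E := by
  intro k f hf φ hφ
  refine mem_radical_of_congr e (hE k _ (hf.compEquiv e) _ ?_)
  rw [value_congr, hφ]

theorem Nullstellensatz.prod (hE : Nullstellensatz E) : Nullstellensatz (E × ℂ) := by
  intro k f hf φ hφ
  have h1 : ∃ i, mk _ (f i) ≠ 0 := by
    by_contra! hcon
    have h2 : ∀ᶠ p in 𝓝 (0 : E × ℂ), ∀ i, (f i : E × ℂ → ℂ) p = 0 := by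
      rw [eventually_all]
      intro i
      exact of_eq_zero.1 (hcon i)
    have h3 : zvar E = 0 := by
      refine of_eq_zero.2 ?_
      filter_upwards [hf, h2] with p hp hp2
      rw [hp hp2]; rfl
    exact coord_ne_zero (by rw [← axis_zvar (E := E), h3, map_zero])
  obtain ⟨i, hi⟩ := h1
  obtain ⟨e, he⟩ := exists_axis_congr_ne_zero hi
  obtain ⟨d, hd⟩ := exists_regularOfOrder he
  refine mem_radical_of_congr e
    (nullstellensatz_of_regular hE _ (hf.compEquiv e) i (d := d) hd _ ?_)
  rw [value_congr, hφ]

end Transport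

/-! ### Regular sequences and division by a vector field with an isolated zero. -/

section Koszul

/-- Exactness of the Koszul complex of three elements of a commutative ring, if the ideal they
generate contains a regular sequence of length three. -/
theorem exists_cross_of_dot_eq_zero {R : Type*} [CommRing R] {u₁ u₂ u₃ : R}
    (r₁ : ∀ a, u₁ * a = 0 → a = 0) (r₂ : ∀ a, u₁ ∣ u₂ * a → u₁ ∣ a)
    (r₃ : ∀ a b c, u₃ * a = u₁ * b + u₂ * c → ∃ b' c', a = u₁ * b' + u₂ * c')
    {X l m n : Fin 3 → R} (hl : u₁ = ∑ i, l i * X i) (hm : u₂ = ∑ i, m i * X i)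
    (hn : u₃ = ∑ i, n i * X i) {a : Fin 3 → R} (ha : ∑ i, a i * X i = 0) :
    ∃ S : Fin 3 → R, a = crossProduct S X := by
  rw [Fin.sum_univ_three] at hl hm hn ha
  -- Since `a · X = 0`, `(l × a) × X = (l · X) a = u₁ a`: the claim holds up to the factor `u₁`,
  -- which remains to be removed.
  set S : Fin 3 → R := crossProduct l a with hS
  have hSX : ∀ i, u₁ * a i = crossProduct S X i := by
    intro i
    rw [hS, cross_apply, cross_apply]
    fin_cases i <;> simp only [Fin.isValue, Matrix.cons_val, Fin.zero_eta, Fin.mk_one,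
      Fin.reduceFinMk]
    · linear_combination a 0 * hl + l 0 * ha
    · linear_combination a 1 * hl + l 1 * ha
    · linear_combination a 2 * hl + l 2 * ha
  set T : Fin 3 → R := crossProduct m a with hT
  have h2 : ∀ i, u₂ * S i = (m 0 * S 0 + m 1 * S 1 + m 2 * S 2) * X i + u₁ * T i := by
    intro i
    have e0 := hSX 0
    have e1 := hSX 1
    have e2 := hSX 2
    rw [cross_apply] at e0 e1 e2
    rw [hT, cross_apply]
    simp only [Fin.isValue, Matrix.cons_val] at e0 e1 e2
    fin_cases i <;> simp only [Fin.isValue, Matrix.cons_val, Fin.zero_eta, Fin.mk_one,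
      Fin.reduceFinMk]
    · linear_combination S 0 * hm - m 1 * e2 + m 2 * e1
    · linear_combination S 1 * hm - m 2 * e0 + m 0 * e2
    · linear_combination S 2 * hm - m 0 * e1 + m 1 * e0
  set c := m 0 * S 0 + m 1 * S 1 + m 2 * S 2
  -- Pairing `u₂ S = c X + u₁ T` with `n` gives `u₃ c ∈ (u₁, u₂)`, so `c ∈ (u₁, u₂)` by regularity.
  -- Then `u₁` divides `u₂ (S - c₂ X)`, hence `S - c₂ X`, and the quotient solves the problem.
  obtain ⟨c₁, c₂, hc⟩ := r₃ c (-(n 0 * T 0 + n 1 * T 1 + n 2 * T 2))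
    (n 0 * S 0 + n 1 * S 1 + n 2 * S 2) (by
      linear_combination c * hn - n 0 * h2 0 - n 1 * h2 1 - n 2 * h2 2)
  have h3 : ∀ i, u₁ ∣ S i - c₂ * X i := fun i => by
    refine r₂ _ ⟨c₁ * X i + T i, ?_⟩
    linear_combination h2 i + X i * hc
  choose S' hS' using h3
  refine ⟨S', ?_⟩
  funext i
  rw [← sub_eq_zero]
  refine r₁ _ ?_
  rw [mul_sub, hSX i, cross_apply, cross_apply]
  fin_cases i <;> simp only [Fin.isValue, Matrix.cons_val, Fin.zero_eta, Fin.mk_one,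
      Fin.reduceFinMk]
  · linear_combination X 2 * hS' 1 - X 1 * hS' 2
  · linear_combination X 0 * hS' 2 - X 2 * hS' 0
  · linear_combination X 1 * hS' 0 - X 0 * hS' 1

variable {E : Type*} [NormedAddCommGroup E] [NormedSpace ℂ E]

theorem zvar_ne_zero : zvar E ≠ 0 := zvar_regular.ne_zero

theorem zvar_pow_regular (n : ℕ) : RegularOfOrder (zvar E ^ n) n :=
  ⟨1, isUnit_one, by rw [map_pow, axis_zvar, mul_one]⟩

theorem zvar_pow_dvd_of_dvd_base_mul {n : ℕ} {a : AGerm E} (ha : a ≠ 0) {b : AGerm (E × ℂ)}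
    (h : zvar E ^ n ∣ base E a * b) : zvar E ^ n ∣ b :=
  (zvar_pow_regular n).dvd_of_dvd_base_mul ha h

/-- Powers of the three coordinates form a regular sequence. -/
theorem coordinates_regular {k m n : ℕ} {a b c : AGerm (((E × ℂ) × ℂ) × ℂ)}
    (h : base _ (base _ (zvar E)) ^ k * a = zvar _ ^ n * b + base _ (zvar (E × ℂ)) ^ m * c) :
    ∃ b' c', a = zvar _ ^ n * b' + base _ (zvar (E × ℂ)) ^ m * c' := by
  have hreg : RegularOfOrder (zvar ((E × ℂ) × ℂ) ^ n) n := zvar_pow_regular n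
  obtain ⟨Qa, ra, hra, ha⟩ := hreg.exists_div a
  obtain ⟨Qc, rc, hrc, hc⟩ := hreg.exists_div c
  -- Modulo the power of the last coordinate the relation becomes an equality of remainders, which
  -- can be compared coefficient by coefficient.
  have h1 : C (base _ (zvar E) ^ k) * ra - C (zvar (E × ℂ) ^ m) * rc = 0 := by
    refine hreg.eq_zero_of_dvd ?_ ⟨b + base _ (zvar (E × ℂ)) ^ m * Qc -
      base _ (base _ (zvar E)) ^ k * Qa, ?_⟩
    · refine lt_of_le_of_lt (degree_sub_le _ _) (max_lt ?_ ?_)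
      · exact lt_of_le_of_lt (by rw [← smul_eq_C_mul]; exact degree_smul_le _ _) hra
      · exact lt_of_le_of_lt (by rw [← smul_eq_C_mul]; exact degree_smul_le _ _) hrc
    · rw [map_sub, map_mul, map_mul, polyMap_C, polyMap_C, map_pow, map_pow]
      rw [ha, hc] at h
      linear_combination h
  have h2 : C (zvar (E × ℂ) ^ m) ∣ ra := by
    rw [C_dvd_iff_dvd_coeff]
    intro j
    have h3 := congrArg (fun p => p.coeff j) h1
    simp only [coeff_sub, coeff_C_mul, coeff_zero] at h3
    rw [← map_pow] at h3
    refine zvar_pow_dvd_of_dvd_base_mul (pow_ne_zero k zvar_ne_zero) ⟨rc.coeff j, ?_⟩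
    exact sub_eq_zero.1 h3
  obtain ⟨s, hs⟩ := h2
  refine ⟨Qa, polyMap _ s, ?_⟩
  rw [ha, hs, map_mul, polyMap_C, map_pow]
  ring

/-- A three-dimensional space presented as an iterated product. -/
abbrev M3 : Type := (((Fin 0 → ℂ) × ℂ) × ℂ) × ℂ

theorem nullstellensatz_M3 : Nullstellensatz M3 :=
  nullstellensatz_of_subsingleton.prod.prod.prod

theorem exists_equiv_M3 : Nonempty (M3 ≃L[ℂ] C3) := by
  refine FiniteDimensional.nonempty_continuousLinearEquiv_of_finrank_eq ?_
  simp

theorem nullstellensatz_C3 : Nullstellensatz C3 :=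
  let ⟨e⟩ := exists_equiv_M3
  nullstellensatz_M3.congr e

/-- Division of forms annihilated by a vector field with an isolated zero. -/
theorem exists_cross_of_isolatedZero {X : Fin 3 → AnalyticFun C3} (hX : IsolatedZero X)
    {a : Fin 3 → AGerm C3} (ha : ∑ i, a i * mk C3 (X i) = 0) :
    ∃ S : Fin 3 → AGerm C3, a = crossProduct S fun i => mk C3 (X i) := by
  obtain ⟨e⟩ := exists_equiv_M3
  have hX' := hX.compEquiv e
  have hrad : ∀ φ : AGerm M3, value φ = 0 → ∃ (n : ℕ) (l : Fin 3 → AGerm M3),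
      φ ^ n = ∑ i, l i * congr e (mk C3 (X i)) := by
    intro φ hφ
    obtain ⟨n, hn⟩ := nullstellensatz_M3 _ _ hX' φ hφ
    obtain ⟨l, hl⟩ := Ideal.mem_span_range_iff_exists_fun.1 hn
    exact ⟨n, l, hl.symm⟩
  obtain ⟨n₁, l, hl⟩ := hrad (zvar _) value_zvar
  obtain ⟨n₂, m, hm⟩ := hrad (base _ (zvar _)) (by rw [value_base, value_zvar])
  obtain ⟨n₃, n, hn⟩ := hrad (base _ (base _ (zvar _)))
    (by rw [value_base, value_base, value_zvar])
  have ha' : ∑ i, congr e (a i) * congr e (mk C3 (X i)) = 0 := by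
    simpa only [map_sum, map_mul, map_zero] using congrArg (congr e) ha
  obtain ⟨S, hS⟩ := exists_cross_of_dot_eq_zero (a := fun i => congr e (a i))
    (fun b hb => (mul_eq_zero.1 hb).resolve_left (pow_ne_zero _ zvar_ne_zero))
    (fun b hb => by
      rw [← map_pow] at hb
      exact zvar_pow_dvd_of_dvd_base_mul (pow_ne_zero _ zvar_ne_zero) hb)
    (fun a b c h => coordinates_regular h) hl hm hn ha'
  refine ⟨fun i => (congr e).symm (S i), ?_⟩
  funext i
  apply (congr e).injective
  rw [congrFun hS i, cross_apply, cross_apply]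
  fin_cases i <;> simp

end Koszul

end SimpleSing

namespace SimpleSing

open Polynomial AGerm

/-! ### Splitting off a common factor. -/

section CommonFactor

/-- Over an integrally closed domain, a monic polynomial and further polynomials have a monic
common factor such that the quotients have a common multiple of degree zero in their ideal. -/
theorem exists_monic_common_factor {R : Type*} [CommRing R] [IsDomain R] [IsIntegrallyClosed R]
    {k : ℕ} {P : R[X]} (hP : P.Monic) (r : Fin k → R[X]) :
    ∃ (h F : R[X]) (s : Fin k → R[X]) (ρ : R), h.Monic ∧ F.Monic ∧ P = h * F ∧
      (∀ i, r i = h * s i) ∧ ρ ≠ 0 ∧ C ρ ∈ Ideal.span (insert F (Set.range s)) := by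
  classical
  let K := FractionRing R
  let φ : R[X] →+* K[X] := mapRingHom (algebraMap R K)
  have hφ : Function.Injective (algebraMap R K) := IsFractionRing.injective R K
  have hφ' : Function.Injective φ := map_injective _ hφ
  let J : Ideal K[X] := Ideal.span (insert (φ P) (Set.range fun i => φ (r i)))
  obtain ⟨h₀, hh₀⟩ : ∃ h₀, J = Ideal.span {h₀} :=
    (IsPrincipalIdealRing.principal J).principal
  have hPJ : φ P ∈ J := Ideal.subset_span (Set.mem_insert _ _)
  have hdvd : ∀ {x}, x ∈ J → h₀ ∣ x := fun {x} hx => by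
    rw [hh₀] at hx
    exact Ideal.mem_span_singleton.1 hx
  have hPm : (φ P).Monic := hP.map _
  have hh0 : h₀ ≠ 0 := fun h0 => hPm.ne_zero (zero_dvd_iff.1 (h0 ▸ hdvd hPJ))
  -- By Gauss's lemma a divisor over the fraction field of a monic polynomial is, up to a constant,
  -- defined over the integrally closed ring.
  obtain ⟨h, hh⟩ := IsIntegrallyClosed.eq_map_mul_C_of_dvd K hP (hdvd hPJ)
  have hlc : h₀.leadingCoeff ≠ 0 := leadingCoeff_ne_zero.2 hh0
  have hmonK : (φ h).Monic := by
    have h1 : (φ h).leadingCoeff * h₀.leadingCoeff = h₀.leadingCoeff := by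
      have h2 := congrArg leadingCoeff hh
      rwa [leadingCoeff_mul, leadingCoeff_C] at h2
    exact mul_right_cancel₀ hlc (h1.trans (one_mul _).symm)
  have hmon : h.Monic := by
    have h1 : (φ h).leadingCoeff = algebraMap R K h.leadingCoeff :=
      leadingCoeff_map_of_injective hφ h
    refine hφ ?_
    rw [← h1, hmonK, map_one]
  have hunit : IsUnit (C h₀.leadingCoeff) := isUnit_C.2 hlc.isUnit
  have hass : Associated (φ h) h₀ := ⟨hunit.unit, hh⟩
  have hdvd' : ∀ {x}, φ x ∈ J → h ∣ x := fun {x} hx =>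
    (map_dvd_map _ hφ hmon).1 (hass.dvd.trans (hdvd hx))
  obtain ⟨F, hF⟩ := hdvd' hPJ
  have hs : ∀ i, ∃ s, r i = h * s := fun i =>
    hdvd' (Ideal.subset_span (Set.mem_insert_of_mem _ ⟨i, rfl⟩))
  choose s hs using hs
  have hFm : F.Monic := hmon.of_mul_monic_left (hF ▸ hP)
  let I : Ideal R[X] := Ideal.span (insert F (Set.range s))
  -- Over the fraction field `h` generates the original ideal, so the quotients by `h` generate the
  -- unit ideal; clearing denominators puts a nonzero constant `ρ` into `I`.
  have htop : I.map φ = ⊤ := by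
    have h1 : J ≤ Ideal.span {φ h} * I.map φ := by
      refine Ideal.span_le.2 (Set.insert_subset ?_ ?_)
      · rw [hF, map_mul]
        exact Ideal.mul_mem_mul (Ideal.mem_span_singleton_self _)
          (Ideal.mem_map_of_mem _ (Ideal.subset_span (Set.mem_insert _ _)))
      · rintro _ ⟨i, rfl⟩
        change φ (r i) ∈ _
        rw [hs, map_mul]
        exact Ideal.mul_mem_mul (Ideal.mem_span_singleton_self _)
          (Ideal.mem_map_of_mem _ (Ideal.subset_span (Set.mem_insert_of_mem _ ⟨i, rfl⟩)))
    have h2 : φ h ∈ J := by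
      rw [hh₀]
      exact Ideal.mem_span_singleton.2 hass.symm.dvd
    obtain ⟨y, hy, hy2⟩ := Ideal.mem_span_singleton_mul.1 (h1 h2)
    rw [Ideal.eq_top_iff_one]
    have : y = 1 := mul_left_cancel₀ hmonK.ne_zero (hy2.trans (mul_one _).symm)
    rwa [← this]
  let _ : Algebra R[X] K[X] := Polynomial.algebra R K
  have hloc : IsLocalization (Submonoid.map C (nonZeroDivisors R)) K[X] :=
    Polynomial.isLocalization _ _
  have hnd : ¬ Disjoint (Submonoid.map C (nonZeroDivisors R) : Set R[X]) (I : Set R[X]) :=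
    fun hd => (IsLocalization.map_algebraMap_ne_top_iff_disjoint
      (Submonoid.map C (nonZeroDivisors R)) K[X] I).2 hd htop
  rw [Set.not_disjoint_iff] at hnd
  obtain ⟨_, ⟨ρ, hρ, rfl⟩, hρI⟩ := hnd
  exact ⟨h, F, s, ρ, hmon, hFm, hF, hs, nonZeroDivisors.ne_zero hρ, hρI⟩

end CommonFactor

section Germs

variable {E : Type*} [NormedAddCommGroup E] [NormedSpace ℂ E]

/-- The components of a vector of germs have a common factor such that the ideal of the
quotients contains both a Weierstrass polynomial and a nonzero germ of the base. -/
theorem exists_common_factor [UniqueFactorizationMonoid (AGerm E)] {k : ℕ}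
    (w : Fin k → AGerm (E × ℂ)) {i₀ : Fin k} (hw : axis E (w i₀) ≠ 0) :
    ∃ (g : AGerm (E × ℂ)) (W : Fin k → AGerm (E × ℂ)) (F : (AGerm E)[X]) (ρ : AGerm E),
      g ≠ 0 ∧ (∀ i, w i = g * W i) ∧ F.Monic ∧ ρ ≠ 0 ∧
      polyMap E F ∈ Ideal.span (Set.range W) ∧ base E ρ ∈ Ideal.span (Set.range W) := by
  obtain ⟨d, hd⟩ := exists_regularOfOrder hw
  obtain ⟨P, hP, -, ⟨u, hu⟩⟩ := hd.exists_weierstrass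
  choose Q r hr hQ using fun i => hd.exists_div (w i)
  obtain ⟨h, F, s, ρ, hh, hF, hPF, hs, hρ, hmem⟩ := exists_monic_common_factor hP.1 r
  have hP0 : polyMap E P ≠ 0 := hP.regular.ne_zero
  have hg : polyMap E h ≠ 0 := by
    rw [hPF, map_mul] at hP0
    exact left_ne_zero_of_mul hP0
  have hFw : w i₀ = polyMap E h * (polyMap E F * u) := by
    rw [← hu, hPF, map_mul, mul_assoc]
  let W : Fin k → AGerm (E × ℂ) := fun i => Q i * (polyMap E F * u) + polyMap E (s i)
  have hW : ∀ i, w i = polyMap E h * W i := fun i => by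
    change _ = _ * (_ + _)
    rw [hQ i, hFw, hs i, map_mul]; ring
  have hFspan : polyMap E F ∈ Ideal.span (Set.range W) := by
    -- The component `w i₀` is the Weierstrass polynomial up to a unit, so its quotient by the
    -- common factor is `F` up to a unit.
    have h1 : W i₀ = polyMap E F * u := mul_left_cancel₀ hg ((hW i₀).symm.trans hFw)
    rw [← Ideal.mul_unit_mem_iff_mem _ u.isUnit, ← h1]
    exact Ideal.subset_span ⟨i₀, rfl⟩
  refine ⟨polyMap E h, W, F, ρ, hg, hW, hF, hρ, hFspan, ?_⟩
  have h2 : Ideal.span (insert F (Set.range s)) ≤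
      (Ideal.span (Set.range W)).comap (polyMap E) := by
    refine Ideal.span_le.2 (Set.insert_subset hFspan ?_)
    rintro _ ⟨i, rfl⟩
    have h3 : polyMap E (s i) = W i - Q i * (polyMap E F * u) := by
      change _ = _ + _ - _
      ring
    change polyMap E (s i) ∈ Ideal.span (Set.range W)
    rw [h3]
    exact sub_mem (Ideal.subset_span ⟨i, rfl⟩)
      (Ideal.mul_mem_left _ _ (Ideal.mul_mem_right _ _ hFspan))
  have h4 := h2 hmem
  rwa [Ideal.mem_comap, polyMap_C] at h4

end Germs

end SimpleSing

namespace SimpleSing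

open AGerm

/-! ### Linear algebra of cross products over a domain. -/

section Algebra

open Matrix in
/-- Criterion for two vectors `X`, `S` to form a basis of the orthogonal of `S × X`. -/
theorem exists_combination {A : Type*} [CommRing A] [IsDomain A] {X S c d : Fin 3 → A} {F R : A}
    (hF : F = c ⬝ᵥ crossProduct S X) (hR : R = d ⬝ᵥ crossProduct S X) (hF0 : F ≠ 0)
    (hdvd : ∀ a b, R * b = F * a → F ∣ b) {Z : Fin 3 → A} (hZ : crossProduct S X ⬝ᵥ Z = 0) :
    ∃ α β, ∀ i, Z i = α * X i + β * S i := by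
  set W := crossProduct S X with hW
  obtain ⟨k, hk⟩ : ∃ k, W k ≠ 0 := by
    by_contra! hcon
    exact hF0 (by rw [hF, show W = 0 from funext hcon, dotProduct_zero])
  -- A vector `q` parallel to `W` satisfies `R (c · q) = F (d · q)`. So `F` divides `c · q`, and the
  -- quotient is the factor of proportionality.
  have key : ∀ q : Fin 3 → A, (∀ i j, W i * q j = W j * q i) → ∃ γ, ∀ i, q i = γ * W i := by
    intro q hq
    have h1 : ∀ (v : Fin 3 → A) i, v ⬝ᵥ W * q i = W i * v ⬝ᵥ q := by
      intro v i
      simp only [dotProduct, Finset.sum_mul, Finset.mul_sum]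
      refine Finset.sum_congr rfl fun j _ => ?_
      linear_combination v j * hq j i
    obtain ⟨γ, hγ⟩ := hdvd (d ⬝ᵥ q) (c ⬝ᵥ q) (by
      rw [hF, hR]
      have h2 : c ⬝ᵥ W * d ⬝ᵥ q = d ⬝ᵥ W * c ⬝ᵥ q := by
        simp only [dotProduct, Fin.sum_univ_three]
        linear_combination (c 0 * d 1) * hq 0 1 + (c 0 * d 2) * hq 0 2 + (c 1 * d 0) * hq 1 0 +
          (c 1 * d 2) * hq 1 2 + (c 2 * d 0) * hq 2 0 + (c 2 * d 1) * hq 2 1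
      exact h2.symm)
    refine ⟨γ, fun i => mul_left_cancel₀ hF0 ?_⟩
    have h3 := h1 c i
    rw [← hF, hγ] at h3
    linear_combination h3
  rw [cross_apply] at hW
  have w0 := congrFun hW 0
  have w1 := congrFun hW 1
  have w2 := congrFun hW 2
  simp only [dotProduct, Fin.sum_univ_three] at hZ
  simp only [Fin.isValue, cons_val] at w0 w1 w2
  obtain ⟨β, hβ⟩ := key (crossProduct Z X) (by
    intro i j
    rw [cross_apply]
    fin_cases i <;> fin_cases j <;> simp only [Fin.isValue, cons_val, Fin.zero_eta, Fin.mk_one,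
      Fin.reduceFinMk, w0, w1, w2] at hZ ⊢ <;>
      first
      | rfl
      | linear_combination X 0 * hZ | linear_combination -X 0 * hZ
      | linear_combination X 1 * hZ | linear_combination -X 1 * hZ
      | linear_combination X 2 * hZ | linear_combination -X 2 * hZ)
  obtain ⟨α, hα⟩ := key (crossProduct S Z) (by
    intro i j
    rw [cross_apply]
    fin_cases i <;> fin_cases j <;> simp only [Fin.isValue, cons_val, Fin.zero_eta, Fin.mk_one,
      Fin.reduceFinMk, w0, w1, w2] at hZ ⊢ <;>
      first
      | rfl
      | linear_combination S 0 * hZ | linear_combination -S 0 * hZ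
      | linear_combination S 1 * hZ | linear_combination -S 1 * hZ
      | linear_combination S 2 * hZ | linear_combination -S 2 * hZ)
  refine ⟨α, β, ?_⟩
  rw [cross_apply] at hα hβ
  have a0 := hα 0
  have a1 := hα 1
  have a2 := hα 2
  have b0 := hβ 0
  have b1 := hβ 1
  have b2 := hβ 2
  simp only [Fin.isValue, cons_val] at a0 a1 a2 b0 b1 b2
  -- The difference `Y` is parallel to both `X` and `S`, so it is killed by every component of `W =
  -- S × X`.
  set Y : Fin 3 → A := fun i => Z i - α * X i - β * S i with hY
  have hYX : ∀ i j, Y i * X j = Y j * X i := by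
    intro i j
    fin_cases i <;> fin_cases j <;> simp only [hY, Fin.isValue, Fin.zero_eta, Fin.mk_one,
      Fin.reduceFinMk] <;>
      first
      | rfl
      | linear_combination b0 + β * w0 | linear_combination -b0 - β * w0
      | linear_combination b1 + β * w1 | linear_combination -b1 - β * w1
      | linear_combination b2 + β * w2 | linear_combination -b2 - β * w2
  have hYS : ∀ i j, Y i * S j = Y j * S i := by
    intro i j
    fin_cases i <;> fin_cases j <;> simp only [hY, Fin.isValue, Fin.zero_eta, Fin.mk_one,
      Fin.reduceFinMk] <;>
      first
      | rfl
      | linear_combination a0 + α * w0 | linear_combination -a0 - α * w0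
      | linear_combination a1 + α * w1 | linear_combination -a1 - α * w1
      | linear_combination a2 + α * w2 | linear_combination -a2 - α * w2
  intro i
  have h0 : W k * Y i = 0 := by
    fin_cases k <;> simp only [Fin.isValue, Fin.zero_eta, Fin.mk_one, Fin.reduceFinMk, w0, w1, w2]
    · linear_combination S 1 * hYX i 2 - S 2 * hYX i 1 + X i * hYS 2 1
    · linear_combination S 2 * hYX i 0 - S 0 * hYX i 2 + X i * hYS 0 2
    · linear_combination S 0 * hYX i 1 - S 1 * hYX i 0 + X i * hYS 1 0
  have h4 : Y i = 0 := (mul_eq_zero.1 h0).resolve_left hk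
  linear_combination h4

open Matrix in
theorem eq_zero_of_combination {A : Type*} [CommRing A] [IsDomain A] {X S : Fin 3 → A}
    (hW : crossProduct S X ≠ 0) {α β : A} (h : ∀ i, α * X i + β * S i = 0) : α = 0 ∧ β = 0 := by
  obtain ⟨k, hk⟩ := Function.ne_iff.1 hW
  rw [cross_apply] at hk
  constructor
  all_goals
    refine (mul_eq_zero.1 ?_).resolve_right hk
    fin_cases k <;> simp only [Fin.isValue, cons_val, Fin.zero_eta, Fin.mk_one,
      Fin.reduceFinMk]
  · linear_combination S 1 * h 2 - S 2 * h 1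
  · linear_combination S 2 * h 0 - S 0 * h 2
  · linear_combination S 0 * h 1 - S 1 * h 0
  · linear_combination X 2 * h 1 - X 1 * h 2
  · linear_combination X 0 * h 2 - X 2 * h 0
  · linear_combination X 1 * h 0 - X 0 * h 1

end Algebra

/-! ### Germs at arbitrary points, by translation. -/

section GermAt

theorem eventually_transl {E : Type*} [NormedAddCommGroup E] {p : E} {q : E → Prop} :
    (∀ᶠ x in 𝓝 0, q (p + x)) ↔ ∀ᶠ x in 𝓝 p, q x := by
  rw [← map_add_left_nhds_zero p]; rfl

variable {E : Type*} [NormedAddCommGroup E] [NormedSpace ℂ E]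

/-- Translation to the origin of a function analytic at `p`. -/
def transl {f : E → ℂ} {p : E} (hf : AnalyticAt ℂ f p) : AnalyticFun E :=
  ⟨fun x => f (p + x), AnalyticAt.fun_comp (f := fun x => p + x) (by simpa using hf)
    (analyticAt_const.add analyticAt_id)⟩

theorem mk_eq_mk {f g : AnalyticFun E} :
    mk E f = mk E g ↔ ∀ᶠ x in 𝓝 0, (f : E → ℂ) x = (g : E → ℂ) x :=
  of_eq_of (hf := analyticAt_coe f) (hg := analyticAt_coe g)

theorem mk_transl_eq {f g : E → ℂ} {p : E} {hf : AnalyticAt ℂ f p} {hg : AnalyticAt ℂ g p} :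
    mk E (transl hf) = mk E (transl hg) ↔ ∀ᶠ x in 𝓝 p, f x = g x :=
  mk_eq_mk.trans (eventually_transl (q := fun x => f x = g x))

theorem mk_transl_eq_zero {f : E → ℂ} {p : E} {hf : AnalyticAt ℂ f p} :
    mk E (transl hf) = 0 ↔ ∀ᶠ x in 𝓝 p, f x = 0 := by
  rw [← map_zero (mk E), mk_eq_mk]
  exact eventually_transl (q := fun x => f x = 0)

theorem exists_mk_transl (p : E) (φ : AGerm E) :
    ∃ (f : E → ℂ) (hf : AnalyticAt ℂ f p), φ = mk E (transl hf) := by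
  obtain ⟨f, hf, rfl⟩ := exists_rep φ
  refine ⟨fun x => f (x - p), AnalyticAt.fun_comp (f := fun x => x - p) (by simpa using hf)
    (analyticAt_id.sub analyticAt_const), ?_⟩
  refine of_eq_of.2 (Eventually.of_forall fun x => ?_)
  simp

end GermAt

end SimpleSing

namespace SimpleSing

open Polynomial AGerm

/-! ### Persistence of the division property at nearby points. -/

section LocalDiv

variable {E : Type*} [NormedAddCommGroup E] [NormedSpace ℂ E]
  {E' : Type*} [NormedAddCommGroup E'] [NormedSpace ℂ E']

/-- Near `p` the function `F` divides every analytic function `b` such that `F` divides `R b`. -/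
structure LocalDiv (R F : E → ℂ) (p : E) : Prop where
  left : AnalyticAt ℂ R p
  right : AnalyticAt ℂ F p
  ne_zero : ¬ ∀ᶠ x in 𝓝 p, F x = 0
  exists_div : ∀ a b : E → ℂ, AnalyticAt ℂ a p → AnalyticAt ℂ b p →
    (∀ᶠ x in 𝓝 p, R x * b x = F x * a x) →
    ∃ q : E → ℂ, AnalyticAt ℂ q p ∧ ∀ᶠ x in 𝓝 p, b x = F x * q x

theorem LocalDiv.comp_symm (e : E' ≃L[ℂ] E) {R F : E' → ℂ} {p : E'} (h : LocalDiv R F p) :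
    LocalDiv (fun x => R (e.symm x)) (fun x => F (e.symm x)) (e p) := by
  have ht : Tendsto e.symm (𝓝 (e p)) (𝓝 p) := by
    simpa using e.symm.continuous.tendsto (e p)
  have ht' : Tendsto e (𝓝 p) (𝓝 (e p)) := e.continuous.tendsto p
  have hs : ∀ {f : E' → ℂ}, AnalyticAt ℂ f p → AnalyticAt ℂ (fun x => f (e.symm x)) (e p) :=
    fun {f} hf => AnalyticAt.fun_comp (f := e.symm) (by simpa using hf)
      (e.symm.toContinuousLinearMap.analyticAt _)
  have he : ∀ {f : E → ℂ}, AnalyticAt ℂ f (e p) → AnalyticAt ℂ (fun x => f (e x)) p :=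
    fun {f} hf => AnalyticAt.fun_comp (f := e) hf (e.toContinuousLinearMap.analyticAt _)
  refine ⟨hs h.left, hs h.right, fun h0 => h.ne_zero ?_, fun a b ha hb hab => ?_⟩
  · filter_upwards [ht'.eventually h0] with x hx
    simpa using hx
  · obtain ⟨q, hq, hbq⟩ := h.exists_div (fun x => a (e x)) (fun x => b (e x)) (he ha) (he hb) (by
      filter_upwards [ht'.eventually hab] with x hx
      simpa using hx)
    refine ⟨_, hs hq, ?_⟩
    filter_upwards [ht.eventually hbq] with x hx
    simpa using hx

theorem eventually_not_eventually_zero {f : E → ℂ} {p : E} (hf : AnalyticAt ℂ f p)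
    (h0 : ¬ ∀ᶠ x in 𝓝 p, f x = 0) : ∀ᶠ q in 𝓝 p, ¬ ∀ᶠ x in 𝓝 q, f x = 0 := by
  obtain ⟨r, hr, hball⟩ := Metric.eventually_nhds_iff_ball.1 hf.eventually_analyticAt
  filter_upwards [Metric.ball_mem_nhds p hr] with q hq hcon
  refine h0 ?_
  have h1 := AnalyticOnNhd.eqOn_zero_of_preconnected_of_eventuallyEq_zero (U := Metric.ball p r)
    hball (convex_ball p r).isPreconnected hq hcon
  filter_upwards [Metric.ball_mem_nhds p hr] with x hx using h1 hx

/-- At `p` the function `F` is regular in the last variable, so `RegularOfOrder.dvd_of_dvd_base_mul`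
allows the base function `R` to be cancelled. -/
theorem localDiv_of_regular {R : E → ℂ} {F : E × ℂ → ℂ} {p : E × ℂ} (hR : AnalyticAt ℂ R p.1)
    (hR0 : ¬ ∀ᶠ x in 𝓝 p.1, R x = 0) (hF : AnalyticAt ℂ F p)
    (hF0 : ¬ ∀ᶠ z in 𝓝 p.2, F (p.1, z) = 0) : LocalDiv (fun q => R q.1) F p := by
  have hR' : AnalyticAt ℂ (fun q : E × ℂ => R q.1) p :=
    AnalyticAt.fun_comp (f := Prod.fst) hR analyticAt_fst
  have hax : axis E (mk _ (transl hF)) ≠ 0 := by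
    intro h
    refine hF0 ?_
    have h1 := of_eq_zero.1 h
    refine (eventually_transl (p := p.2) (q := fun z => F (p.1, z) = 0)).1 ?_
    filter_upwards [h1] with z hz
    have : p + ((0 : E), z) = (p.1, p.2 + z) := by ext <;> simp
    rw [← this]
    exact hz
  obtain ⟨d, hd⟩ := exists_regularOfOrder hax
  refine ⟨hR', hF, fun h => hd.ne_zero (mk_transl_eq_zero.2 h), fun a b ha hb hab => ?_⟩
  have hbase : base E (mk E (transl hR)) = mk _ (transl hR') := base_of _ _
  have h1 : mk _ (transl hF) ∣ base E (mk E (transl hR)) * mk _ (transl hb) := by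
    refine ⟨mk _ (transl ha), ?_⟩
    rw [hbase, ← map_mul, ← map_mul, mk_eq_mk]
    exact eventually_transl (q := fun x => R x.1 * b x = F x * a x) |>.2 hab
  obtain ⟨q, hq⟩ := hd.dvd_of_dvd_base_mul (fun h => hR0 (mk_transl_eq_zero.1 h)) h1
  obtain ⟨q, hqa, rfl⟩ := exists_mk_transl p q
  refine ⟨q, hqa, ?_⟩
  rw [← map_mul, mk_eq_mk] at hq
  exact eventually_transl (q := fun x => b x = F x * q x) |>.1 hq

theorem eventually_localDiv {P : (AnalyticFun E)[X]} (hP : P.Monic) {ρ : AnalyticFun E}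
    (hρ : mk E ρ ≠ 0) :
    ∀ᶠ p in 𝓝 (0 : E × ℂ), LocalDiv (fun q => (ρ : E → ℂ) q.1) (polyFun P) p := by
  have hρ0 : ¬ ∀ᶠ x in 𝓝 (0 : E), (ρ : E → ℂ) x = 0 := fun h => hρ (of_eq_zero.2 h)
  have ht : Tendsto Prod.fst (𝓝 (0 : E × ℂ)) (𝓝 (0 : E)) := continuous_fst.tendsto _
  filter_upwards [(analyticAt_polyFun P).eventually_analyticAt,
    ht.eventually (analyticAt_coe ρ).eventually_analyticAt,
    ht.eventually (eventually_not_eventually_zero (analyticAt_coe ρ) hρ0)] with p h1 h2 h3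
  refine localDiv_of_regular h2 h3 h1 fun h => ?_
  -- A polynomial vanishing on an open set of the vertical line has infinitely many roots, which is
  -- impossible for a monic one.
  have h4 : (P.map (evalAt p.1)) = 0 := by
    refine eq_zero_of_infinite_isRoot _ ((infinite_of_mem_nhds p.2 h).mono fun z hz => ?_)
    change eval z (P.map (evalAt p.1)) = 0
    rw [eval_map]
    exact hz
  exact (hP.map _).ne_zero h4

end LocalDiv

/-! ### From pairs of vector fields to free frames. -/

section Frame

open Matrix

theorem analyticAt_comp {Z : C3 → C3} {p : C3} (hZ : AnalyticAt ℂ Z p) (i : Fin 3) :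
    AnalyticAt ℂ (fun x => Z x i) p :=
  analyticAt_pi_iff.1 hZ i

theorem analyticAt_cross {S X : C3 → C3} {p : C3} (hS : AnalyticAt ℂ S p)
    (hX : AnalyticAt ℂ X p) : AnalyticAt ℂ (fun x => crossProduct (S x) (X x)) p := by
  refine analyticAt_pi_iff.2 fun i => ?_
  have s := analyticAt_comp hS
  have x := analyticAt_comp hX
  simp only [cross_apply]
  fin_cases i
  · exact ((s 1).mul (x 2)).sub ((s 2).mul (x 1))
  · exact ((s 2).mul (x 0)).sub ((s 0).mul (x 2))
  · exact ((s 0).mul (x 1)).sub ((s 1).mul (x 0))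

theorem analyticAt_dot {c W : C3 → C3} {p : C3} (hc : AnalyticAt ℂ c p)
    (hW : AnalyticAt ℂ W p) : AnalyticAt ℂ (fun x => c x ⬝ᵥ W x) p := by
  simp only [dotProduct]
  exact Finset.univ.analyticAt_fun_sum fun i _ => (analyticAt_comp hc i).mul (analyticAt_comp hW i)

/-- The germs at `p` of the components of a vector field. -/
noncomputable def vgerm {Z : C3 → C3} {p : C3} (hZ : AnalyticAt ℂ Z p) (i : Fin 3) : AGerm C3 :=
  mk C3 (transl (analyticAt_comp hZ i))

theorem vgerm_cross {S X : C3 → C3} {p : C3} (hS : AnalyticAt ℂ S p) (hX : AnalyticAt ℂ X p) :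
    crossProduct (vgerm hS) (vgerm hX) = vgerm (analyticAt_cross hS hX) := by
  funext i
  rw [cross_apply]
  simp only [vgerm, ← map_mul, ← map_sub]
  fin_cases i <;> refine mk_eq_mk.2 (Eventually.of_forall fun x => ?_) <;> simp [cross_apply, transl]

theorem vgerm_dot {c W : C3 → C3} {p : C3} (hc : AnalyticAt ℂ c p) (hW : AnalyticAt ℂ W p) :
    vgerm hc ⬝ᵥ vgerm hW = mk C3 (transl (analyticAt_dot hc hW)) := by
  simp only [dotProduct, Fin.sum_univ_three, vgerm, ← map_mul, ← map_add]
  refine mk_eq_mk.2 (Eventually.of_forall fun x => ?_)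
  simp [transl]

theorem vgerm_eq_combination {Z X S : C3 → C3} {α β : C3 → ℂ} {p : C3} (hZ : AnalyticAt ℂ Z p)
    (hX : AnalyticAt ℂ X p) (hS : AnalyticAt ℂ S p) (hα : AnalyticAt ℂ α p)
    (hβ : AnalyticAt ℂ β p) :
    (∀ i, vgerm hZ i = mk C3 (transl hα) * vgerm hX i + mk C3 (transl hβ) * vgerm hS i) ↔
      ∀ᶠ x in 𝓝 p, Z x = α x • X x + β x • S x := by
  simp only [vgerm, ← map_mul, ← map_add, mk_eq_mk, ← eventually_all]
  rw [← eventually_transl (p := p)]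
  refine eventually_congr (Eventually.of_forall fun x => ?_)
  rw [funext_iff]
  rfl

/-- Criterion for a pair of vector fields `X`, `S` to be a free frame of the kernel of
`g • (S × X)`. -/
theorem isFreeFrame_of_localDiv {ω : OneForm} {U : Set C3} (hω : AnalyticOnNhd ℂ ω U)
    {g F R : C3 → ℂ} {X S c d : C3 → C3} (hg : AnalyticOnNhd ℂ g U)
    (hX : AnalyticOnNhd ℂ X U) (hS : AnalyticOnNhd ℂ S U) (hc : AnalyticOnNhd ℂ c U)
    (hd : AnalyticOnNhd ℂ d U) (hg0 : ∀ p ∈ U, ¬ ∀ᶠ x in 𝓝 p, g x = 0)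
    (hωg : ∀ p ∈ U, ∀ v, ω p ![v] = g p * crossProduct (S p) (X p) ⬝ᵥ v)
    (hF : ∀ p ∈ U, F p = c p ⬝ᵥ crossProduct (S p) (X p))
    (hR : ∀ p ∈ U, R p = d p ⬝ᵥ crossProduct (S p) (X p))
    (hdiv : ∀ p ∈ U, LocalDiv R F p) (hU : IsOpen U) : IsFreeFrame ω U ![X, S] := by
  have hFg : ∀ p (hp : p ∈ U), mk C3 (transl (hdiv p hp).right) =
      vgerm (hc p hp) ⬝ᵥ crossProduct (vgerm (hS p hp)) (vgerm (hX p hp)) := fun p hp => by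
    rw [vgerm_cross, vgerm_dot, mk_transl_eq]
    filter_upwards [hU.mem_nhds hp] with x hx using hF x hx
  have hRg : ∀ p (hp : p ∈ U), mk C3 (transl (hdiv p hp).left) =
      vgerm (hd p hp) ⬝ᵥ crossProduct (vgerm (hS p hp)) (vgerm (hX p hp)) := fun p hp => by
    rw [vgerm_cross, vgerm_dot, mk_transl_eq]
    filter_upwards [hU.mem_nhds hp] with x hx using hR x hx
  have hF0 : ∀ p (hp : p ∈ U), mk C3 (transl (hdiv p hp).right) ≠ 0 := fun p hp h =>
    (hdiv p hp).ne_zero (mk_transl_eq_zero.1 h)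
  have huniq : ∀ p ∈ U, ∀ α β : C3 → ℂ, AnalyticAt ℂ α p → AnalyticAt ℂ β p →
      (∀ᶠ x in 𝓝 p, α x • X x + β x • S x = 0) →
      (∀ᶠ x in 𝓝 p, α x = 0) ∧ ∀ᶠ x in 𝓝 p, β x = 0 := by
    intro p hp α β hα hβ h
    have hW : crossProduct (vgerm (hS p hp)) (vgerm (hX p hp)) ≠ 0 := fun h0 =>
      hF0 p hp (by rw [hFg p hp, h0, dotProduct_zero])
    have hz : AnalyticAt ℂ (fun _ : C3 => (0 : C3)) p := analyticAt_const
    have h1 := (vgerm_eq_combination hz (hX p hp) (hS p hp) hα hβ).2 (h.mono fun x hx => hx.symm)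
    have h2 : ∀ i, vgerm hz i = 0 := fun i =>
      mk_transl_eq_zero.2 (Eventually.of_forall fun x => rfl)
    have h3 := eq_zero_of_combination hW fun i => (h1 i).symm.trans (h2 i)
    exact ⟨mk_transl_eq_zero.1 h3.1, mk_transl_eq_zero.1 h3.2⟩
  have hgen : ∀ p ∈ U, ∀ Z : C3 → C3, AnalyticAt ℂ Z p → (∀ᶠ x in 𝓝 p, ω x ![Z x] = 0) →
      ∃ α β : C3 → ℂ, AnalyticAt ℂ α p ∧ AnalyticAt ℂ β p ∧
        ∀ᶠ x in 𝓝 p, Z x = α x • X x + β x • S x := by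
    intro p hp Z hZ hZω
    have h1 : crossProduct (vgerm (hS p hp)) (vgerm (hX p hp)) ⬝ᵥ vgerm hZ = 0 := by
      rw [vgerm_cross, vgerm_dot, mk_transl_eq_zero]
      refine (eventually_eq_zero_of_mul (hg p hp)
        (analyticAt_dot (analyticAt_cross (hS p hp) (hX p hp)) hZ) ?_).resolve_left (hg0 p hp)
      filter_upwards [hZω, hU.mem_nhds hp] with x hx hxU
      rw [← hωg x hxU, hx]
    obtain ⟨α, β, hαβ⟩ := exists_combination (hFg p hp) (hRg p hp) (hF0 p hp) (fun a b hab => by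
      obtain ⟨a, ha, rfl⟩ := exists_mk_transl p a
      obtain ⟨b, hb, rfl⟩ := exists_mk_transl p b
      rw [← map_mul, ← map_mul, mk_eq_mk] at hab
      obtain ⟨q, hq, hbq⟩ := (hdiv p hp).exists_div a b ha hb
        (eventually_transl (q := fun x => R x * b x = F x * a x) |>.1 hab)
      refine ⟨mk C3 (transl hq), ?_⟩
      rw [← map_mul, mk_eq_mk]
      exact eventually_transl (q := fun x => b x = F x * q x) |>.2 hbq) h1
    obtain ⟨α, hα, rfl⟩ := exists_mk_transl p α
    obtain ⟨β, hβ, rfl⟩ := exists_mk_transl p β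
    exact ⟨α, β, hα, hβ, (vgerm_eq_combination hZ _ _ hα hβ).1 hαβ⟩
  refine ⟨hω, ?_, ?_, ?_⟩
  · intro i
    fin_cases i
    · refine ⟨hX, fun p hp => ?_⟩
      change ω p ![X p] = 0
      rw [hωg p hp, dotProduct_comm, dot_cross_self, mul_zero]
    · refine ⟨hS, fun p hp => ?_⟩
      change ω p ![S p] = 0
      rw [hωg p hp, dotProduct_comm, dot_self_cross, mul_zero]
  · intro V hV hVU Z hZ
    have h1 : ∀ p : V, ∃ α β : C3 → ℂ, AnalyticAt ℂ α p ∧ AnalyticAt ℂ β p ∧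
        ∀ᶠ x in 𝓝 (p : C3), Z x = α x • X x + β x • S x := fun p =>
      hgen p (hVU p.2) Z (hZ.1 p p.2) (by
        filter_upwards [hV.mem_nhds p.2] with x hx using hZ.2 x hx)
    choose α β hα hβ hαβ using h1
    classical
    -- The coefficients are glued from local solutions by taking at each point the value of the
    -- solution chosen there; local uniqueness makes the result agree with every local solution.
    let a : C3 → ℂ := fun p => if hp : p ∈ V then α ⟨p, hp⟩ p else 0
    let b : C3 → ℂ := fun p => if hp : p ∈ V then β ⟨p, hp⟩ p else 0
    have hab : ∀ p : V, (∀ᶠ x in 𝓝 (p : C3), a x = α p x) ∧ ∀ᶠ x in 𝓝 (p : C3), b x = β p x := by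
      intro p
      rw [← eventually_and]
      filter_upwards [hV.mem_nhds p.2, (hα p).eventually_analyticAt,
        (hβ p).eventually_analyticAt, (hαβ p).eventually_nhds] with x hx h1 h2 h3
      have h4 := huniq x (hVU hx) (fun y => α ⟨x, hx⟩ y - α p y) (fun y => β ⟨x, hx⟩ y - β p y)
        ((hα ⟨x, hx⟩).sub h1) ((hβ ⟨x, hx⟩).sub h2) (by
          filter_upwards [h3, hαβ ⟨x, hx⟩] with y hy hy'
          rw [sub_smul, sub_smul, sub_add_sub_comm, ← hy, ← hy', sub_self])
      simp only [a, b, hx, dif_pos]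
      exact ⟨sub_eq_zero.1 h4.1.self_of_nhds, sub_eq_zero.1 h4.2.self_of_nhds⟩
    refine ⟨![a, b], ?_, ?_⟩
    · intro i
      fin_cases i
      · exact fun p hp => (hα ⟨p, hp⟩).congr ((hab ⟨p, hp⟩).1.mono fun x hx => hx.symm)
      · exact fun p hp => (hβ ⟨p, hp⟩).congr ((hab ⟨p, hp⟩).2.mono fun x hx => hx.symm)
    · intro p hp
      rw [Fin.sum_univ_two]
      change Z p = a p • X p + b p • S p
      rw [(hab ⟨p, hp⟩).1.self_of_nhds, (hab ⟨p, hp⟩).2.self_of_nhds]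
      exact (hαβ ⟨p, hp⟩).self_of_nhds
  · intro V hV hVU a b ha hb hab i p hp
    have h1 := huniq p (hVU hp) (fun x => a 0 x - b 0 x) (fun x => a 1 x - b 1 x)
      ((ha 0 p hp).sub (hb 0 p hp)) ((ha 1 p hp).sub (hb 1 p hp)) (by
        filter_upwards [hV.mem_nhds hp] with x hx
        have h2 := hab x hx
        rw [Fin.sum_univ_two, Fin.sum_univ_two] at h2
        change a 0 x • X x + a 1 x • S x = b 0 x • X x + b 1 x • S x at h2
        rw [sub_smul, sub_smul, sub_add_sub_comm, h2, sub_self])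
    fin_cases i
    · exact sub_eq_zero.1 h1.1.self_of_nhds
    · exact sub_eq_zero.1 h1.2.self_of_nhds

end Frame

end SimpleSing

namespace SimpleSing

namespace AGerm

/-! ### Directional derivatives of germs and order of vanishing. -/

section Derivation

variable {E : Type*} [NormedAddCommGroup E] [NormedSpace ℂ E]

theorem analyticAt_fderiv_apply {f : E → ℂ} {p : E} (hf : AnalyticAt ℂ f p) (v : E) :
    AnalyticAt ℂ (fun x => fderiv ℂ f x v) p :=
  ((ContinuousLinearMap.apply ℂ ℂ v).analyticAt _).fun_comp hf.fderiv

/-- Directional derivative of a germ. -/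
noncomputable def dir (v : E) (φ : AGerm E) : AGerm E :=
  of (fun x => fderiv ℂ (exists_rep φ).choose x v)
    (analyticAt_fderiv_apply (exists_rep φ).choose_spec.choose v)

theorem dir_of (v : E) {f : E → ℂ} (hf : AnalyticAt ℂ f 0) :
    dir v (of f hf) = of (fun x => fderiv ℂ f x v) (analyticAt_fderiv_apply hf v) := by
  refine of_eq_of.2 ?_
  have h := of_eq_of.1 (exists_rep (of f hf)).choose_spec.choose_spec
  filter_upwards [EventuallyEq.fderiv (𝕜 := ℂ) h] with x hx
  rw [hx]

theorem dir_add (v : E) (φ ψ : AGerm E) : dir v (φ + ψ) = dir v φ + dir v ψ := by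
  obtain ⟨f, hf, rfl⟩ := exists_rep φ
  obtain ⟨g, hg, rfl⟩ := exists_rep ψ
  rw [of_add, dir_of, dir_of, dir_of, of_add, of_eq_of]
  filter_upwards [hf.eventually_analyticAt, hg.eventually_analyticAt] with x h1 h2
  rw [fderiv_fun_add h1.differentiableAt h2.differentiableAt]
  rfl

theorem dir_mul (v : E) (φ ψ : AGerm E) : dir v (φ * ψ) = dir v φ * ψ + φ * dir v ψ := by
  obtain ⟨f, hf, rfl⟩ := exists_rep φ
  obtain ⟨g, hg, rfl⟩ := exists_rep ψ
  rw [of_mul, dir_of, dir_of, dir_of, of_mul, of_mul, of_add, of_eq_of]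
  filter_upwards [hf.eventually_analyticAt, hg.eventually_analyticAt] with x h1 h2
  rw [fderiv_fun_mul h1.differentiableAt h2.differentiableAt]
  simp [mul_comm, add_comm]

theorem dir_sub (v : E) (φ ψ : AGerm E) : dir v (φ - ψ) = dir v φ - dir v ψ := by
  have h := dir_add v (φ - ψ) ψ
  rw [sub_add_cancel] at h
  exact eq_sub_of_add_eq h.symm

theorem dir_const (v : E) (c : ℂ) : dir v (algebraMap ℂ (AGerm E) c) = 0 := by
  rw [← of_const, dir_of]
  refine of_eq_zero.2 (Eventually.of_forall fun x => ?_)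
  simp

theorem dir_comm (u v : E) (φ : AGerm E) : dir u (dir v φ) = dir v (dir u φ) := by
  obtain ⟨f, hf, rfl⟩ := exists_rep φ
  rw [dir_of, dir_of, dir_of, dir_of, of_eq_of]
  filter_upwards [hf.eventually_analyticAt] with x hx
  have hd : DifferentiableAt ℂ (fderiv ℂ f) x := hx.fderiv.differentiableAt
  have h1 : ∀ w : E, fderiv ℂ (fun y => fderiv ℂ f y w) x =
      (ContinuousLinearMap.apply ℂ ℂ w).comp (fderiv ℂ (fderiv ℂ f) x) := fun w =>
    ((ContinuousLinearMap.apply ℂ ℂ w).hasFDerivAt.comp x hd.hasFDerivAt).fderiv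
  rw [h1, h1]
  exact (hx.contDiffAt.isSymmSndFDerivAt (n := ⊤) (by simp)).eq u v

theorem dir_pow (v : E) (φ : AGerm E) (n : ℕ) :
    dir v (φ ^ (n + 1)) = algebraMap ℂ (AGerm E) (n + 1) * φ ^ n * dir v φ := by
  induction n with
  | zero => simp
  | succ n ih =>
    rw [pow_succ, dir_mul, ih]
    rw [Nat.cast_add_one, map_add _ ((n : ℂ) + 1), map_one]
    ring

theorem value_dir (v : E) {f : E → ℂ} (hf : AnalyticAt ℂ f 0) :
    value (dir v (of f hf)) = fderiv ℂ f 0 v := by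
  rw [dir_of, value_of]

/-- The germ vanishes to order at least `n` at the origin. -/
def VanishesToOrder : ℕ → AGerm E → Prop
  | 0, _ => True
  | n + 1, φ => value φ = 0 ∧ ∀ v, VanishesToOrder n (dir v φ)

namespace VanishesToOrder

theorem zero (n : ℕ) : VanishesToOrder n (0 : AGerm E) := by
  induction n with
  | zero => trivial
  | succ n ih =>
    refine ⟨map_zero _, fun v => ?_⟩
    have h : dir v (0 : AGerm E) = 0 := by simpa using dir_const v 0
    rwa [h]

theorem of_succ {n : ℕ} {φ : AGerm E} (h : VanishesToOrder (n + 1) φ) : VanishesToOrder n φ := by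
  induction n generalizing φ with
  | zero => trivial
  | succ n ih => exact ⟨h.1, fun v => ih (h.2 v)⟩

theorem add {n : ℕ} {φ ψ : AGerm E} (hφ : VanishesToOrder n φ) (hψ : VanishesToOrder n ψ) :
    VanishesToOrder n (φ + ψ) := by
  induction n generalizing φ ψ with
  | zero => trivial
  | succ n ih =>
    refine ⟨by rw [map_add, hφ.1, hψ.1, add_zero], fun v => ?_⟩
    rw [dir_add]
    exact ih (hφ.2 v) (hψ.2 v)

theorem mul {m n : ℕ} {φ ψ : AGerm E} (hφ : VanishesToOrder m φ) (hψ : VanishesToOrder n ψ) :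
    VanishesToOrder (m + n) (φ * ψ) := by
  generalize hk : m + n = k
  induction k generalizing m n φ ψ with
  | zero => trivial
  | succ k ih =>
    have h0 : value (φ * ψ) = 0 := by
      rw [map_mul]
      rcases m with _ | m
      · rw [zero_add] at hk
        subst hk
        rw [hψ.1, mul_zero]
      · rw [hφ.1, zero_mul]
    refine ⟨h0, fun v => ?_⟩
    rw [dir_mul]
    refine add ?_ ?_
    · rcases m with _ | m
      · rw [zero_add] at hk
        subst hk
        exact ih (m := 0) trivial hψ.of_succ (zero_add k)
      · exact ih (hφ.2 v) hψ (by omega)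
    · rcases n with _ | n
      · rw [add_zero] at hk
        subst hk
        exact ih (n := 0) hφ.of_succ trivial (add_zero k)
      · exact ih hφ (hψ.2 v) (by omega)

theorem neg {n : ℕ} {φ : AGerm E} (hφ : VanishesToOrder n φ) : VanishesToOrder n (-φ) := by
  have h := mul (m := 0) (φ := -1) trivial hφ
  rwa [zero_add, neg_one_mul] at h

theorem sub {n : ℕ} {φ ψ : AGerm E} (hφ : VanishesToOrder n φ) (hψ : VanishesToOrder n ψ) :
    VanishesToOrder n (φ - ψ) := by
  rw [sub_eq_add_neg]
  exact hφ.add hψ.neg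

theorem of_mem_span {n : ℕ} {ι : Type*} {X : ι → AGerm E} (hX : ∀ i, VanishesToOrder n (X i))
    {φ : AGerm E} (hφ : φ ∈ Ideal.span (Set.range X)) : VanishesToOrder n φ := by
  induction hφ using Submodule.span_induction with
  | mem x hx =>
    obtain ⟨i, rfl⟩ := hx
    exact hX i
  | zero => exact zero n
  | add x y _ _ hx hy => exact hx.add hy
  | smul a x _ hx =>
    have h := mul (m := 0) (φ := a) trivial hx
    rwa [zero_add] at h

/-- Each derivative along `v` lowers both the order and the exponent by one, and the factors that
appear are nonzero in characteristic zero. -/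
theorem eq_zero_of_mul_pow {v : E} {x : AGerm E} (hx : dir v x = 1) {n : ℕ} {c : ℂ}
    (h : VanishesToOrder (n + 1) (algebraMap ℂ (AGerm E) c * x ^ n)) : c = 0 := by
  induction n generalizing c with
  | zero =>
    have h1 := h.1
    rwa [pow_zero, mul_one, AlgHom.commutes] at h1
  | succ n ih =>
    have h1 := h.2 v
    rw [dir_mul, dir_const, zero_mul, zero_add, dir_pow, hx, mul_one, ← mul_assoc, ← map_mul] at h1
    exact (mul_eq_zero.1 (ih h1)).resolve_right (Nat.cast_add_one_ne_zero n)

end VanishesToOrder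

end Derivation

/-! ### Consequences of the equation `X = curl (S × X)`. -/

section Curl

/-- The partial derivative of a germ. -/
noncomputable abbrev pd (i : Fin 3) : AGerm C3 → AGerm C3 := dir (e i)

/-- The curl of a vector of germs. -/
noncomputable def curl (w : Fin 3 → AGerm C3) : Fin 3 → AGerm C3 :=
  ![pd 1 (w 2) - pd 2 (w 1), pd 2 (w 0) - pd 0 (w 2), pd 0 (w 1) - pd 1 (w 0)]

theorem div_curl (w : Fin 3 → AGerm C3) :
    pd 0 (curl w 0) + pd 1 (curl w 1) + pd 2 (curl w 2) = 0 := by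
  simp only [curl, Fin.isValue, Matrix.cons_val, dir_sub]
  linear_combination dir_comm (e 0) (e 1) (w 2) + dir_comm (e 2) (e 0) (w 1) +
    dir_comm (e 1) (e 2) (w 0)

variable {X S : Fin 3 → AGerm C3}

/-- The classical formula for the curl of a cross product; its term `(div X) S` vanishes because `X`
is itself a curl. -/
theorem curl_cross (h : X = curl (crossProduct S X)) (i : Fin 3) :
    X i = (X 0 * pd 0 (S i) + X 1 * pd 1 (S i) + X 2 * pd 2 (S i)) -
      X i * (pd 0 (S 0) + pd 1 (S 1) + pd 2 (S 2)) -
      (S 0 * pd 0 (X i) + S 1 * pd 1 (X i) + S 2 * pd 2 (X i)) := by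
  have hdiv := div_curl (crossProduct S X)
  rw [← h] at hdiv
  have hi := congrFun h i
  rw [cross_apply] at hi
  simp only [curl, Fin.isValue, Matrix.cons_val, dir_sub, dir_mul] at hi
  fin_cases i <;> simp only [Fin.isValue, Fin.zero_eta, Fin.mk_one, Fin.reduceFinMk,
    Matrix.cons_val] at hi ⊢
  · linear_combination hi + S 0 * hdiv
  · linear_combination hi + S 1 * hdiv
  · linear_combination hi + S 2 * hdiv

/-- By `curl_cross`, `(S·∇)X_i` is a combination of the components of `X`, and the Leibniz rule
extends this to the ideal. -/
theorem dir_mem_span (h : X = curl (crossProduct S X)) {φ : AGerm C3}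
    (hφ : φ ∈ Ideal.span (Set.range X)) :
    S 0 * pd 0 φ + S 1 * pd 1 φ + S 2 * pd 2 φ ∈ Ideal.span (Set.range X) := by
  have hm : ∀ i, X i ∈ Ideal.span (Set.range X) := fun i => Ideal.subset_span ⟨i, rfl⟩
  induction hφ using Submodule.span_induction with
  | mem x hx =>
    obtain ⟨i, rfl⟩ := hx
    have h1 : S 0 * pd 0 (X i) + S 1 * pd 1 (X i) + S 2 * pd 2 (X i) =
        pd 0 (S i) * X 0 + pd 1 (S i) * X 1 + pd 2 (S i) * X 2 -
        (pd 0 (S 0) + pd 1 (S 1) + pd 2 (S 2)) * X i - X i := by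
      linear_combination curl_cross h i
    rw [h1]
    exact sub_mem (sub_mem (add_mem (add_mem (Ideal.mul_mem_left _ _ (hm _))
      (Ideal.mul_mem_left _ _ (hm _))) (Ideal.mul_mem_left _ _ (hm _)))
      (Ideal.mul_mem_left _ _ (hm _))) (hm _)
  | zero =>
    have h0 : ∀ v : C3, dir v (0 : AGerm C3) = 0 := fun v => by
      simpa using dir_const v 0
    simp [h0]
  | add x y _ _ hx hy =>
    simp only [dir_add]
    convert add_mem hx hy using 1
    ring
  | smul a x hx0 hx =>
    simp only [smul_eq_mul, dir_mul]
    convert add_mem (Ideal.mul_mem_left _ a hx)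
      (Ideal.mul_mem_left _ (S 0 * pd 0 a + S 1 * pd 1 a + S 2 * pd 2 a) hx0) using 1
    ring

/-- The germ of a coordinate function. -/
noncomputable def xvar (i : Fin 3) : AGerm C3 :=
  of (fun p => p i) (analyticAt_comp analyticAt_id i)

theorem value_xvar (i : Fin 3) : value (xvar i) = 0 := by rw [xvar, value_of]; rfl

theorem pd_xvar (i j : Fin 3) : pd j (xvar i) = if i = j then 1 else 0 := by
  have h : pd j (xvar i) = algebraMap ℂ (AGerm C3) (if i = j then 1 else 0) := by
    rw [← of_const, xvar, pd, dir_of, of_eq_of]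
    refine Eventually.of_forall fun x => ?_
    have h1 : fderiv ℂ (fun p : C3 => p i) x = ContinuousLinearMap.proj i :=
      (ContinuousLinearMap.proj (R := ℂ) (φ := fun _ : Fin 3 => ℂ) i).fderiv
    rw [h1]
    simp [e, Pi.single_apply]
  rw [h]
  split_ifs <;> simp

/-- Applying `S·∇` to the least power `x_i^(N+1)` in the ideal puts `(N+1) S_i x_i^N` into it. If
`S_i(0) ≠ 0`, this contradicts minimality. -/
theorem value_eq_zero_of_curl (h : X = curl (crossProduct S X)) (hX : ∀ i, value (X i) = 0)
    {i : Fin 3} (hrad : xvar i ∈ (Ideal.span (Set.range X)).radical) : value (S i) = 0 := by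
  classical
  by_contra hS
  have hex : ∃ n, xvar i ^ n ∈ Ideal.span (Set.range X) := hrad
  have hmin := fun m (hm : m < Nat.find hex) => Nat.find_min hex hm
  have hN := Nat.find_spec hex
  generalize Nat.find hex = N at hmin hN
  rcases N with _ | N
  · rw [pow_zero] at hN
    have h1 := VanishesToOrder.of_mem_span (n := 1) (fun j => ⟨hX j, fun _ => trivial⟩) hN
    exact one_ne_zero ((map_one value).symm.trans h1.1)
  · refine hmin N N.lt_succ_self ?_
    have h1 := dir_mem_span h hN
    simp only [dir_pow, pd_xvar] at h1
    have h2 : algebraMap ℂ (AGerm C3) (N + 1) * S i * xvar i ^ N ∈ Ideal.span (Set.range X) := by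
      convert h1 using 1
      fin_cases i <;> simp <;> ring
    refine (Ideal.unit_mul_mem_iff_mem _ ?_).1 h2
    rw [isUnit_iff, map_mul, AlgHom.commutes]
    exact mul_ne_zero (Nat.cast_add_one_ne_zero N) hS

theorem exists_value_dir_ne_zero (h : X = curl (crossProduct S X))
    (hrad : xvar 0 ∈ (Ideal.span (Set.range X)).radical) (hS : ∀ i, value (S i) = 0) :
    ∃ i v, value (dir v (S i)) ≠ 0 := by
  by_contra! hcon
  have hS1 : ∀ i v, VanishesToOrder 1 (dir v (S i)) := fun i v => ⟨hcon i v, fun _ => trivial⟩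
  have hS2 : ∀ i, VanishesToOrder 2 (S i) := fun i => ⟨hS i, hS1 i⟩
  -- If `S` vanishes to order two, every term of `curl_cross` vanishes to one order more than `X`,
  -- so `X` vanishes to all orders.
  have key : ∀ n i, VanishesToOrder n (X i) := by
    intro n
    induction n with
    | zero => exact fun i => trivial
    | succ n ih =>
      intro i
      have hSX : ∀ j, VanishesToOrder (n + 1) (S j * pd j (X i)) := by
        intro j
        rcases n with _ | n
        · exact (VanishesToOrder.mul (n := 0) (hS2 j) trivial).of_succ
        · have h1 := (hS2 j).mul ((ih i).2 (e j))
          rwa [add_comm 2 n] at h1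
      rw [curl_cross h i]
      exact ((((ih 0).mul (hS1 i _)).add ((ih 1).mul (hS1 i _))).add
        ((ih 2).mul (hS1 i _))).sub ((ih i).mul (((hS1 0 _).add (hS1 1 _)).add (hS1 2 _))) |>.sub
        (((hSX 0).add (hSX 1)).add (hSX 2))
  obtain ⟨N, hN⟩ := hrad
  have h1 := VanishesToOrder.of_mem_span (key (N + 1)) hN
  refine one_ne_zero (VanishesToOrder.eq_zero_of_mul_pow (v := e 0) (x := xvar 0) (n := N)
    (c := 1) ?_ ?_)
  · simpa using pd_xvar 0 0
  · rwa [map_one, one_mul]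

end Curl

end AGerm

end SimpleSing

namespace SimpleSing

open Polynomial AGerm Matrix

/-! ### Zero loci of codimension two, and passage from germs to a neighbourhood. -/

section Locus

/-- The ideal generated by the `W i` contains, in suitable coordinates, a monic polynomial in the
last variable and a nonzero germ of the other variables. -/
def SmallLocus (W : Fin 3 → AGerm C3) : Prop :=
  ∃ (σ : M3 ≃L[ℂ] C3) (F : (AGerm (((Fin 0 → ℂ) × ℂ) × ℂ))[X])
    (ρ : AGerm (((Fin 0 → ℂ) × ℂ) × ℂ)), F.Monic ∧ ρ ≠ 0 ∧
    (AGerm.congr σ).symm (polyMap _ F) ∈ Ideal.span (Set.range W) ∧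
    (AGerm.congr σ).symm (base _ ρ) ∈ Ideal.span (Set.range W)

theorem SmallLocus.mono {W W' : Fin 3 → AGerm C3} (h : SmallLocus W)
    (hW : ∀ i, W i ∈ Ideal.span (Set.range W')) : SmallLocus W' := by
  obtain ⟨σ, F, ρ, hF, hρ, h1, h2⟩ := h
  have h3 : Ideal.span (Set.range W) ≤ Ideal.span (Set.range W') :=
    Ideal.span_le.2 (by rintro _ ⟨i, rfl⟩; exact hW i)
  exact ⟨σ, F, ρ, hF, hρ, h3 h1, h3 h2⟩

theorem SmallLocus.of_mul {W W' : Fin 3 → AGerm C3} (h : SmallLocus W) (u : AGerm C3)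
    (hW : ∀ i, W i = u * W' i) : SmallLocus W' :=
  h.mono fun i => by
    rw [hW]
    exact Ideal.mul_mem_left _ _ (Ideal.subset_span ⟨i, rfl⟩)

theorem exists_eq_mul_smallLocus {w : Fin 3 → AGerm C3} {i₀ : Fin 3} (hw : w i₀ ≠ 0) :
    ∃ (g : AGerm C3) (W : Fin 3 → AGerm C3), g ≠ 0 ∧ (∀ i, w i = g * W i) ∧ SmallLocus W := by
  obtain ⟨σ₀⟩ := exists_equiv_M3
  obtain ⟨τ, hτ⟩ := exists_axis_congr_ne_zero (F := AGerm.congr σ₀ (w i₀))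
    ((map_ne_zero_iff _ (AGerm.congr σ₀).injective).2 hw)
  have hστ : ∀ φ : AGerm C3, AGerm.congr (τ.trans σ₀) φ = AGerm.congr τ (AGerm.congr σ₀ φ) := by
    intro φ
    obtain ⟨f, hf, rfl⟩ := exists_rep φ
    rw [congr_of, congr_of, congr_of]
    rfl
  generalize τ.trans σ₀ = σ at hστ
  rw [← hστ] at hτ
  obtain ⟨g, W, F, ρ, hg, hW, hF, hρ, h1, h2⟩ :=
    exists_common_factor (fun i => AGerm.congr σ (w i)) hτ
  have h3 : ∀ φ ∈ Ideal.span (Set.range W), (AGerm.congr σ).symm φ ∈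
      Ideal.span (Set.range fun i => (AGerm.congr σ).symm (W i)) := by
    intro φ hφ
    obtain ⟨c, rfl⟩ := Ideal.mem_span_range_iff_exists_fun.1 hφ
    rw [map_sum]
    refine sum_mem fun i _ => ?_
    rw [map_mul]
    exact Ideal.mul_mem_left _ _ (Ideal.subset_span ⟨i, rfl⟩)
  refine ⟨(AGerm.congr σ).symm g, fun i => (AGerm.congr σ).symm (W i),
    (map_ne_zero_iff _ (AGerm.congr σ).symm.injective).2 hg, fun i => ?_,
    σ, F, ρ, hF, hρ, h3 _ h1, h3 _ h2⟩
  rw [← map_mul, ← hW, AlgEquiv.symm_apply_apply]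

theorem congr_symm_of {E E' : Type*} [NormedAddCommGroup E] [NormedSpace ℂ E]
    [NormedAddCommGroup E'] [NormedSpace ℂ E'] (σ : E' ≃L[ℂ] E) {f : E' → ℂ}
    (hf : AnalyticAt ℂ f 0) (hf' : AnalyticAt ℂ (fun x => f (σ.symm x)) 0) :
    (AGerm.congr σ).symm (of f hf) = of (fun x => f (σ.symm x)) hf' := by
  rw [AlgEquiv.symm_apply_eq, congr_of, of_eq_of]
  exact Eventually.of_forall fun x => by simp

theorem vgerm_zero {Z : C3 → C3} (hZ : AnalyticAt ℂ Z 0) (i : Fin 3) :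
    vgerm hZ i = of (fun x => Z x i) (analyticAt_comp hZ i) :=
  of_eq_of.2 (Eventually.of_forall fun x => by simp)

theorem mk_transl_zero {f : C3 → ℂ} (hf : AnalyticAt ℂ f 0) :
    mk C3 (transl hf) = of f hf :=
  of_eq_of.2 (Eventually.of_forall fun x => by simp)

theorem exists_vgerm (c : Fin 3 → AGerm C3) :
    ∃ (Z : C3 → C3) (hZ : AnalyticAt ℂ Z 0), c = vgerm hZ := by
  choose f hf hc using fun i => exists_rep (c i)
  refine ⟨fun x i => f i x, AnalyticAt.pi hf, ?_⟩
  funext i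
  rw [vgerm_zero, hc]

theorem exists_dot_of_mem_span {W : C3 → C3} (hW : AnalyticAt ℂ W 0) {F : C3 → ℂ}
    {hF : AnalyticAt ℂ F 0} (h : of F hF ∈ Ideal.span (Set.range (vgerm hW))) :
    ∃ c : C3 → C3, AnalyticAt ℂ c 0 ∧ ∀ᶠ p in 𝓝 0, F p = c p ⬝ᵥ W p := by
  obtain ⟨c, hc⟩ := Ideal.mem_span_range_iff_exists_fun.1 h
  obtain ⟨c, hca, rfl⟩ := exists_vgerm c
  refine ⟨c, hca, ?_⟩
  change vgerm hca ⬝ᵥ vgerm hW = _ at hc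
  rw [vgerm_dot, mk_transl_zero, of_eq_of] at hc
  exact hc.mono fun x hx => hx.symm

/-- The vector field with the components of a differential form. -/
noncomputable def comps (ω : OneForm) (p : C3) : C3 := fun i => ω p ![e i]

theorem apply_eq_comps_dot (ω : OneForm) (p v : C3) : ω p ![v] = comps ω p ⬝ᵥ v := by
  have hv : v = ∑ i, v i • e i := by
    funext j
    simp [e, Finset.sum_apply, Pi.single_apply]
  have h : ∀ u : C3, ω p ![u] = ((ω p).toContinuousMultilinearMap.toContinuousLinearMap ![0] 0) u :=
    fun u => by
      change ω p ![u] = ω p (Function.update ![0] 0 u)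
      congr 1
      funext i
      fin_cases i
      simp
  simp only [comps, dotProduct, h]
  conv_lhs => rw [hv]
  rw [map_sum]
  refine Finset.sum_congr rfl fun i _ => ?_
  rw [map_smul, smul_eq_mul, mul_comm]

theorem analyticAt_comps {ω : OneForm} {p : C3} (hω : AnalyticAt ℂ ω p) :
    AnalyticAt ℂ (comps ω) p := by
  refine analyticAt_pi_iff.2 fun i => ?_
  exact ((ContinuousAlternatingMap.apply ℂ C3 ℂ ![e i]).analyticAt _).fun_comp hω

/-- The polynomial and base germ from `SmallLocus` satisfy `LocalDiv` at all points near `0`, so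
data given by germs at `0` yield a frame on a whole neighbourhood. -/
theorem exists_isFreeFrame {ω : OneForm} (hω : AnalyticAt ℂ ω 0) {g : C3 → ℂ} {X S : C3 → C3}
    (hg : AnalyticAt ℂ g 0) (hX : AnalyticAt ℂ X 0) (hS : AnalyticAt ℂ S 0)
    (hg0 : of g hg ≠ 0)
    (hωg : ∀ i, vgerm (analyticAt_comps hω) i =
      of g hg * crossProduct (vgerm hS) (vgerm hX) i)
    (hloc : SmallLocus (crossProduct (vgerm hS) (vgerm hX))) :
    ∃ U : Set C3, IsOpen U ∧ (0 : C3) ∈ U ∧ IsFreeFrame ω U ![X, S] := by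
  obtain ⟨σ, F, ρ, hF, hρ, h1, h2⟩ := hloc
  -- The lift must be monic as a polynomial over functions, so that it stays monic when evaluated at
  -- points other than the origin.
  obtain ⟨P, hPF, -, hP⟩ := lifts_and_natDegree_eq_and_monic (f := (AGerm.mk (((Fin 0 → ℂ) × ℂ) × ℂ)).toRingHom)
    (p := F) (by
      rw [lifts_iff_coeff_lifts]
      exact fun n => mk_surjective _) hF
  obtain ⟨ρ, rfl⟩ := mk_surjective ρ
  rw [vgerm_cross] at h1 h2 hωg
  have hs : ∀ {f : M3 → ℂ}, AnalyticAt ℂ f 0 → AnalyticAt ℂ (fun x => f (σ.symm x)) 0 :=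
    fun {f} hf => AnalyticAt.fun_comp (f := σ.symm) (by simpa using hf)
      (σ.symm.toContinuousLinearMap.analyticAt _)
  rw [← hPF, polyMap_map_mk, congr_symm_of σ _ (hs (analyticAt_polyFun P))] at h1
  rw [mk_eq_of, base_of, congr_symm_of σ _ (hs (AnalyticAt.fun_comp (f := Prod.fst)
    (analyticAt_coe ρ) analyticAt_fst))] at h2
  obtain ⟨c, hc, hFc⟩ := exists_dot_of_mem_span _ h1
  obtain ⟨d, hd, hRd⟩ := exists_dot_of_mem_span _ h2
  have ht : Tendsto σ.symm (𝓝 0) (𝓝 0) := by simpa using σ.symm.continuous.tendsto 0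
  have hdiv := ht.eventually (eventually_localDiv hP hρ)
  have hωg' : ∀ᶠ x in 𝓝 0, ∀ i, comps ω x i = g x * crossProduct (S x) (X x) i := by
    rw [eventually_all]
    intro i
    have h3 := hωg i
    rw [vgerm_zero, vgerm_zero, of_mul, of_eq_of] at h3
    exact h3
  obtain ⟨U, hU, hUo, h0⟩ := eventually_nhds_iff.1 (hω.eventually_analyticAt.and
    (hg.eventually_analyticAt.and (hX.eventually_analyticAt.and (hS.eventually_analyticAt.and
    (hc.eventually_analyticAt.and (hd.eventually_analyticAt.and
    ((eventually_not_eventually_zero hg fun h => hg0 (of_eq_zero.2 h)).and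
    (hωg'.and (hFc.and (hRd.and hdiv))))))))))
  refine ⟨U, hUo, h0, isFreeFrame_of_localDiv (fun p hp => (hU p hp).1) (fun p hp => (hU p hp).2.1)
    (fun p hp => (hU p hp).2.2.1) (fun p hp => (hU p hp).2.2.2.1)
    (fun p hp => (hU p hp).2.2.2.2.1) (fun p hp => (hU p hp).2.2.2.2.2.1)
    (fun p hp => (hU p hp).2.2.2.2.2.2.1) (fun p hp v => ?_)
    (fun p hp => (hU p hp).2.2.2.2.2.2.2.2.1) (fun p hp => (hU p hp).2.2.2.2.2.2.2.2.2.1)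
    (fun p hp => ?_) hUo⟩
  · have h3 : comps ω p = g p • crossProduct (S p) (X p) :=
      funext (hU p hp).2.2.2.2.2.2.2.1
    rw [apply_eq_comps_dot, h3, smul_dotProduct, smul_eq_mul]
  · have h3 := (hU p hp).2.2.2.2.2.2.2.2.2.2.comp_symm σ
    rwa [ContinuousLinearEquiv.apply_symm_apply] at h3

end Locus

end SimpleSing

namespace SimpleSing

open AGerm Matrix

/-! ### Choice of `S`: its linear part and its value at the origin. -/

section Normalization

theorem cross_smul_left {A : Type*} [CommRing A] (g : A) (S X : Fin 3 → A) :
    crossProduct (fun i => g * S i) X = fun i => g * crossProduct S X i := by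
  have h : (fun i => g * S i) = g • S := rfl
  rw [h, map_smul, LinearMap.smul_apply]
  rfl

theorem value_cross (S X : Fin 3 → AGerm C3) (i : Fin 3) :
    value (crossProduct S X i) =
      crossProduct (fun j => value (S j)) (fun j => value (X j)) i := by
  rw [cross_apply, cross_apply]
  fin_cases i <;> simp

theorem value_dir_mul (v : C3) (φ ψ : AGerm C3) :
    value (dir v (φ * ψ)) = value (dir v φ) * value ψ + value φ * value (dir v ψ) := by
  rw [dir_mul, map_add, map_mul, map_mul]

/-- An integrable germ `w` with curl `X`, zero at the origin, is of the form `g • (S × X)` with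
`S` of nonzero linear part, and `S` vanishes at the origin unless `g` does. -/
theorem exists_normalized {X w : Fin 3 → AGerm C3} (hcurl : X = curl w)
    (hw0 : ∀ i, value (w i) = 0) (hwne : ∃ i, w i ≠ 0)
    (hdiv : ∀ a : Fin 3 → AGerm C3, ∑ i, a i * X i = 0 → ∃ S, a = crossProduct S X)
    (hdot : ∑ i, w i * X i = 0) (hrad : ∀ i, xvar i ∈ (Ideal.span (Set.range X)).radical) :
    ∃ (g : AGerm C3) (S : Fin 3 → AGerm C3), g ≠ 0 ∧ (∀ i, w i = g * crossProduct S X i) ∧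
      SmallLocus (crossProduct S X) ∧ (∃ i v, value (dir v (S i)) ≠ 0) ∧
      ((∀ i, value (S i) = 0) ∨ value g = 0) := by
  obtain ⟨i₀, hi₀⟩ := hwne
  obtain ⟨g, W, hg, hgW, hloc⟩ := exists_eq_mul_smallLocus hi₀
  obtain ⟨T, rfl⟩ := hdiv W (by
    refine (mul_eq_zero.1 (?_ : g * _ = 0)).resolve_left hg
    rw [Finset.mul_sum, ← hdot]
    exact Finset.sum_congr rfl fun i _ => by rw [hgW, mul_assoc])
  have hw : w = crossProduct (fun i => g * T i) X := by
    rw [cross_smul_left]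
    exact funext hgW
  by_cases hgu : value g = 0
  · have hS0 : ∀ i, value (g * T i) = 0 := fun i => by rw [map_mul, hgu, zero_mul]
    obtain ⟨i, v, hv⟩ := exists_value_dir_ne_zero (hcurl.trans (congrArg curl hw)) (hrad 0) hS0
    -- As `g(0) = 0`, the nonzero linear part of `g T` comes from `T(0)`; in particular `T(0) ≠ 0`.
    rw [value_dir_mul, hgu, zero_mul, add_zero] at hv
    by_cases hT : ∃ i v, value (dir v (T i)) ≠ 0
    · exact ⟨g, T, hg, hgW, hloc, hT, Or.inr hgu⟩
    · push Not at hT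
      -- If `T` has no linear part, multiplication by the unit `1 + x` creates the linear part `x
      -- T(0)`, compensated by dividing `g` by the same unit.
      have hu : IsUnit (1 + xvar 0) := by
        rw [AGerm.isUnit_iff, map_add, map_one, value_xvar, add_zero]
        exact one_ne_zero
      obtain ⟨u, hu⟩ := hu
      have hcr : ∀ j, crossProduct T X j =
          ↑u⁻¹ * crossProduct (fun i => (u : AGerm C3) * T i) X j := fun j => by
        rw [cross_smul_left, Units.inv_mul_cancel_left]
      refine ⟨g * ↑u⁻¹, fun i => u * T i, mul_ne_zero hg (Units.ne_zero _), fun j => ?_,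
        hloc.of_mul _ hcr, ⟨i, e 0, ?_⟩, Or.inr ?_⟩
      · rw [hgW, hcr, mul_assoc]
      · have h1 : dir (e 0) (1 + xvar 0) = (1 : AGerm C3) := by
          have h2 : dir (e 0) (1 : AGerm C3) = 0 := by simpa using dir_const (e 0) 1
          rw [dir_add, h2, zero_add]
          simpa using pd_xvar 0 0
        rw [value_dir_mul, hT, mul_zero, add_zero, hu, h1, map_one, one_mul]
        exact right_ne_zero_of_mul hv
      · rw [map_mul, hgu, zero_mul]
  · obtain ⟨u, rfl⟩ := (AGerm.isUnit_iff g).2 hgu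
    have hS : ∃ S, w = crossProduct S X ∧ ∀ i, value (S i) = 0 := by
      by_cases hX : ∀ i, value (X i) = 0
      · exact ⟨_, hw, fun i => value_eq_zero_of_curl (hcurl.trans (congrArg curl hw)) hX (hrad i)⟩
      · push Not at hX
        obtain ⟨k, hk⟩ := hX
        generalize (fun i => (u : AGerm C3) * T i) = S at hw
        -- From `w(0) = 0` it follows that `S(0) × X(0) = 0`, so `S(0)` is a multiple of `X(0)`;
        -- subtracting that multiple of `X` does not change `S × X`.
        refine ⟨fun i => S i - algebraMap ℂ _ (value (S k) / value (X k)) * X i, ?_, fun i => ?_⟩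
        · rw [hw]
          funext i
          rw [cross_apply, cross_apply]
          fin_cases i <;> simp <;> ring
        · have hc : crossProduct (fun j => value (S j)) (fun j => value (X j)) = 0 := by
            funext j
            rw [← value_cross, ← hw, hw0]
            rfl
          have c0 := congrFun hc 0
          have c1 := congrFun hc 1
          have c2 := congrFun hc 2
          rw [cross_apply] at c0 c1 c2
          simp only [Fin.isValue, cons_val, Pi.zero_apply] at c0 c1 c2
          rw [map_sub, map_mul, AlgHom.commutes, Algebra.algebraMap_self, RingHom.id_apply]
          field_simp
          generalize hs : (fun j => value (S j)) = s at *
          generalize hx : (fun j => value (X j)) = x at *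
          fin_cases k <;> fin_cases i <;> simp only [Fin.isValue, Fin.zero_eta, Fin.mk_one,
            Fin.reduceFinMk] <;>
            first
            | ring1
            | linear_combination c0 | linear_combination -c0
            | linear_combination c1 | linear_combination -c1
            | linear_combination c2 | linear_combination -c2
    obtain ⟨S, hS, hS0⟩ := hS
    refine ⟨1, S, one_ne_zero, fun i => by rw [hS, one_mul], ?_,
      exists_value_dir_ne_zero (hcurl.trans (congrArg curl hS)) (hrad 0) hS0, Or.inl hS0⟩
    refine hloc.of_mul ↑u⁻¹ fun i => ?_
    rw [← hS, hgW, Units.inv_mul_cancel_left]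

end Normalization

/-! ### Translation between forms and vectors of germs. -/

section Forms

theorem extDeriv_pair {ω : OneForm} {p : C3} (h : DifferentiableAt ℂ ω p) (i j : Fin 3) :
    extDeriv ω p ![e i, e j] = fderiv ℂ (fun q => comps ω q j) p (e i) -
      fderiv ℂ (fun q => comps ω q i) p (e j) := by
  rw [extDeriv_apply h, Fin.sum_univ_two]
  have h0 : (0 : Fin 2).removeNth ![e i, e j] = ![e j] := by
    funext k; fin_cases k; rfl
  have h1 : (1 : Fin 2).removeNth ![e i, e j] = ![e i] := by
    funext k; fin_cases k; rfl
  rw [h0, h1]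
  simp [comps, sub_eq_add_neg]

theorem analyticAt_rot {ω : OneForm} (hω : AnalyticAt ℂ ω 0) : AnalyticAt ℂ (rot ω) 0 := by
  have hc := fun i j => analyticAt_fderiv_apply (analyticAt_comp (analyticAt_comps hω) i) (e j)
  have h : AnalyticAt ℂ (fun p => ![fderiv ℂ (fun q => comps ω q 2) p (e 1) -
      fderiv ℂ (fun q => comps ω q 1) p (e 2), fderiv ℂ (fun q => comps ω q 0) p (e 2) -
      fderiv ℂ (fun q => comps ω q 2) p (e 0), fderiv ℂ (fun q => comps ω q 1) p (e 0) -
      fderiv ℂ (fun q => comps ω q 0) p (e 1)]) 0 := by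
    refine analyticAt_pi_iff.2 fun i => ?_
    fin_cases i
    · exact (hc 2 1).sub (hc 1 2)
    · exact (hc 0 2).sub (hc 2 0)
    · exact (hc 1 0).sub (hc 0 1)
  refine h.congr ?_
  filter_upwards [hω.eventually_analyticAt] with p hp
  simp only [rot, extDeriv_pair hp.differentiableAt]

theorem vgerm_rot {ω : OneForm} (hω : AnalyticAt ℂ ω 0) :
    vgerm (analyticAt_rot hω) = curl (vgerm (analyticAt_comps hω)) := by
  funext i
  rw [vgerm_zero]
  simp only [curl, vgerm_zero, dir_of, of_sub]
  fin_cases i <;> refine of_eq_of.2 ?_ <;>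
    filter_upwards [hω.eventually_analyticAt] with p hp <;>
    simp [rot, extDeriv_pair hp.differentiableAt]

theorem comps_dot_rot {ω : OneForm} (hω : AnalyticAt ℂ ω 0) (hint : IsIntegrable ω) :
    ∑ i, vgerm (analyticAt_comps hω) i * vgerm (analyticAt_rot hω) i = 0 := by
  change vgerm (analyticAt_comps hω) ⬝ᵥ vgerm (analyticAt_rot hω) = 0
  rw [vgerm_dot, mk_transl_eq_zero]
  filter_upwards [hint, hω.eventually_analyticAt] with p hp hd
  have h := hp (e 0) (e 1) (e 2)
  simp only [wedge, extDeriv_pair hd.differentiableAt] at h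
  simp only [dotProduct, Fin.sum_univ_three, rot, extDeriv_pair hd.differentiableAt, Fin.isValue,
    cons_val]
  simp only [comps] at h ⊢
  linear_combination h

theorem rot_eq_zero_iff {ω : OneForm} {p : C3} : rot ω p = 0 ↔ extDeriv ω p = 0 := by
  rw [eq_comm, eq_rot_iff, map_zero]

theorem apply_eq_zero_of_comps {ω : OneForm} {p : C3} (h : comps ω p = 0) : ω p = 0 := by
  ext v
  have hv : v = ![v 0] := by
    funext i; fin_cases i; rfl
  rw [hv, apply_eq_comps_dot, h, zero_dotProduct]
  rfl

end Forms

/-- If some component of `X` is a unit, a vector orthogonal to `X` is a cross product with `X`. -/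
theorem exists_cross_of_isUnit {A : Type*} [CommRing A] {X : Fin 3 → A} {k : Fin 3}
    (hk : IsUnit (X k)) {a : Fin 3 → A} (ha : ∑ i, a i * X i = 0) :
    ∃ S, a = crossProduct S X := by
  obtain ⟨u, hu⟩ := hk
  -- Since `a · X = 0`, `(e_k × a) × X = X_k a`, and `X_k` is invertible.
  refine ⟨fun i => ↑u⁻¹ * crossProduct (Pi.single k 1) a i, ?_⟩
  rw [cross_smul_left]
  funext i
  rw [Units.eq_inv_mul_iff_mul_eq, hu, cross_apply, cross_apply]
  rw [Fin.sum_univ_three] at ha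
  fin_cases k <;> fin_cases i <;> simp <;>
    first | ring1 | linear_combination ha

end SimpleSing

/-! ### The theorem. -/

open SimpleSing AGerm in
theorem mainTheorem6 (ω : SimpleSing.OneForm) (hω : AnalyticAt ℂ ω 0)
    (hint : SimpleSing.IsIntegrable ω) (hsimple : SimpleSing.IsSimpleSingularity ω) :
    SimpleSing.TangentSheafLocallyFree ω ∧
    ∃ (U : Set SimpleSing.C3) (S : SimpleSing.C3 → SimpleSing.C3),
      IsOpen U ∧ (0 : SimpleSing.C3) ∈ U ∧
      SimpleSing.IsFreeFrame ω U ![SimpleSing.rot ω, S] ∧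
      fderiv ℂ S 0 ≠ 0 ∧
      (SimpleSing.SingCodimGETwo ω → S 0 = 0) := by
  suffices h : ∃ (U : Set SimpleSing.C3) (S : SimpleSing.C3 → SimpleSing.C3),
      IsOpen U ∧ (0 : SimpleSing.C3) ∈ U ∧
      SimpleSing.IsFreeFrame ω U ![SimpleSing.rot ω, S] ∧
      fderiv ℂ S 0 ≠ 0 ∧
      (SimpleSing.SingCodimGETwo ω → S 0 = 0) by
    refine ⟨?_, h⟩
    obtain ⟨U, S, hU, h0, hf, -⟩ := h
    exact ⟨U, hU, h0, 2, _, hf⟩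
  have hX := analyticAt_rot hω
  have hval : ∀ i, value (vgerm hX i) = rot ω 0 i := fun i => by rw [vgerm_zero, value_of]
  have hcase : (∃ k, IsUnit (vgerm hX k)) ∨
      ∃ Y : Fin 3 → AnalyticFun C3, (vgerm hX = fun i => AGerm.mk C3 (Y i)) ∧ IsolatedZero Y := by
    rcases hsimple.2 with h | ⟨-, h⟩
    · left
      by_contra! hcon
      refine h (rot_eq_zero_iff.1 (funext fun k => ?_))
      have h1 := hcon k
      rw [AGerm.isUnit_iff, not_not, hval] at h1
      exact h1
    · right
      refine ⟨fun i => transl (analyticAt_comp hX i), rfl, ?_⟩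
      rw [eventually_nhdsWithin_iff] at h
      filter_upwards [h] with p hp hp0
      by_contra hne
      refine hp hne (rot_eq_zero_iff.1 (funext fun i => ?_))
      have h1 : rot ω (0 + p) i = 0 := hp0 i
      rwa [zero_add] at h1
  have hrad : ∀ i, xvar i ∈ (Ideal.span (Set.range (vgerm hX))).radical := by
    intro i
    rcases hcase with ⟨k, hk⟩ | ⟨Y, hY, hiso⟩
    · rw [Ideal.eq_top_of_isUnit_mem _ (Ideal.subset_span (Set.mem_range_self k)) hk,
        Ideal.radical_top]
      trivial
    · rw [hY]
      exact nullstellensatz_C3 _ _ hiso _ (value_xvar i)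
  -- If the germ of `ω` vanished, so would `X`, but the ideal of `X` contains a power of a
  -- coordinate.
  have hwne : ∃ i, vgerm (analyticAt_comps hω) i ≠ 0 := by
    by_contra! hcon
    have h0 : vgerm hX = 0 := by
      have h1 : ∀ v : C3, dir v (0 : AGerm C3) = 0 := fun v => by simpa using dir_const v 0
      rw [vgerm_rot hω, funext hcon]
      funext i
      fin_cases i <;> simp [curl, h1]
    obtain ⟨n, hn⟩ := hrad 0
    rw [h0] at hn
    have h2 := VanishesToOrder.of_mem_span (n := n + 1) (fun i => VanishesToOrder.zero _) hn
    refine one_ne_zero (VanishesToOrder.eq_zero_of_mul_pow (v := e 0) (x := xvar 0) (n := n)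
      (c := 1) (by simpa using pd_xvar 0 0) (by rwa [map_one, one_mul]))
  obtain ⟨g, S, hg, hgS, hloc, ⟨i, v, hv⟩, hS0⟩ := exists_normalized (vgerm_rot hω)
    (fun i => by
      rw [vgerm_zero, value_of, comps, hsimple.1]
      rfl) hwne (by
      intro a ha
      rcases hcase with ⟨k, hk⟩ | ⟨Y, hY, hiso⟩
      · exact exists_cross_of_isUnit hk ha
      · rw [hY] at ha ⊢
        exact exists_cross_of_isolatedZero hiso ha) (comps_dot_rot hω hint) hrad
  obtain ⟨g, hga, rfl⟩ := exists_rep g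
  obtain ⟨S, hS, rfl⟩ := exists_vgerm S
  obtain ⟨U, hU, h0, hframe⟩ := exists_isFreeFrame hω hga hX hS hg hgS hloc
  refine ⟨U, S, hU, h0, hframe, fun hd => hv ?_, fun hcodim => ?_⟩
  · rw [vgerm_zero, value_dir]
    have h1 : HasFDerivAt S (0 : C3 →L[ℂ] C3) 0 := hd ▸ hS.differentiableAt.hasFDerivAt
    have h2 := (hasFDerivAt_pi'.1 h1 i).fderiv
    rw [h2]
    rfl
  · rcases hS0 with h | h
    · funext j
      have h1 := h j
      rwa [vgerm_zero, value_of] at h1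
    -- When `g(0) = 0`, the hypersurface `{g = 0}` lies in the singular set.
    · refine absurd ⟨g, hga, by rwa [value_of] at h, fun h1 => hg (of_eq_zero.2 h1), ?_⟩ hcodim
      have h2 : ∀ᶠ p in 𝓝 (0 : C3), ∀ j, comps ω p j =
          g p * crossProduct (S p) (rot ω p) j := by
        rw [eventually_all]
        intro j
        have h3 := hgS j
        rw [vgerm_cross, vgerm_zero, vgerm_zero, of_mul, of_eq_of] at h3
        exact h3
      filter_upwards [h2] with p hp hgp
      refine apply_eq_zero_of_comps (funext fun j => ?_)
      rw [hp, hgp, zero_mul]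
      rfl
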